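/- Let $\Sigma$ be a monoid and let $W$ be a finite-dimensional real representation of $\Sigma$. Let $\mathrm{End}(W)$ be the real algebra of $\Sigma$-equivariant linear maps $W\to W$. A nonzero representation $V$ is *indecomposable* if it is not the direct sum of two nonzero invariant subspaces. For a finite-dimensional indecomposable $V$, the nilpotent elements form an ideal $\mathrm{nil}(V)$ of $\mathrm{End}(V)$, and $V$ is of *real*, *complex* or *quaternionic type* according to whether the real algebra $\mathrm{End}(V)/\mathrm{nil}(V)$ is isomorphic to $\mathbb R$, $\mathbb C$ or $\mathbb H$. Suppose that $$W\;\cong\;\bigoplus_{i=1}^{u}(W_i^R)^{r_i}\;\oplus\;\bigoplus_{i=1}^{v}(W_i^C)^{c_i}\;\oplus\;\bigoplus_{i=1}^{w}(W_i^H)^{h_i},$$ where the $W_i^R$, $W_i^C$, $W_i^H$ are mutually non-isomorphic finite-dimensional indecomposable representations of $\Sigma$ of real, complex and quaternionic type, respectively, and $r_i,c_i,h_i$ are nonnegative integers. Let $\mathrm{Nil}(W)\subset\mathrm{End}(W)$ be the set of endomorphisms whose generalized kernel (the generalized eigenspace for the eigenvalue $0$) is isomorphic to $W$ as a representation, i.e.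 the nilpotent endomorphisms. Let $\mathrm{Cen}(W)\subset\mathrm{End}(W)$ be the set of endomorphisms whose center subspace (the span of the generalized eigenvectors for all eigenvalues with vanishing real part) is isomorphic to $W$, i.e. the endomorphisms all of whose complex eigenvalues have vanishing real part. Then $\mathrm{Nil}(W)$ is the disjoint union of a finite set of nonempty smooth embedded submanifolds of $\mathrm{End}(W)$, each of codimension $$K_W=r_1+\dots+r_u+2c_1+\dots+2c_v+4h_1+\dots+4h_w$$ or higher, and exactly one of these submanifolds has codimension precisely $K_W$. Moreover these submanifolds are conjugacy invariant: if $M$ is one of them, $A\in M$ and $C\in\mathrm{End}(W)$ is invertible, then $CAC^{-1}\in M$. Likewise, $\mathrm{Cen}(W)$ is the disjoint union of a finite set of nonempty, conjugacy invariant, smooth embedded submanifolds of $\mathrm{End}(W)$, each of codimension $$C_W=\lceil r_1/2\rceil+\dots+\lceil r_u/2\rceil+c_1+\dots+c_v+h_1+\dots+h_w$$ or higher, and exactly one of these submanifolds has codimension precisely $C_W$. -/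

import Mathlib

open scoped ContDiff Quaternion TensorProduct

namespace MonoidRep

section Representations

variable {S : Type*} [Monoid S] {V : Type*} [AddCommGroup V] [Module ℝ V]

/-- The algebra `End(V)` of equivariant linear maps of a real representation to itself. -/
abbrev EquivEnd (ρ : Representation ℝ S V) : Type _ :=
  Representation.IntertwiningMap ρ ρ

/-- A nonzero representation that is not the direct sum of two nonzero invariant subspaces. -/
def IsIndecomposable (ρ : Representation ℝ S V) : Prop :=
  Nontrivial V ∧ ∀ U U' : Subrepresentation ρ, IsCompl U U' → U = ⊥ ∨ U' = ⊥

/-- The nilpotent endomorphisms of `V` form an ideal of `End(V)` and the quotient algebra is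
isomorphic to `D`: there is a surjective morphism of real algebras `End(V) → D` whose kernel is the
set of nilpotent endomorphisms. -/
def HasEndType (ρ : Representation ℝ S V) (D : Type*) [Ring D] [Algebra ℝ D] : Prop :=
  ∃ π : EquivEnd ρ →ₐ[ℝ] D, Function.Surjective π ∧ ∀ A, π A = 0 ↔ IsNilpotent A

/-- Indecomposable representations of real type. -/
def IsRealType (ρ : Representation ℝ S V) : Prop :=
  IsIndecomposable ρ ∧ HasEndType ρ ℝ

/-- Indecomposable representations of complex type. -/
def IsComplexType (ρ : Representation ℝ S V) : Prop :=
  IsIndecomposable ρ ∧ HasEndType ρ ℂ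

/-- Indecomposable representations of quaternionic type. -/
def IsQuaternionicType (ρ : Representation ℝ S V) : Prop :=
  IsIndecomposable ρ ∧ HasEndType ρ ℍ[ℝ]

/-- `⨁ᵢ (⨁^{m i} V i)`: the direct sum in which the `i`-th representation occurs `m i` times. -/
noncomputable abbrev sumWithMult {n : ℕ} {V : Fin n → Type*} [∀ i, AddCommGroup (V i)]
    [∀ i, Module ℝ (V i)] (ρ : ∀ i, Representation ℝ S (V i)) (m : Fin n → ℕ) :=
  Representation.directSum (fun p : (Σ i, Fin (m i)) => ρ p.1)

/-- The generalized kernel of an equivariant endomorphism, as an invariant subspace. -/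
noncomputable def genKernel {ρ : Representation ℝ S V} (A : EquivEnd ρ) : Subrepresentation ρ where
  toSubmodule := Module.End.maxGenEigenspace A.toLinearMap 0
  apply_mem_toSubmodule g := by
    refine Module.End.mapsTo_maxGenEigenspace_of_comm ?_ 0
    exact A.isIntertwining' g

/-- The complexification of an equivariant endomorphism, acting on `ℂ ⊗ V`. -/
noncomputable def complexify {ρ : Representation ℝ S V} (A : EquivEnd ρ) :
    Module.End ℂ (TensorProduct ℝ ℂ V) :=
  A.toLinearMap.baseChange ℂ

/-- The span in `ℂ ⊗ V` of the generalized eigenvectors of (the complexification of) `A` for all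
complex eigenvalues with vanishing real part. -/
noncomputable def complexCenter {ρ : Representation ℝ S V} (A : EquivEnd ρ) :
    Submodule ℂ (TensorProduct ℝ ℂ V) :=
  ⨆ μ : {μ : ℂ // μ.re = 0}, (complexify A).maxGenEigenspace μ

/-- The center subspace of an equivariant endomorphism, as an invariant subspace: the real vectors
in the span of the generalized eigenvectors for all eigenvalues with vanishing real part. -/
noncomputable def centerSubspace {ρ : Representation ℝ S V} (A : EquivEnd ρ) :
    Subrepresentation ρ where
  toSubmodule := ((complexCenter A).restrictScalars ℝ).comap (TensorProduct.mk ℝ ℂ V 1)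
  apply_mem_toSubmodule g := by
    have key : complexCenter A ≤ (complexCenter A).comap ((ρ g).baseChange ℂ) := by
      refine iSup_le fun μ => ?_
      refine le_trans ?_ (Submodule.comap_mono
        (le_iSup (fun μ : {μ : ℂ // μ.re = 0} => (complexify A).maxGenEigenspace μ) μ))
      refine Module.End.mapsTo_maxGenEigenspace_of_comm ?_ _
      change (complexify A).comp ((ρ g).baseChange ℂ) = ((ρ g).baseChange ℂ).comp (complexify A)
      rw [complexify, ← LinearMap.baseChange_comp, ← LinearMap.baseChange_comp,
        A.isIntertwining' g]
    intro v hv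
    have := key hv
    simpa using this

variable {U : Type*} [AddCommGroup U] [Module ℝ U]

/-- `Nil(U)`: the elements of `End(W)` whose generalized kernel is isomorphic to `U`. -/
def nilSet (ρ : Representation ℝ S V) (σ : Representation ℝ S U) : Set (EquivEnd ρ) :=
  {A | Nonempty ((genKernel A).toRepresentation.Equiv σ)}

/-- `Cen(U)`: the elements of `End(W)` whose center subspace is isomorphic to `U`. -/
def cenSet (ρ : Representation ℝ S V) (σ : Representation ℝ S U) : Set (EquivEnd ρ) :=
  {A | Nonempty ((centerSubspace A).toRepresentation.Equiv σ)}

theorem genKernel_eq_top_iff [FiniteDimensional ℝ V] {ρ : Representation ℝ S V} (A : EquivEnd ρ) :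
    (genKernel A).toSubmodule = ⊤ ↔ IsNilpotent A := by
  have hpow : ∀ n : ℕ, (A ^ n).toLinearMap = A.toLinearMap ^ n := by
    intro n
    induction n with
    | zero => rfl
    | succ n ih => rw [pow_succ, pow_succ, ← ih]; rfl
  change Module.End.maxGenEigenspace A.toLinearMap 0 = ⊤ ↔ _
  constructor
  · intro h
    rw [Module.End.maxGenEigenspace_eq_genEigenspace_finrank, Module.End.genEigenspace_zero_nat,
      LinearMap.ker_eq_top] at h
    exact ⟨_, Representation.IntertwiningMap.ext ((hpow _).trans h)⟩
  · rintro ⟨n, hn⟩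
    rw [eq_top_iff]
    intro v _
    rw [Module.End.mem_maxGenEigenspace]
    refine ⟨n, ?_⟩
    rw [zero_smul, sub_zero, ← hpow, hn]
    rfl

theorem centerSubspace_eq_top_iff [FiniteDimensional ℝ V] {ρ : Representation ℝ S V}
    (A : EquivEnd ρ) :
    (centerSubspace A).toSubmodule = ⊤ ↔
      ∀ μ : ℂ, (complexify A).HasEigenvalue μ → μ.re = 0 := by
  have h1 : (centerSubspace A).toSubmodule = ⊤ ↔ complexCenter A = ⊤ := by
    constructor
    · intro h
      rw [eq_top_iff]
      intro x _
      induction x with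
      | zero => exact zero_mem _
      | add x y hx hy => exact add_mem (hx trivial) (hy trivial)
      | tmul z v =>
        have hv : v ∈ (centerSubspace A).toSubmodule := h ▸ Submodule.mem_top
        have hv' : (1 : ℂ) ⊗ₜ[ℝ] v ∈ complexCenter A := hv
        have := (complexCenter A).smul_mem z hv'
        rwa [TensorProduct.smul_tmul', smul_eq_mul, mul_one] at this
    · intro h
      rw [eq_top_iff]
      intro v _
      change (1 : ℂ) ⊗ₜ[ℝ] v ∈ complexCenter A
      rw [h]
      trivial
  rw [h1]
  constructor
  · intro h μ hμ
    by_contra hne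
    have hind := (Module.End.independent_maxGenEigenspace (complexify A)) μ
    have hle : complexCenter A ≤ ⨆ j, ⨆ (_ : j ≠ μ), (complexify A).maxGenEigenspace j :=
      iSup_le fun ν => le_iSup₂_of_le ν.1 (fun hν => hne (hν ▸ ν.2)) le_rfl
    rw [h, top_le_iff] at hle
    rw [hle, disjoint_top] at hind
    refine hμ (eq_bot_iff.2 ?_)
    rw [← hind]
    exact ((complexify A).genEigenspace μ).monotone le_top
  · intro h
    rw [eq_top_iff, ← Module.End.iSup_maxGenEigenspace_eq_top (complexify A)]
    refine iSup_le fun μ => ?_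
    by_cases hμ : (complexify A).HasEigenvalue μ
    · exact le_iSup (fun μ : {μ : ℂ // μ.re = 0} => (complexify A).maxGenEigenspace μ) ⟨μ, h μ hμ⟩
    · have : (complexify A).maxGenEigenspace μ = ⊥ := by
        by_contra hne
        exact hμ (Module.End.hasEigenvalue_of_hasGenEigenvalue (k := Module.finrank ℂ _) (by
          rw [Module.End.maxGenEigenspace_eq_genEigenspace_finrank] at hne
          exact hne))
      rw [this]
      exact bot_le

theorem nonempty_equiv_self_iff [FiniteDimensional ℝ V] {ρ : Representation ℝ S V}
    (P : Subrepresentation ρ) : Nonempty (P.toRepresentation.Equiv ρ) ↔ P.toSubmodule = ⊤ := by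
  constructor
  · rintro ⟨e⟩
    exact Submodule.eq_top_of_finrank_eq e.toLinearEquiv.finrank_eq
  · intro h
    exact ⟨Representation.Equiv.mk (LinearEquiv.ofTop _ h) (fun g => rfl)⟩

/-- `Nil(W)` is the set of nilpotent elements of `End(W)`. -/
theorem mem_nilSet_self [FiniteDimensional ℝ V] (ρ : Representation ℝ S V) (A : EquivEnd ρ) :
    A ∈ nilSet ρ ρ ↔ IsNilpotent A :=
  (nonempty_equiv_self_iff _).trans (genKernel_eq_top_iff A)

/-- `Cen(W)` is the set of elements of `End(W)` with purely imaginary spectrum. -/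
theorem mem_cenSet_self [FiniteDimensional ℝ V] (ρ : Representation ℝ S V) (A : EquivEnd ρ) :
    A ∈ cenSet ρ ρ ↔ ∀ μ : ℂ, (complexify A).HasEigenvalue μ → μ.re = 0 :=
  (nonempty_equiv_self_iff _).trans (centerSubspace_eq_top_iff A)

end Representations

section Submanifolds

/-- `M` is a smooth embedded submanifold of `E`, of codimension `k` at each of its points: near
each point of `M` it is the zero set of a smooth submersion to `ℝ^k`. -/
def IsEmbeddedSubmanifold {E : Type*} [NormedAddCommGroup E] [NormedSpace ℝ E]
    (M : Set E) (k : ℕ) : Prop :=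
  ∀ x ∈ M, ∃ O : Set E, IsOpen O ∧ x ∈ O ∧ ∃ f : E → (Fin k → ℝ), ContDiffOn ℝ ∞ f O ∧
    (∀ y ∈ O, Function.Surjective (fderiv ℝ f y)) ∧ M ∩ O = {y ∈ O | f y = 0}

/-- The same notion in a finite-dimensional real vector space `E`, read in linear coordinates
`E ≃ ℝ^n`; see `isEmbeddedSubmanifoldOf_iff` for the independence of the coordinates. -/
def IsEmbeddedSubmanifoldOf (E : Type*) [AddCommGroup E] [Module ℝ E] [FiniteDimensional ℝ E]
    (M : Set E) (k : ℕ) : Prop :=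
  IsEmbeddedSubmanifold ((Module.finBasis ℝ E).equivFun '' M) k

theorem IsEmbeddedSubmanifold.image {E F : Type*} [NormedAddCommGroup E] [NormedSpace ℝ E]
    [NormedAddCommGroup F] [NormedSpace ℝ F] {M : Set E} {k : ℕ}
    (h : IsEmbeddedSubmanifold M k) (e : E ≃L[ℝ] F) : IsEmbeddedSubmanifold (e '' M) k := by
  rintro _ ⟨x, hx, rfl⟩
  obtain ⟨O, hO, hxO, f, hf, hs, hM⟩ := h x hx
  refine ⟨e.symm ⁻¹' O, hO.preimage e.symm.continuous, by simpa using hxO, f ∘ e.symm,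
    hf.comp e.symm.contDiff.contDiffOn (fun y hy => hy), ?_, ?_⟩
  · intro y hy
    rw [e.symm.comp_right_fderiv]
    exact (hs _ hy).comp e.symm.surjective
  · ext y
    have key := Set.ext_iff.1 hM (e.symm y)
    have hmem : y ∈ e '' M ↔ e.symm y ∈ M :=
      ⟨by rintro ⟨x, hx, rfl⟩; simpa using hx, fun hy => ⟨_, hy, by simp⟩⟩
    change y ∈ e '' M ∧ e.symm y ∈ O ↔ _
    rw [hmem]
    exact key

theorem isEmbeddedSubmanifoldOf_iff {E F : Type*} [AddCommGroup E] [Module ℝ E]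
    [FiniteDimensional ℝ E] [NormedAddCommGroup F] [NormedSpace ℝ F] (e : E ≃ₗ[ℝ] F)
    (M : Set E) (k : ℕ) :
    IsEmbeddedSubmanifoldOf E M k ↔ IsEmbeddedSubmanifold (e '' M) k := by
  have : FiniteDimensional ℝ F := e.finiteDimensional
  let b := (Module.finBasis ℝ E).equivFun
  let φ : (Fin (Module.finrank ℝ E) → ℝ) ≃L[ℝ] F := (b.symm.trans e).toContinuousLinearEquiv
  have h1 : e '' M = φ '' (b '' M) := by
    rw [← Set.image_comp]; congr 1; ext x; simp [φ]
  have h2 : b '' M = φ.symm '' (e '' M) := by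
    rw [h1, ← Set.image_comp]; simp
  constructor
  · intro h
    rw [h1]
    exact IsEmbeddedSubmanifold.image h φ
  · intro h
    change IsEmbeddedSubmanifold (b '' M) k
    rw [h2]
    exact h.image φ.symm

end Submanifolds

section Stratification

variable {S : Type*} [Monoid S] {V : Type*} [AddCommGroup V] [Module ℝ V]

/-- `X ⊆ End(V)` is the disjoint union of finitely many (nonempty) conjugacy invariant embedded
submanifolds of `End(V)` of codimension `K` or higher, exactly one of which has codimension
precisely `K`. -/
def IsUnionOfInvariantSubmanifolds [FiniteDimensional ℝ V] (ρ : Representation ℝ S V)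
    (X : Set (EquivEnd ρ)) (K : ℕ) : Prop :=
  ∃ 𝓜 : Set (Set (EquivEnd ρ)), 𝓜.Finite ∧ 𝓜.PairwiseDisjoint id ∧ ⋃₀ 𝓜 = X ∧
    (∀ M ∈ 𝓜, M.Nonempty) ∧
    (∀ M ∈ 𝓜, ∀ A ∈ M, ∀ C : (EquivEnd ρ)ˣ, C.val * A * C⁻¹.val ∈ M) ∧
    (∀ M ∈ 𝓜, ∃ k, K ≤ k ∧ IsEmbeddedSubmanifoldOf (EquivEnd ρ) M k) ∧
    (∃! M, M ∈ 𝓜 ∧ IsEmbeddedSubmanifoldOf (EquivEnd ρ) M K)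

end Stratification

end MonoidRep

/-! Modulo a nil ideal, End(W) is a product of matrix algebras over ℝ, ℂ and ℍ, one for each
indecomposable summand, of size its multiplicity (`exists_blockAlg_hom`). An endomorphism that
factors through a non-isomorphic indecomposable is nilpotent, and a kernel whose elements all have
trace zero is nil. Nilpotency and purely imaginary spectrum are both detected modulo a nil ideal,
and preimages of submanifolds under surjective linear maps keep their codimension. In a product the
codimensions add up, and a sum of lower bounds is attained only if each bound is. So it suffices to
stratify each matrix algebra with a single stratum of minimal codimension (`HasStrat`).

Nilpotent matrices in M_n(D) are sorted by the dimension `cdim` of their centralizer, which is the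
codimension of the conjugacy class. Near a nilpotent A₀ this stratum is given by the ranks of the
powers: these ranks can only rise near A₀, `cdim` is dim D times the sum of the squares of the
successive rank drops, and a majorization argument forces equality (`rankStratum_eventually`).
Prescribing the ranks of all powers gives a submanifold, by induction on the dimension through a
transversal slice (`rankStratum_submfdAt_aux`). The least value, n · dim D, is attained by a single
Jordan block.

For imaginary spectrum, write A = S + N with S semisimple, N nilpotent, SN = NS. Besides
conjugation, the stratum allows the distinct eigenvalues to slide along the imaginary axis; these
motions form the space `imCenter S` of imaginary elements of the double centralizer of S. In a slice
through A, the stratum of fixed `imDim` and `cdim` is exactly A + `imCenter S` near A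
(`cenStratum_eventually`), hence has codimension `cdim A - imDim A`. The two inputs are that the
centralizer of S is again a semisimple algebra, so that the nilpotent case applies inside it, and
that the trace form is definite on `imCenter S`.

Finally `cdim` is at least R and `imDim` at most R/2, where R = n over ℝ and R = 2n over ℂ and ℍ. A
companion or diagonal matrix with distinct imaginary eigenvalues attains both bounds at once
(`hasStrat_cen`), which gives ⌈n/2⌉, n and n. -/

open scoped ContDiff Quaternion TensorProduct

namespace MonoidRep

open Filter Topology Module

set_option linter.unusedSectionVars false

/-! ### Germs of submanifolds: pullback, products, descent along submersions -/

section Submfd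

variable {E F G : Type*} [NormedAddCommGroup E] [NormedSpace ℝ E] [FiniteDimensional ℝ E]
  [NormedAddCommGroup F] [NormedSpace ℝ F] [FiniteDimensional ℝ F]
  [NormedAddCommGroup G] [NormedSpace ℝ G] [FiniteDimensional ℝ G]

/-- Near `x`, the set `M` is the zero set of an analytic submersion to `ℝ^k`. -/
def SubmfdAt (M : Set E) (k : ℕ) (x : E) : Prop :=
  ∃ f : E → (Fin k → ℝ), ContDiffAt ℝ ω f x ∧ Function.Surjective (fderiv ℝ f x) ∧
    ∀ᶠ y in 𝓝 x, y ∈ M ↔ f y = 0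

theorem SubmfdAt.congr {M N : Set E} {k : ℕ} {x : E} (h : SubmfdAt M k x)
    (hMN : ∀ᶠ y in 𝓝 x, y ∈ N ↔ y ∈ M) : SubmfdAt N k x := by
  obtain ⟨f, hf, hs, hM⟩ := h
  exact ⟨f, hf, hs, by filter_upwards [hM, hMN] with y h1 h2 using h2.trans h1⟩

theorem SubmfdAt.of_map {M : Set E} {k : ℕ} {x : E} (f : E → F) (f' : E →L[ℝ] F)
    (hf : ContDiffAt ℝ ω f x) (hf' : HasFDerivAt f f' x) (hs : Function.Surjective f')
    (hM : ∀ᶠ y in 𝓝 x, y ∈ M ↔ f y = 0) (hk : finrank ℝ F = k) : SubmfdAt M k x := by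
  let e : F ≃L[ℝ] (Fin k → ℝ) :=
    (LinearEquiv.ofFinrankEq F (Fin k → ℝ) (by simpa using hk)).toContinuousLinearEquiv
  refine ⟨fun y => e (f y), e.contDiff.contDiffAt.comp x hf, ?_, ?_⟩
  · have : HasFDerivAt (fun y => e (f y)) ((e : F →L[ℝ] (Fin k → ℝ)).comp f') x :=
      e.hasFDerivAt.comp x hf'
    rw [this.fderiv]
    exact e.surjective.comp hs
  · filter_upwards [hM] with y hy
    rw [hy]
    simp

theorem SubmfdAt.exists_hasStrictFDerivAt {M : Set E} {k : ℕ} {x : E} (h : SubmfdAt M k x) :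
    ∃ (f : E → (Fin k → ℝ)) (f' : E →L[ℝ] (Fin k → ℝ)), ContDiffAt ℝ ω f x ∧
      HasStrictFDerivAt f f' x ∧ Function.Surjective f' ∧ ∀ᶠ y in 𝓝 x, y ∈ M ↔ f y = 0 := by
  obtain ⟨f, hf, hs, hM⟩ := h
  exact ⟨f, fderiv ℝ f x, hf, hf.hasStrictFDerivAt (by simp), hs, hM⟩

/-- If `f` is constant on the fibre of a submersion `Ψ` through `a`, its derivative kills the kernel
of the derivative of `Ψ`. -/
theorem deriv_eq_zero_of_const_on_fibre {Ψ : E → F} {Ψ' : E →L[ℝ] F} {a : E}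
    (hΨ : HasStrictFDerivAt Ψ Ψ' a) (hs : Function.Surjective Ψ') {f : E → G} {f' : E →L[ℝ] G}
    (hf : HasFDerivAt f f' a) (h : ∀ᶠ y in 𝓝 a, Ψ y = Ψ a → f y = f a) {v : E} (hv : Ψ' v = 0) :
    f' v = 0 := by
  have := FiniteDimensional.complete ℝ E
  have hr : Ψ'.range = ⊤ := LinearMap.range_eq_top.2 hs
  -- `g` parametrizes the fibre of Ψ through `a`, with derivative the inclusion of `ker Ψ'`. As `f ∘
  -- g` is locally constant, `f'` vanishes on that kernel.
  let g : Ψ'.ker → E := hΨ.implicitFunction Ψ Ψ' hr (Ψ a)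
  have hg : HasStrictFDerivAt g Ψ'.ker.subtypeL 0 := hΨ.to_implicitFunction hr
  have hg0 : g 0 = a := hΨ.implicitFunction_apply_image hr
  have h1 : ∀ᶠ p in 𝓝 (0 : Ψ'.ker), Ψ (g p) = Ψ a := by
    have := hΨ.map_implicitFunction_eq hr
    have hc : Tendsto (fun p : Ψ'.ker => (Ψ a, p)) (𝓝 0) (𝓝 (Ψ a, 0)) :=
      (continuous_const.prodMk continuous_id).tendsto 0
    exact hc.eventually this
  have h2 : ∀ᶠ p in 𝓝 (0 : Ψ'.ker), f (g p) = f a := by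
    have hc : Tendsto g (𝓝 0) (𝓝 a) := by
      have := hg.continuousAt
      rwa [ContinuousAt, hg0] at this
    filter_upwards [h1, hc.eventually h] with p hp hp' using hp' hp
  have h3 : HasFDerivAt (fun p => f (g p)) (f'.comp Ψ'.ker.subtypeL) 0 := by
    refine HasFDerivAt.comp (0 : Ψ'.ker) ?_ hg.hasFDerivAt
    rw [hg0]
    exact hf
  have h4 : HasFDerivAt (fun p => f (g p)) (0 : Ψ'.ker →L[ℝ] G) 0 :=
    (hasFDerivAt_const (f a) (0 : Ψ'.ker)).congr_of_eventuallyEq h2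
  have := congrArg (fun L => L (⟨v, hv⟩ : Ψ'.ker)) (h3.unique h4)
  simpa using this

/-- Pullback along an affine submersion. -/
theorem SubmfdAt.comap_affine {M : Set F} {k : ℕ} {x : E} (L : E →ₗ[ℝ] F)
    (hL : Function.Surjective L) (c : F) (h : SubmfdAt M k (c + L x)) :
    SubmfdAt {y | c + L y ∈ M} k x := by
  obtain ⟨f, f', hf, hf', hs, hM⟩ := h.exists_hasStrictFDerivAt
  let L' : E →L[ℝ] F := L.toContinuousLinearMap
  have hd : HasFDerivAt (fun y => c + L y) L' x := (L'.hasFDerivAt (x := x)).const_add c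
  have hc : ContDiffAt ℝ ω (fun y => c + L y) x := contDiffAt_const.add L'.contDiff.contDiffAt
  exact SubmfdAt.of_map (fun y => f (c + L y)) (f'.comp L')
    (ContDiffAt.comp x hf hc) (HasFDerivAt.comp x hf'.hasFDerivAt hd) (hs.comp hL)
    (hc.continuousAt.tendsto.eventually hM) (by simp)

theorem SubmfdAt.comap_linear {M : Set F} {k : ℕ} {x : E} (L : E →ₗ[ℝ] F)
    (hL : Function.Surjective L) (h : SubmfdAt M k (L x)) : SubmfdAt {y | L y ∈ M} k x := by
  have := SubmfdAt.comap_affine (x := x) L hL 0 (by simpa using h)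
  simpa using this

theorem SubmfdAt.prod {M : Set E} {N : Set F} {k l : ℕ} {x : E} {y : F} (hM : SubmfdAt M k x)
    (hN : SubmfdAt N l y) : SubmfdAt (M ×ˢ N) (k + l) (x, y) := by
  obtain ⟨f, f', hf, hf', hfs, hfM⟩ := hM.exists_hasStrictFDerivAt
  obtain ⟨g, g', hg, hg', hgs, hgM⟩ := hN.exists_hasStrictFDerivAt
  refine SubmfdAt.of_map (fun p : E × F => (f p.1, g p.2)) (f'.prodMap g') ?_ ?_ ?_ ?_ (by simp)
  · exact (hf.fst'' (x := (x, y))).prodMk (hg.snd'' (x := (x, y)))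
  · exact hf'.hasFDerivAt.prodMap (p := (x, y)) hg'.hasFDerivAt
  · exact hfs.prodMap hgs
  · have h1 : ∀ᶠ p in 𝓝 (x, y), p.1 ∈ M ↔ f p.1 = 0 := (continuous_fst.tendsto (x, y)).eventually hfM
    have h2 : ∀ᶠ p in 𝓝 (x, y), p.2 ∈ N ↔ g p.2 = 0 := (continuous_snd.tendsto (x, y)).eventually hgM
    filter_upwards [h1, h2] with p h1 h2
    rw [Set.mem_prod, h1, h2, Prod.mk_eq_zero]

theorem SubmfdAt.pi {ι : Type*} [Fintype ι] {V : ι → Type*} [∀ i, NormedAddCommGroup (V i)]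
    [∀ i, NormedSpace ℝ (V i)] [∀ i, FiniteDimensional ℝ (V i)] {M : ∀ i, Set (V i)} {k : ι → ℕ}
    {x : ∀ i, V i} (h : ∀ i, SubmfdAt (M i) (k i) (x i)) :
    SubmfdAt (Set.univ.pi M) (∑ i, k i) x := by
  choose f f' hf hf' hs hM using fun i => (h i).exists_hasStrictFDerivAt
  refine SubmfdAt.of_map (F := ∀ i, Fin (k i) → ℝ) (fun y i => f i (y i))
    (ContinuousLinearMap.pi fun i => (f' i).comp (ContinuousLinearMap.proj i)) ?_ ?_ ?_ ?_ ?_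
  · rw [contDiffAt_pi]
    intro i
    exact ContDiffAt.comp x (hf i) (ContinuousLinearMap.proj (R := ℝ) (φ := V) i).contDiff.contDiffAt
  · rw [hasFDerivAt_pi]
    intro i
    exact HasFDerivAt.comp x (hf' i).hasFDerivAt (ContinuousLinearMap.proj (R := ℝ) (φ := V) i).hasFDerivAt
  · intro w
    choose v hv using fun i => hs i (w i)
    exact ⟨v, funext hv⟩
  · have : ∀ᶠ y in 𝓝 x, ∀ i, y i ∈ M i ↔ f i (y i) = 0 :=
      eventually_all.2 fun i => ((continuous_apply i).tendsto x).eventually (hM i)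
    filter_upwards [this] with y hy
    simp only [Set.mem_univ_pi, funext_iff, Pi.zero_apply]
    exact forall_congr' fun i => (hy i).trans funext_iff
  · simp [Module.finrank_pi_fintype]

/-- The zero set of a surjective linear map inside which a further condition is imposed. -/
theorem SubmfdAt.inter_ker {H : Type*} [AddCommGroup H] [Module ℝ H] [FiniteDimensional ℝ H]
    {M : Set F} {k : ℕ} {x : E} (K : E →ₗ[ℝ] H) (L : E →ₗ[ℝ] F) (c : F)
    (hs : ∀ a b, ∃ y, K y = a ∧ L y = b) (h : SubmfdAt M k (c + L x)) :
    SubmfdAt {y | K y = 0 ∧ c + L y ∈ M} (finrank ℝ H + k) x := by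
  let e : H ≃ₗ[ℝ] (Fin (finrank ℝ H) → ℝ) := LinearEquiv.ofFinrankEq _ _ (by simp)
  have h0 : SubmfdAt ({0} : Set (Fin (finrank ℝ H) → ℝ)) (finrank ℝ H) (e (K x)) :=
    SubmfdAt.of_map (F := Fin (finrank ℝ H) → ℝ) id (ContinuousLinearMap.id ℝ _) contDiffAt_id
      (hasFDerivAt_id _) Function.surjective_id (by simp) (by simp)
  have h1 := SubmfdAt.comap_affine (x := x) ((e.toLinearMap ∘ₗ K).prod L)
    (by
      rintro ⟨a, b⟩
      obtain ⟨y, hy, hy'⟩ := hs (e.symm a) b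
      exact ⟨y, by simp [hy, hy']⟩) (0, c) (by simpa using h0.prod h)
  refine h1.congr (Eventually.of_forall fun y => ?_)
  simp

/-- A linear subspace. -/
theorem SubmfdAt.submodule (L : Submodule ℝ E) (x : E) :
    SubmfdAt (L : Set E) (finrank ℝ E - finrank ℝ L) x := by
  have h0 : SubmfdAt (Set.univ : Set (Fin 0 → ℝ)) 0 0 :=
    SubmfdAt.of_map (F := Fin 0 → ℝ) id (ContinuousLinearMap.id ℝ _) contDiffAt_id
      (hasFDerivAt_id _) Function.surjective_id
      (Eventually.of_forall fun y => by simp [Subsingleton.elim y 0]) (by simp)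
  have := SubmfdAt.inter_ker (x := x) L.mkQ (0 : E →ₗ[ℝ] (Fin 0 → ℝ)) 0 (fun a b => by
    obtain ⟨y, rfl⟩ := L.mkQ_surjective a
    exact ⟨y, rfl, Subsingleton.elim _ _⟩) (by simpa using h0)
  have hd := L.finrank_quotient_add_finrank
  rw [show finrank ℝ E - finrank ℝ L = finrank ℝ (E ⧸ L) + 0 by omega]
  refine this.congr (Eventually.of_forall fun y => ?_)
  simp

/-- A set whose preimage under a submersion is a submanifold is a submanifold. -/
theorem SubmfdAt.of_comap {Ψ : E → F} {Ψ' : E →L[ℝ] F} {a : E} (hc : ContDiffAt ℝ ω Ψ a)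
    (hΨ : HasFDerivAt Ψ Ψ' a) (hs : Function.Surjective Ψ') {M : Set F} (ha : Ψ a ∈ M) {k : ℕ}
    (h : SubmfdAt (Ψ ⁻¹' M) k a) : SubmfdAt M k (Ψ a) := by
  have := FiniteDimensional.complete ℝ E
  have := FiniteDimensional.complete ℝ F
  obtain ⟨f, f', hf, hf', hfs, hM⟩ := h.exists_hasStrictFDerivAt
  have hfa : f a = 0 := hM.self_of_nhds.1 ha
  have hΨs : HasStrictFDerivAt Ψ Ψ' a := hc.hasStrictFDerivAt' hΨ (by simp)
  -- The preimage of `M` contains the whole fibre through `a`, so `f` vanishes on this fibre near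
  -- `a` and `f'` factors through Ψ'.
  have hker : ∀ v, Ψ' v = 0 → f' v = 0 := fun v hv =>
    deriv_eq_zero_of_const_on_fibre hΨs hs hf'.hasFDerivAt (by
      filter_upwards [hM] with y hy h1
      rw [hfa, ← hy, Set.mem_preimage, h1]
      exact ha) hv
  obtain ⟨R₀, hR₀⟩ := (Ψ' : E →ₗ[ℝ] F).exists_rightInverse_of_surjective
    (LinearMap.range_eq_top.2 hs)
  let R : F →L[ℝ] E := R₀.toContinuousLinearMap
  have hR : ∀ u, Ψ' (R u) = u := fun u => LinearMap.congr_fun hR₀ u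
  -- Restricted to the affine space `a + R(F)`, Ψ has derivative the identity. Its local inverse `s`
  -- gives an analytic section `t = a + R ∘ s` of Ψ through `a`, and `f ∘ t` is the submersion that
  -- defines `M`.
  let φ : F → F := fun u => Ψ (a + R u)
  have hφ0 : φ 0 = Ψ a := by simp [φ]
  have hin : ContDiffAt ℝ ω (fun u => a + R u) (0 : F) :=
    contDiffAt_const.add R.contDiff.contDiffAt
  have hin' : HasFDerivAt (fun u => a + R u) R (0 : F) := (R.hasFDerivAt (x := 0)).const_add a
  have h0 : a + R 0 = a := by simp
  have hφc : ContDiffAt ℝ ω φ 0 := ContDiffAt.comp (0 : F) (h0.symm ▸ hc) hin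
  have hφ' : HasFDerivAt φ ((ContinuousLinearEquiv.refl ℝ F : F ≃L[ℝ] F) : F →L[ℝ] F) 0 := by
    have h1 : HasFDerivAt φ (Ψ'.comp R) 0 :=
      HasFDerivAt.comp (0 : F) (g := Ψ) (h0.symm ▸ hΨ) hin'
    convert h1 using 1
    ext u
    simp [hR]
  have hω : (ω : WithTop ℕ∞) ≠ 0 := by simp
  let s : F → F := hφc.localInverse hφ' hω
  have hsc : ContDiffAt ℝ ω s (Ψ a) := hφ0 ▸ hφc.to_localInverse hφ' hω
  have hs0 : s (Ψ a) = 0 := by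
    have := hφc.localInverse_apply_image hφ' hω
    rwa [hφ0] at this
  have hst := hφc.hasStrictFDerivAt' hφ' hω
  have hsr : ∀ᶠ y in 𝓝 (Ψ a), φ (s y) = y := by
    have := hst.eventually_right_inverse
    rwa [hφ0] at this
  have hsd : HasFDerivAt s (ContinuousLinearMap.id ℝ F) (Ψ a) := by
    have := hst.to_localInverse.hasFDerivAt
    rw [hφ0] at this
    exact this
  let t : F → E := fun y => a + R (s y)
  have ht0 : t (Ψ a) = a := by simp [t, hs0]
  have htc : ContDiffAt ℝ ω t (Ψ a) :=
    contDiffAt_const.add (R.contDiff.contDiffAt.comp _ hsc)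
  have htd : HasFDerivAt t R (Ψ a) := by
    have h1 : HasFDerivAt (fun y => R (s y)) (R.comp (ContinuousLinearMap.id ℝ F)) (Ψ a) :=
      R.hasFDerivAt.comp (Ψ a) hsd
    exact h1.const_add a
  refine SubmfdAt.of_map (fun y => f (t y)) (f'.comp R) (ContDiffAt.comp _ (ht0.symm ▸ hf) htc)
    (HasFDerivAt.comp (Ψ a) (g := f) (ht0.symm ▸ hf'.hasFDerivAt) htd) ?_ ?_ (by simp)
  · intro w
    obtain ⟨v, rfl⟩ := hfs w
    refine ⟨Ψ' v, ?_⟩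
    have := hker (R (Ψ' v) - v) (by simp [hR])
    rw [map_sub, sub_eq_zero] at this
    exact this
  · have htt : Tendsto t (𝓝 (Ψ a)) (𝓝 a) := by
      have := htc.continuousAt
      rwa [ContinuousAt, ht0] at this
    filter_upwards [htt.eventually hM, hsr] with y hy hy'
    rw [← hy, Set.mem_preimage]
    change y ∈ M ↔ φ (s y) ∈ M
    rw [hy']

/-- If a submanifold meets a transversal subspace of complementary dimension at `x`, and some
tangent directions `T` together with `Y` span, then `x` is isolated in the intersection. -/
theorem SubmfdAt.isolated {M : Set E} {k : ℕ} {x : E} (h : SubmfdAt M k x) (hx : x ∈ M)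
    (Y : Submodule ℝ E) (hY : finrank ℝ Y = k)
    (hT : ∀ v, ∃ y ∈ Y, ∃ (f : ℝ → E), HasDerivAt f (v - y) 0 ∧ f 0 = x ∧ ∀ᶠ t in 𝓝 0, f t ∈ M) :
    ∀ᶠ y : Y in 𝓝 0, x + (y : E) ∈ M → y = 0 := by
  obtain ⟨f, f', hf, hf', hs, hM⟩ := h.exists_hasStrictFDerivAt
  have hfx : f x = 0 := hM.self_of_nhds.1 hx
  -- Velocities of curves in `M` are killed by `f'`, so `f'` takes on `Y` all the values that it
  -- takes on the whole space. By dimension it is bijective on `Y`, and the inverse function theorem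
  -- makes `f` injective on `x + Y` near `x`.
  have hsurj : Function.Surjective (fun y : Y => f' y) := by
    intro w
    obtain ⟨v, rfl⟩ := hs w
    obtain ⟨y, hy, g, hg, hg0, hgM⟩ := hT v
    refine ⟨⟨y, hy⟩, ?_⟩
    have hgt : Tendsto g (𝓝 0) (𝓝 x) := by
      have := hg.continuousAt
      rwa [ContinuousAt, hg0] at this
    have h1 : HasDerivAt (fun t => f (g t)) (f' (v - y)) 0 :=
      HasFDerivAt.comp_hasDerivAt (0 : ℝ) (l := f) (hg0.symm ▸ hf'.hasFDerivAt) hg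
    have h2 : HasDerivAt (fun t => f (g t)) 0 0 := by
      refine (hasDerivAt_const (0 : ℝ) (0 : Fin k → ℝ)).congr_of_eventuallyEq ?_
      filter_upwards [hgt.eventually hM, hgM] with t h1 h2 using h1.1 h2
    have := h1.unique h2
    rw [map_sub, sub_eq_zero] at this
    exact this.symm
  let e : Y ≃ₗ[ℝ] (Fin k → ℝ) := LinearEquiv.ofBijective ((f' : E →ₗ[ℝ] _) ∘ₗ Y.subtype)
    ⟨(LinearMap.injective_iff_surjective_of_finrank_eq_finrank (by simp [hY])).2 hsurj, hsurj⟩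
  let e' : Y ≃L[ℝ] (Fin k → ℝ) := e.toContinuousLinearEquiv
  have hin : HasStrictFDerivAt (fun y : Y => x + (y : E)) Y.subtypeL 0 :=
    (Y.subtypeL.hasStrictFDerivAt (x := 0)).const_add x
  have h0 : x + ((0 : Y) : E) = x := by simp
  have hd : HasStrictFDerivAt (fun y : Y => f (x + (y : E))) (e' : Y →L[ℝ] (Fin k → ℝ)) 0 := by
    have h1 := HasStrictFDerivAt.comp (0 : Y) (g := f) (h0.symm ▸ hf') hin
    exact h1
  have := FiniteDimensional.complete ℝ Y
  have ht : Tendsto (fun y : Y => x + (y : E)) (𝓝 0) (𝓝 x) := by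
    have h5 : Tendsto (fun y : Y => x + (y : E)) (𝓝 0) (𝓝 (x + ((0 : Y) : E))) := hin.continuousAt
    rwa [h0] at h5
  have hl := hd.eventually_left_inverse
  filter_upwards [hl, ht.eventually hM] with y h1 h2 h3
  have h4 := hd.localInverse_apply_image
  simp only [h0, hfx] at h4
  rw [h2] at h3
  rw [h3, h4] at h1
  exact h1.symm

/-- Passage from the germ form to the definition of an embedded submanifold. -/
theorem isEmbeddedSubmanifold_of_submfdAt {M : Set E} {k : ℕ} (h : ∀ x ∈ M, SubmfdAt M k x) :
    IsEmbeddedSubmanifold M k := by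
  intro x hx
  obtain ⟨f, hf, hs, hM⟩ := h x hx
  have h1 : ∀ᶠ y in 𝓝 x, ContDiffAt ℝ ω f y := hf.eventually (by simp)
  -- Surjectivity is an open condition: composed with a fixed right inverse of the derivative at
  -- `x`, the nearby derivatives are units.
  have h2 : ∀ᶠ y in 𝓝 x, Function.Surjective (fderiv ℝ f y) := by
    obtain ⟨R₀, hR₀⟩ := (fderiv ℝ f x).toLinearMap.exists_rightInverse_of_surjective
      (LinearMap.range_eq_top.2 hs)
    let R : (Fin k → ℝ) →L[ℝ] E := R₀.toContinuousLinearMap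
    have hc : ContinuousAt (fun y => (fderiv ℝ f y).comp R) x :=
      ((hf.fderiv_right (m := ω) (by simp)).continuousAt).clm_comp continuousAt_const
    have hu : IsUnit ((fderiv ℝ f x).comp R) := by
      have : (fderiv ℝ f x).comp R = 1 := by
        ext1 u
        exact LinearMap.congr_fun hR₀ u
      rw [this]
      exact isUnit_one
    filter_upwards [hc.eventually (Units.isOpen.mem_nhds hu)] with y hy
    obtain ⟨u, hu⟩ := hy
    intro w
    refine ⟨R ((u⁻¹).val w), ?_⟩
    have : (u.val * u⁻¹.val) w = w := by simp
    rw [hu] at this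
    exact this
  obtain ⟨O, hO, hOo, hxO⟩ := eventually_nhds_iff.1 (h1.and (h2.and hM))
  refine ⟨O, hOo, hxO, f, ?_, fun y hy => (hO y hy).2.1, ?_⟩
  · intro y hy
    exact ((hO y hy).1.of_le (by simp)).contDiffWithinAt
  · ext y
    constructor
    · rintro ⟨h3, h4⟩
      exact ⟨h4, (hO y h4).2.2.1 h3⟩
    · rintro ⟨h3, h4⟩
      exact ⟨(hO y h3).2.2.2 h4, h3⟩

end Submfd

/-! ### Commutator maps and dimensions of centralizers -/

section Adjoint

variable {C : Type*} [Ring C] [Algebra ℝ C]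

/-- The commutator map `X ↦ A X - X A`. -/
noncomputable def adj (A : C) : C →ₗ[ℝ] C := LinearMap.mulLeft ℝ A - LinearMap.mulRight ℝ A

@[simp] theorem adj_apply (A X : C) : adj A X = A * X - X * A := rfl

/-- The real dimension of the centralizer. -/
noncomputable def cdim (A : C) : ℕ := finrank ℝ (LinearMap.ker (adj A))

theorem mem_ker_adj {A X : C} : X ∈ LinearMap.ker (adj A) ↔ A * X = X * A := by
  simp [sub_eq_zero]

theorem cdim_equiv {B : Type*} [Ring B] [Algebra ℝ B] (e : C ≃ₐ[ℝ] B) (A : C) :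
    cdim (e A) = cdim A := by
  symm
  refine LinearEquiv.finrank_eq (LinearEquiv.ofSubmodules e.toLinearEquiv _ _ ?_)
  ext X
  constructor
  · rintro ⟨Y, hY, rfl⟩
    rw [SetLike.mem_coe, mem_ker_adj] at hY
    rw [mem_ker_adj]
    change e A * e Y = e Y * e A
    rw [← map_mul, hY, map_mul]
  · intro hX
    rw [mem_ker_adj] at hX
    refine ⟨e.symm X, ?_, by simp⟩
    rw [SetLike.mem_coe, mem_ker_adj]
    apply e.injective
    simpa using hX

theorem cdim_conj (A : C) (g : Cˣ) : cdim (g.val * A * g⁻¹.val) = cdim A := by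
  let e : C ≃ₐ[ℝ] C :=
    AlgEquiv.ofAlgHom
      (AlgHom.ofLinearMap (LinearMap.mulLeft ℝ g.val ∘ₗ LinearMap.mulRight ℝ g⁻¹.val)
        (by simp) (fun x y => by simp [mul_assoc]))
      (AlgHom.ofLinearMap (LinearMap.mulLeft ℝ g⁻¹.val ∘ₗ LinearMap.mulRight ℝ g.val)
        (by simp) (fun x y => by simp [mul_assoc]))
      (by ext x; simp [mul_assoc]) (by ext x; simp [mul_assoc])
  have := cdim_equiv e A
  have h : e A = g.val * A * g⁻¹.val := by simp [e, mul_assoc]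
  rwa [h] at this

theorem cdim_pi {ι : Type*} [Fintype ι] {B : ι → Type*} [∀ i, Ring (B i)] [∀ i, Algebra ℝ (B i)]
    [∀ i, FiniteDimensional ℝ (B i)] (A : ∀ i, B i) : cdim A = ∑ i, cdim (A i) := by
  have e : LinearMap.ker (adj A) ≃ₗ[ℝ] (∀ i, LinearMap.ker (adj (A i))) :=
    { toFun := fun X i => ⟨X.1 i, by
        have := X.2
        rw [mem_ker_adj] at this ⊢
        exact congrFun this i⟩
      invFun := fun X => ⟨fun i => (X i).1, by
        rw [mem_ker_adj]
        funext i
        exact mem_ker_adj.1 (X i).2⟩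
      map_add' := fun _ _ => rfl
      map_smul' := fun _ _ => rfl
      left_inv := fun _ => rfl
      right_inv := fun _ => rfl }
  rw [cdim, e.finrank_eq, Module.finrank_pi_fintype]
  rfl

end Adjoint

/-! ### Slices transversal to conjugacy classes -/

section Slice

variable {C : Type*} [NormedRing C] [NormedAlgebra ℝ C] [FiniteDimensional ℝ C]

theorem isUnit_eventually {x : C} (hx : IsUnit x) : ∀ᶠ y in 𝓝 x, IsUnit y := by
  have := FiniteDimensional.complete ℝ C
  exact Units.isOpen.mem_nhds hx

variable (x : C) (Y : Submodule ℝ C)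

/-- The conjugation map `(g, y) ↦ (1 + g) (x + y) (1 + g)⁻¹`. -/
noncomputable def conjMap (p : C × Y) : C := (1 + p.1) * (x + p.2) * Ring.inverse (1 + p.1)

theorem conjMap_zero : conjMap x Y 0 = x := by simp [conjMap]

theorem contDiffAt_conjMap : ContDiffAt ℝ ω (conjMap x Y) 0 := by
  have := FiniteDimensional.complete ℝ C
  have h1 : ContDiffAt ℝ ω (fun p : C × Y => 1 + p.1) 0 := contDiffAt_const.add contDiffAt_fst
  have h2 : ContDiffAt ℝ ω (fun p : C × Y => x + (p.2 : C)) 0 :=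
    contDiffAt_const.add (Y.subtypeL.contDiff.contDiffAt.comp _ contDiffAt_snd)
  have h3 : ContDiffAt ℝ ω (fun p : C × Y => Ring.inverse (1 + p.1)) 0 := by
    refine ContDiffAt.comp (0 : C × Y) (g := Ring.inverse) ?_ h1
    have := contDiffAt_ringInverse ℝ (n := ω) (1 : Cˣ)
    simpa using this
  exact (h1.mul h2).mul h3

theorem hasFDerivAt_conjMap : HasFDerivAt (conjMap x Y)
    ((ContinuousLinearMap.mul ℝ C).flip x ∘L ContinuousLinearMap.fst ℝ C Y -
      ContinuousLinearMap.mul ℝ C x ∘L ContinuousLinearMap.fst ℝ C Y +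
      Y.subtypeL ∘L ContinuousLinearMap.snd ℝ C Y) 0 := by
  have := FiniteDimensional.complete ℝ C
  have h1 : HasFDerivAt (fun p : C × Y => 1 + p.1) (ContinuousLinearMap.fst ℝ C Y) 0 :=
    hasFDerivAt_fst.const_add _
  have h2 : HasFDerivAt (fun p : C × Y => x + (p.2 : C))
      (Y.subtypeL ∘L ContinuousLinearMap.snd ℝ C Y) 0 :=
    (HasFDerivAt.comp (0 : C × Y) Y.subtypeL.hasFDerivAt hasFDerivAt_snd).const_add _
  have h3 : HasFDerivAt (fun p : C × Y => Ring.inverse (1 + p.1))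
      ((-ContinuousLinearMap.mulLeftRight ℝ C ((1 : Cˣ)⁻¹).val ((1 : Cˣ)⁻¹).val) ∘L
        ContinuousLinearMap.fst ℝ C Y) 0 := by
    refine HasFDerivAt.comp (0 : C × Y) (g := Ring.inverse) ?_ h1
    have := hasFDerivAt_ringInverse (𝕜 := ℝ) (1 : Cˣ)
    simpa using this
  have h4 := (h1.mul' h2).mul' h3
  refine h4.congr_fderiv ?_
  ext p
  · simp
    abel
  · simp

variable {x Y}

/-- The derivative of `conjMap` at 0 is `(g, y) ↦ g x - x g + y`; it is onto exactly when `Y` is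
transversal to the conjugacy class of `x`. -/
theorem conjMap_surjective (hY : ∀ v, ∃ y ∈ Y, ∃ g, v = y + (g * x - x * g)) :
    Function.Surjective ((ContinuousLinearMap.mul ℝ C).flip x ∘L ContinuousLinearMap.fst ℝ C Y -
      ContinuousLinearMap.mul ℝ C x ∘L ContinuousLinearMap.fst ℝ C Y +
      Y.subtypeL ∘L ContinuousLinearMap.snd ℝ C Y) := by
  intro v
  obtain ⟨y, hy, g, rfl⟩ := hY v
  refine ⟨(g, ⟨y, hy⟩), ?_⟩
  simp
  abel

theorem conjMap_eventually :
    ∀ᶠ p : C × Y in 𝓝 0, ∃ u : Cˣ, conjMap x Y p = u.val * (x + p.2) * u⁻¹.val := by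
  have h1 : Tendsto (fun p : C × Y => 1 + p.1) (𝓝 0) (𝓝 1) := by
    have : Continuous fun p : C × Y => 1 + p.1 := by fun_prop
    simpa using this.tendsto 0
  filter_upwards [h1.eventually (isUnit_eventually isUnit_one)] with p hp
  obtain ⟨u, hu⟩ := hp
  exact ⟨u, by simp [conjMap, ← hu]⟩

/-- **Slice lemma**: a conjugacy invariant set is a submanifold at `x` if its intersection with an
affine space through `x` transversal to the conjugacy class is. -/
theorem SubmfdAt.of_slice {M : Set C} (hM : ∀ A ∈ M, ∀ g : Cˣ, g.val * A * g⁻¹.val ∈ M)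
    (hx : x ∈ M) (hY : ∀ v, ∃ y ∈ Y, ∃ g, v = y + (g * x - x * g)) {k : ℕ}
    (h : SubmfdAt {y : Y | x + (y : C) ∈ M} k 0) : SubmfdAt M k x := by
  -- By conjugacy invariance, the preimage of `M` under `conjMap` is near 0 the product of `C` with
  -- the slice.
  have h1 : SubmfdAt (conjMap x Y ⁻¹' M) k 0 := by
    have h2 : SubmfdAt {p : C × Y | LinearMap.snd ℝ C Y p ∈ {y : Y | x + (y : C) ∈ M}} k 0 :=
      SubmfdAt.comap_linear (LinearMap.snd ℝ C Y) LinearMap.snd_surjective (by simpa using h)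
    refine h2.congr ?_
    filter_upwards [conjMap_eventually (x := x)] with p ⟨u, hu⟩
    rw [Set.mem_preimage, hu]
    constructor
    · intro h3
      have := hM _ h3 u⁻¹
      simpa [mul_assoc] using this
    · intro h3
      exact hM _ h3 u
  have := SubmfdAt.of_comap (contDiffAt_conjMap x Y) (hasFDerivAt_conjMap x Y)
    (conjMap_surjective hY) (by rwa [conjMap_zero]) h1
  rwa [conjMap_zero] at this

/-- A map with surjective strict derivative is open at the point, so the values of `conjMap` near 0
fill a neighbourhood of `x`. -/
theorem eventually_conj_slice (hY : ∀ v, ∃ y ∈ Y, ∃ g, v = y + (g * x - x * g)) :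
    ∀ᶠ z in 𝓝 x, ∃ y ∈ Y, ∃ u : Cˣ, z = u.val * (x + y) * u⁻¹.val := by
  have := FiniteDimensional.complete ℝ C
  have := FiniteDimensional.complete ℝ Y
  have h1 := ((contDiffAt_conjMap x Y).hasStrictFDerivAt' (hasFDerivAt_conjMap x Y)
    (by simp)).map_nhds_eq_of_surj (LinearMap.range_eq_top.2 (conjMap_surjective hY))
  rw [conjMap_zero] at h1
  rw [← h1, eventually_map]
  filter_upwards [conjMap_eventually (x := x)] with p ⟨u, hu⟩
  exact ⟨p.2, p.2.2, u, hu⟩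

/-- The conjugacy invariant submanifold `M` of codimension `finrank Y` meets the transversal
`x + Y` only in `x`. -/
theorem SubmfdAt.isolated_of_conj {M : Set C} (hM : ∀ A ∈ M, ∀ g : Cˣ, g.val * A * g⁻¹.val ∈ M)
    (hx : x ∈ M) (hY : ∀ v, ∃ y ∈ Y, ∃ g, v = y + (g * x - x * g))
    (h : SubmfdAt M (finrank ℝ Y) x) : ∀ᶠ y : Y in 𝓝 0, x + (y : C) ∈ M → y = 0 := by
  refine h.isolated hx Y rfl fun v => ?_
  obtain ⟨y, hy, g, rfl⟩ := hY v
  -- The tangent direction `g x - x g` is the velocity of the curve of conjugates of `x` by `1 + t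
  -- g`, which stays in `M`.
  have hp : HasDerivAt (fun t : ℝ => ((t • g, 0) : C × Y)) (g, 0) 0 := by
    have h1 : HasDerivAt (fun t : ℝ => t • g) g 0 := by
      simpa using (hasDerivAt_id (0 : ℝ)).smul_const g
    exact h1.prodMk (hasDerivAt_const _ _)
  have h0 : ((((0 : ℝ) • g, 0) : C × Y)) = 0 := by simp
  refine ⟨y, hy, fun t => conjMap x Y (t • g, 0), ?_, by simp [conjMap], ?_⟩
  · have h1 := HasFDerivAt.comp_hasDerivAt (0 : ℝ) (l := conjMap x Y)
      (h0.symm ▸ hasFDerivAt_conjMap x Y) hp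
    refine h1.congr_deriv ?_
    simp
  · have ht : Tendsto (fun t : ℝ => ((t • g, 0) : C × Y)) (𝓝 0) (𝓝 0) := by
      have := hp.continuousAt
      rwa [ContinuousAt, h0] at this
    filter_upwards [ht.eventually (conjMap_eventually (x := x))] with t ⟨u, hu⟩
    rw [hu]
    simpa using hM x hx u

end Slice

/-! ### A normed algebra structure on endomorphism algebras -/

section EndNorm

variable {D V : Type*} [Ring D] [Algebra ℝ D] [AddCommGroup V] [Module ℝ V] [Module D V]
  [IsScalarTower ℝ D V] [FiniteDimensional ℝ V]

/-- The action of `End_D(V)` on `ℝⁿ` through a real basis of `V`. -/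
noncomputable def endToCLM :
    Module.End D V →ₐ[ℝ] ((Fin (finrank ℝ V) → ℝ) →L[ℝ] (Fin (finrank ℝ V) → ℝ)) :=
  let b : V ≃ₗ[ℝ] (Fin (finrank ℝ V) → ℝ) := (Module.finBasis ℝ V).equivFun
  AlgHom.ofLinearMap
    { toFun := fun A =>
        LinearMap.toContinuousLinearMap (b.toLinearMap ∘ₗ A.restrictScalars ℝ ∘ₗ b.symm.toLinearMap)
      map_add' := fun A B => by ext; simp
      map_smul' := fun r A => by ext; simp }
    (by ext; simp) (fun A B => by ext; simp)

theorem endToCLM_injective : Function.Injective (endToCLM (D := D) (V := V)) := by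
  intro A B h
  ext v
  have := congrArg (fun L => L ((Module.finBasis ℝ V).equivFun v)) h
  simp only [endToCLM, AlgHom.ofLinearMap_apply, LinearMap.coe_mk, AddHom.coe_mk,
    LinearMap.coe_toContinuousLinearMap', LinearMap.comp_apply, LinearEquiv.coe_coe,
    LinearEquiv.symm_apply_apply, LinearMap.coe_restrictScalars,
    EmbeddingLike.apply_eq_iff_eq] at this
  exact this

/-- The norm serves only to make calculus available. It is the operator norm of the underlying real
map in a real basis, so no norm on `D` or `V` is needed. -/
noncomputable instance : NormedRing (Module.End D V) :=
  NormedRing.induced _ _ (endToCLM (D := D) (V := V)) endToCLM_injective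

noncomputable instance : NormedAlgebra ℝ (Module.End D V) :=
  NormedAlgebra.induced ℝ _ _ (endToCLM (D := D) (V := V))

end EndNorm

/-! ### Centralizers of nilpotent endomorphisms, by restriction to the range -/

section Nilpotent

universe u

variable {D : Type*} [DivisionRing D] [Algebra ℝ D]
  {V : Type u} [AddCommGroup V] [Module ℝ V] [Module D V] [IsScalarTower ℝ D V]
  [FiniteDimensional ℝ V]

instance finiteDimensional_submodule (U : Submodule D V) : FiniteDimensional ℝ U :=
  FiniteDimensional.of_injective (U.subtype.restrictScalars ℝ) U.injective_subtype

instance finiteDimensional_quotient_submodule (U : Submodule D V) : FiniteDimensional ℝ (V ⧸ U) :=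
  Module.Finite.of_surjective (U.mkQ.restrictScalars ℝ) U.mkQ_surjective

theorem finite_of_real (D : Type*) [DivisionRing D] [Algebra ℝ D] (V : Type*) [AddCommGroup V]
    [Module ℝ V] [Module D V] [IsScalarTower ℝ D V] [FiniteDimensional ℝ V] : Module.Finite D V :=
  Module.Finite.of_restrictScalars_finite ℝ D V

/-- The linear map `A ↦ p A s` on endomorphisms. -/
def sandwich {P Q : Type*} [AddCommGroup P] [Module ℝ P] [Module D P] [IsScalarTower ℝ D P]
    [AddCommGroup Q] [Module D Q] (p : V →ₗ[D] P) (s : Q →ₗ[D] V) :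
    Module.End D V →ₗ[ℝ] (Q →ₗ[D] P) where
  toFun A := p ∘ₗ A ∘ₗ s
  map_add' A B := by ext; simp
  map_smul' r A := by
    ext x
    simp

@[simp] theorem sandwich_apply {P Q : Type*} [AddCommGroup P] [Module ℝ P] [Module D P]
    [IsScalarTower ℝ D P] [AddCommGroup Q] [Module D Q] (p : V →ₗ[D] P) (s : Q →ₗ[D] V)
    (A : Module.End D V) : sandwich p s A = p ∘ₗ A ∘ₗ s := rfl

/-- A projection to the range and a section of `A`. -/
theorem exists_proj_section (A : Module.End D V) :
    ∃ (p : V →ₗ[D] LinearMap.range A) (s : LinearMap.range A →ₗ[D] V),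
      (∀ x : LinearMap.range A, p x = x) ∧ ∀ x, A (s x) = x := by
  obtain ⟨p, hp⟩ := (LinearMap.range A).subtype.exists_leftInverse_of_injective
    (LinearMap.range A).ker_subtype
  obtain ⟨s, hs⟩ := A.rangeRestrict.exists_rightInverse_of_surjective A.range_rangeRestrict
  exact ⟨p, s, fun x => LinearMap.congr_fun hp x,
    fun x => congrArg Subtype.val (LinearMap.congr_fun hs x)⟩

theorem isUnit_sandwich_eventually {P : Type*} [AddCommGroup P] [Module ℝ P] [Module D P]
    [IsScalarTower ℝ D P] [FiniteDimensional ℝ P] (A₀ : Module.End D V) {p : V →ₗ[D] P}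
    {s : P →ₗ[D] V} (h : ∀ x, p (A₀ (s x)) = x) :
    ∀ᶠ A in 𝓝 A₀, IsUnit (M := Module.End D P) (p ∘ₗ A ∘ₗ s) := by
  let L : Module.End D V →ₗ[ℝ] Module.End D P := sandwich p s
  have hL : L A₀ = 1 := by
    ext x
    exact h x
  have h1 : Tendsto L (𝓝 A₀) (𝓝 (L A₀)) := L.continuous_of_finiteDimensional.tendsto A₀
  exact h1.eventually (isUnit_eventually (hL ▸ isUnit_one))

/-- Lower semicontinuity of the rank. -/
theorem finrank_range_le_eventually (A₀ : Module.End D V) :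
    ∀ᶠ A in 𝓝 A₀, finrank D (LinearMap.range A₀) ≤ finrank D (LinearMap.range A) := by
  have := finite_of_real D V
  obtain ⟨p, s, hp, hs⟩ := exists_proj_section A₀
  filter_upwards [isUnit_sandwich_eventually A₀ (fun x => by rw [hs, hp])] with A hA
  have hinj : Function.Injective (A.rangeRestrict ∘ₗ s) := by
    have h1 : Function.Injective (p ∘ₗ A ∘ₗ s) := ((Module.End.isUnit_iff _).1 hA).1
    intro x y hxy
    apply h1
    have := congrArg (fun z : LinearMap.range A => p z) hxy
    simpa using this
  exact LinearMap.finrank_le_finrank_of_injective hinj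

theorem finrank_hom (K N : Type*) [AddCommGroup K] [Module D K] [Module.Finite D K]
    [AddCommGroup N] [Module ℝ N] [Module D N] [IsScalarTower ℝ D N] :
    finrank ℝ (K →ₗ[D] N) = finrank ℝ D * (finrank D K * finrank D N) := by
  rw [Module.finrank_linearMap D ℝ, ← Module.finrank_mul_finrank ℝ D N]
  ring

/-- Keeping `U` as a variable equal to the range lets the restrictions of different endomorphisms
with the same range be compared inside one algebra `End(U)`. -/
theorem proj_apply_eq (A : Module.End D V) {U : Submodule D V} (hU : LinearMap.range A = U)
    {p : V →ₗ[D] U} (hp : ∀ x : U, p x = x) (x : V) : ((p (A x) : U) : V) = A x := by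
  have h : A x ∈ U := hU ▸ LinearMap.mem_range_self A x
  exact congrArg Subtype.val (hp ⟨A x, h⟩)

theorem restr_pow (A : Module.End D V) {U : Submodule D V} (hU : LinearMap.range A = U)
    {p : V →ₗ[D] U} (hp : ∀ x : U, p x = x) (k : ℕ) (x : U) :
    (((((p ∘ₗ A ∘ₗ U.subtype : Module.End D U)) ^ k) x : U) : V) = (A ^ k) x := by
  induction k generalizing x with
  | zero => rfl
  | succ k ih =>
    rw [pow_succ, pow_succ, Module.End.mul_apply, Module.End.mul_apply, ih]
    congr 1
    exact proj_apply_eq A hU hp x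

theorem finrank_range_pow_succ (A : Module.End D V) {U : Submodule D V} (hU : LinearMap.range A = U)
    {p : V →ₗ[D] U} (hp : ∀ x : U, p x = x) (k : ℕ) :
    finrank D (LinearMap.range (A ^ (k + 1))) =
    finrank D (LinearMap.range ((p ∘ₗ A ∘ₗ U.subtype : Module.End D U) ^ k)) := by
  have : LinearMap.range (A ^ (k + 1)) =
      (LinearMap.range ((p ∘ₗ A ∘ₗ U.subtype : Module.End D U) ^ k)).map U.subtype := by
    ext y
    constructor
    · rintro ⟨x, rfl⟩
      have h : A x ∈ U := hU ▸ LinearMap.mem_range_self A x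
      refine ⟨_, ⟨⟨A x, h⟩, rfl⟩, ?_⟩
      rw [Submodule.subtype_apply, restr_pow A hU hp, pow_succ]
      rfl
    · rintro ⟨_, ⟨u, rfl⟩, rfl⟩
      obtain ⟨x, hx⟩ : (u : V) ∈ LinearMap.range A := hU ▸ u.2
      refine ⟨x, ?_⟩
      rw [Submodule.subtype_apply, restr_pow A hU hp, pow_succ, ← hx]
      rfl
  rw [this]
  exact (Submodule.equivMapOfInjective _ U.injective_subtype _).finrank_eq.symm

theorem isNilpotent_restr (A : Module.End D V) {U : Submodule D V} (hU : LinearMap.range A = U)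
    {p : V →ₗ[D] U} (hp : ∀ x : U, p x = x)
    (hA : IsNilpotent A) :
    IsNilpotent (p ∘ₗ A ∘ₗ U.subtype : Module.End D U) := by
  obtain ⟨n, hn⟩ := hA
  refine ⟨n, ?_⟩
  ext x
  rw [restr_pow A hU hp, hn]
  rfl

/-- The dimension of the centralizer of an endomorphism in terms of its restriction to the range. -/
theorem cdim_eq_cdim_restr_add (A : Module.End D V) {U : Submodule D V} (hU : LinearMap.range A = U)
    {p : V →ₗ[D] U} (hp : ∀ x : U, p x = x) :
    cdim A = cdim (p ∘ₗ A ∘ₗ U.subtype : Module.End D U) +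
      finrank ℝ D * (finrank D V - finrank D U) ^ 2 := by
  have := finite_of_real D V
  obtain ⟨s, hs⟩ : ∃ s : U →ₗ[D] V, ∀ x, A (s x) = x := by
    subst hU
    obtain ⟨-, s, -, hs⟩ := exists_proj_section A
    exact ⟨s, hs⟩
  have hAU : ∀ x, A x ∈ U := fun x => hU ▸ LinearMap.mem_range_self A x
  set B : Module.End D U := p ∘ₗ A ∘ₗ U.subtype with hB
  have hAp : ∀ x, ((p (A x) : U) : V) = A x := proj_apply_eq A hU hp
  have hιB : ∀ x : U, ((B x : U) : V) = A x := fun x => hAp x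
  have hcom : ∀ T : LinearMap.ker (adj A), ∀ x, A (T.1 x) = T.1 (A x) := fun T x =>
    LinearMap.congr_fun (mem_ker_adj.1 T.2) x
  have hpT : ∀ (T : LinearMap.ker (adj A)) (x : U), ((p (T.1 x) : U) : V) = T.1 x := by
    intro T x
    obtain ⟨y, hy⟩ : (x : V) ∈ LinearMap.range A := hU ▸ x.2
    rw [← hy, ← hcom, hAp]
  -- An element of the centralizer of `A` preserves `U = range A`, and its restriction commutes with
  -- the restriction `B` of `A`.
  let Φ : LinearMap.ker (adj A) →ₗ[ℝ] LinearMap.ker (adj B) :=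
    ((sandwich p U.subtype).comp (LinearMap.ker (adj A)).subtype).codRestrict _ (by
      intro T
      rw [mem_ker_adj]
      ext x
      change ((B (p (T.1 x)) : U) : V) = ((p (T.1 (B x)) : U) : V)
      rw [hιB, hpT, hcom, hpT, hιB])
  have hΦ : ∀ T x, ((((Φ T).1 : Module.End D U) x : U) : V) = T.1 x := fun T x => hpT T x
  have hsurj : Function.Surjective Φ := by
    intro T'
    let T₁ : Module.End D U := T'.1
    have hT₁ : ∀ x, B (T₁ x) = T₁ (B x) := fun x => LinearMap.congr_fun (mem_ker_adj.1 T'.2) x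
    -- The first summand solves `A T = T₁ p A`. The second corrects it to `T₁` on `U` and takes
    -- values in `ker A`, because `A T₁ = B T₁ = T₁ B = A s T₁ B` on `U`.
    let T : Module.End D V := s ∘ₗ T₁ ∘ₗ p ∘ₗ A +
      (U.subtype ∘ₗ T₁ - s ∘ₗ T₁ ∘ₗ B) ∘ₗ p
    have hTU : ∀ x : U, T x = T₁ x := by
      intro x
      have : p (A x) = B x := rfl
      simp [T, hp, this]
    have hT : A * T = T * A := by
      ext x
      have h1 : T (A x) = T₁ (p (A x)) := by
        have := hTU (p (A x))
        rwa [hAp] at this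
      rw [Module.End.mul_apply, Module.End.mul_apply, h1]
      simp only [T, LinearMap.add_apply, LinearMap.comp_apply, LinearMap.sub_apply, map_add,
        map_sub, hs, Submodule.subtype_apply]
      rw [← hιB, hT₁]
      simp
    refine ⟨⟨T, mem_ker_adj.2 hT⟩, ?_⟩
    ext x
    rw [hΦ]
    exact hTU x
  -- The kernel of Φ consists of the `T` that vanish on `U` and take values in `ker A`. Both `V ⧸ U`
  -- and `ker A` have dimension `dim V - dim U`, whence the square.
  let Ψ : ((V ⧸ U) →ₗ[D] LinearMap.ker A) →ₗ[ℝ] LinearMap.ker Φ :=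
    { toFun := fun f => ⟨⟨(LinearMap.ker A).subtype ∘ₗ f ∘ₗ U.mkQ, by
          rw [mem_ker_adj]
          ext x
          have : U.mkQ (A x) = 0 := by simpa using hAU x
          simp only [Module.End.mul_apply, LinearMap.comp_apply, this]
          simp⟩, by
          rw [LinearMap.mem_ker]
          ext x
          rw [hΦ]
          have : U.mkQ (x : V) = 0 := by simp
          simp only [LinearMap.comp_apply, this]
          simp⟩
      map_add' := fun f g => by
        ext x
        rfl
      map_smul' := fun r f => by
        ext x
        rfl }
  have hΨ : Function.Bijective Ψ := by
    constructor
    · intro f g h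
      ext x
      have := congrArg (fun T : LinearMap.ker Φ => T.1.1 x) h
      exact this
    · rintro ⟨T, hT⟩
      have hTU : ∀ x ∈ U, T.1 x = 0 := by
        intro x hx
        rw [← hΦ T ⟨x, hx⟩, LinearMap.mem_ker.1 hT]
        rfl
      refine ⟨(U.liftQ T.1 hTU).codRestrict _ ?_, ?_⟩
      · intro x
        obtain ⟨x, rfl⟩ := U.mkQ_surjective x
        rw [LinearMap.mem_ker]
        change A (T.1 x) = 0
        rw [hcom]
        exact hTU _ (hAU x)
      · ext x
        rfl
  have h1 := LinearMap.finrank_range_add_finrank_ker (K := ℝ) (V := LinearMap.ker (adj A))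
    (V₂ := LinearMap.ker (adj B)) Φ
  rw [LinearMap.range_eq_top.2 hsurj, finrank_top, ← (LinearEquiv.ofBijective Ψ hΨ).finrank_eq,
    finrank_hom] at h1
  have h2 := LinearMap.finrank_range_add_finrank_ker A
  have h3 := U.finrank_quotient_add_finrank
  have h4 : finrank D (V ⧸ U) = finrank D V - finrank D U := by omega
  have h5 : finrank D (LinearMap.ker A) = finrank D V - finrank D U := by
    rw [hU] at h2
    omega
  rw [h4, h5] at h1
  rw [cdim, cdim, ← h1]
  ring

theorem finrank_range_lt_of_isNilpotent {A : Module.End D V} (hA : IsNilpotent A)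
    (hV : 0 < finrank D V) : finrank D (LinearMap.range A) < finrank D V := by
  have := finite_of_real D V
  have h1 := LinearMap.finrank_range_add_finrank_ker A
  have h2 : LinearMap.ker A ≠ ⊥ := by
    intro h
    have hinj : Function.Injective A := LinearMap.ker_eq_bot.1 h
    obtain ⟨n, hn⟩ := hA
    have hn' : Function.Injective (A ^ n) := by
      rw [Module.End.coe_pow]
      exact hinj.iterate n
    have : Nontrivial V := Module.nontrivial_of_finrank_pos hV
    obtain ⟨x, hx⟩ := exists_ne (0 : V)
    exact hx (hn' (by rw [hn]; simp))
  have h3 : 0 < finrank D (LinearMap.ker A) := by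
    rw [Nat.pos_iff_ne_zero]
    exact fun h => h2 (Submodule.finrank_eq_zero.1 h)
  omega

/-- A nilpotent endomorphism of `V` has centralizer of dimension at least `dim V`. -/
theorem le_cdim_of_isNilpotent (n : ℕ) : ∀ {V : Type u} [AddCommGroup V] [Module ℝ V] [Module D V]
    [IsScalarTower ℝ D V] [FiniteDimensional ℝ V], finrank D V = n →
    ∀ A : Module.End D V, IsNilpotent A → finrank ℝ D * n ≤ cdim A := by
  induction n using Nat.strong_induction_on with
  | _ n ih =>
    intro V _ _ _ _ _ hn A hA
    rcases Nat.eq_zero_or_pos n with rfl | hpos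
    · simp
    · have hlt := finrank_range_lt_of_isNilpotent hA (by omega)
      obtain ⟨p, s, hp, hs⟩ := exists_proj_section A
      have h1 := ih _ (hn ▸ hlt) rfl _ (isNilpotent_restr A rfl hp hA)
      rw [cdim_eq_cdim_restr_add A rfl hp, hn]
      set r := finrank D (LinearMap.range A)
      have h2 : n - r ≤ (n - r) ^ 2 := Nat.le_self_pow (by simp) _
      calc finrank ℝ D * n = finrank ℝ D * r + finrank ℝ D * (n - r) := by
            rw [← mul_add]; congr 1; omega
        _ ≤ _ := Nat.add_le_add h1 (Nat.mul_le_mul_left _ h2)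

/-- The dimension of the centralizer of a nilpotent endomorphism in terms of ranks of powers. -/
theorem cdim_eq_sum (m : ℕ) : ∀ {V : Type u} [AddCommGroup V] [Module ℝ V] [Module D V]
    [IsScalarTower ℝ D V] [FiniteDimensional ℝ V] (A : Module.End D V), A ^ m = 0 →
    cdim A = finrank ℝ D * ∑ k ∈ Finset.range m,
      (finrank D (LinearMap.range (A ^ k)) - finrank D (LinearMap.range (A ^ (k + 1)))) ^ 2 := by
  induction m with
  | zero =>
    intro V _ _ _ _ _ A hA
    have : Subsingleton (Module.End D V) := subsingleton_of_zero_eq_one (by simpa using hA.symm)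
    simp [cdim, Module.finrank_zero_of_subsingleton]
  | succ m ih =>
    intro V _ _ _ _ _ A hA
    obtain ⟨p, s, hp, hs⟩ := exists_proj_section A
    have hm : (p ∘ₗ A ∘ₗ (LinearMap.range A).subtype : Module.End D (LinearMap.range A)) ^ m
        = 0 := by
      ext x
      rw [restr_pow A rfl hp]
      obtain ⟨x, ⟨y, rfl⟩⟩ := x
      have := LinearMap.congr_fun hA y
      rw [pow_succ] at this
      exact this
    rw [cdim_eq_cdim_restr_add A rfl hp, ih _ hm, Finset.sum_range_succ', mul_add]
    congr 1
    · congr 1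
      refine Finset.sum_congr rfl fun k _ => ?_
      rw [finrank_range_pow_succ A rfl hp, finrank_range_pow_succ A rfl hp]
    · congr 2
      rw [zero_add, pow_one, pow_zero]
      congr 1
      exact (LinearMap.range_eq_top.2 (fun x => ⟨x, rfl⟩) :
        LinearMap.range (1 : Module.End D V) = ⊤) ▸ (finrank_top D V).symm

end Nilpotent

/-! ### Nilpotent strata defined by the ranks of powers -/

section RankStrata

universe u

variable {D : Type*} [DivisionRing D] [Algebra ℝ D]

/-- The endomorphisms all of whose powers have the same ranks as those of `A₀`. -/
def rankStratum {V : Type u} [AddCommGroup V] [Module D V] (A₀ : Module.End D V) :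
    Set (Module.End D V) :=
  {A | ∀ k, finrank D (LinearMap.range (A ^ k)) = finrank D (LinearMap.range (A₀ ^ k))}

theorem finrank_range_conj {V : Type u} [AddCommGroup V] [Module D V] (A : Module.End D V)
    (g : (Module.End D V)ˣ) :
    finrank D (LinearMap.range (g.val * A * g⁻¹.val)) = finrank D (LinearMap.range A) := by
  have hg : Function.Bijective g.val := (Module.End.isUnit_iff _).1 g.isUnit
  have hg' : Function.Bijective g⁻¹.val := (Module.End.isUnit_iff _).1 g⁻¹.isUnit
  have : LinearMap.range (g.val * A * g⁻¹.val) = (LinearMap.range A).map g.val := by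
    ext y
    constructor
    · rintro ⟨x, rfl⟩
      exact ⟨A (g⁻¹.val x), ⟨_, rfl⟩, rfl⟩
    · rintro ⟨_, ⟨x, rfl⟩, rfl⟩
      obtain ⟨z, rfl⟩ := hg'.2 x
      exact ⟨z, rfl⟩
  rw [this]
  exact (Submodule.equivMapOfInjective _ hg.1 _).finrank_eq.symm

theorem conj_pow {R : Type*} [Monoid R] (g : Rˣ) (A : R) (k : ℕ) :
    (g.val * A * g⁻¹.val) ^ k = g.val * A ^ k * g⁻¹.val := by
  induction k with
  | zero => simp
  | succ k ih => rw [pow_succ, ih, pow_succ]; simp [mul_assoc]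

theorem rankStratum_conj {V : Type u} [AddCommGroup V] [Module D V] (A₀ : Module.End D V) :
    ∀ A ∈ rankStratum A₀, ∀ g : (Module.End D V)ˣ, g.val * A * g⁻¹.val ∈ rankStratum A₀ := by
  intro A hA g k
  rw [conj_pow, finrank_range_conj, hA k]

/-- Induction on the dimension. On a suitable slice through A₀ the range of `A` contains that of A₀,
and the two agree iff a linear map `K y` vanishes. In that case the ranks of the higher powers are
those of the powers of `c + L y` in `End(range A₀)`, where `c` is the restriction of A₀ and the
induction hypothesis applies. The codimensions add up to `cdim A₀` by `cdim_eq_cdim_restr_add`. -/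
theorem rankStratum_submfdAt_aux (n : ℕ) : ∀ {V : Type u} [AddCommGroup V] [Module ℝ V]
    [Module D V] [IsScalarTower ℝ D V] [FiniteDimensional ℝ V], finrank D V = n →
    ∀ A₀ : Module.End D V, IsNilpotent A₀ → SubmfdAt (rankStratum A₀) (cdim A₀) A₀ := by
  induction n using Nat.strong_induction_on with
  | _ n ih =>
  intro V _ _ _ _ _ hn A₀ hA₀
  have hfin := finite_of_real D V
  rcases Nat.eq_zero_or_pos n with rfl | hpos
  · have hs : Subsingleton V := Module.finrank_zero_iff.1 hn
    have h0 : cdim A₀ = 0 := by simp [cdim, Module.finrank_zero_of_subsingleton]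
    have h1 := SubmfdAt.submodule (⊤ : Submodule ℝ (Module.End D V)) A₀
    rw [finrank_top, Nat.sub_self] at h1
    rw [h0]
    refine h1.congr (Eventually.of_forall fun y => ?_)
    have : y = A₀ := Subsingleton.elim _ _
    simp [this, rankStratum]
  · obtain ⟨p, s, hp, hs⟩ := exists_proj_section A₀
    have hlt := finrank_range_lt_of_isNilpotent hA₀ (by omega)
    set c : Module.End D (LinearMap.range A₀) := p ∘ₗ A₀ ∘ₗ (LinearMap.range A₀).subtype with hc
    have hcn : IsNilpotent c := isNilpotent_restr A₀ rfl hp hA₀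
    have hind := ih _ (hn ▸ hlt) rfl c hcn
    let q : V →ₗ[D] (V ⧸ LinearMap.range A₀) := (LinearMap.range A₀).mkQ
    obtain ⟨t, ht⟩ := q.exists_rightInverse_of_surjective (LinearMap.range A₀).range_mkQ
    have ht' : ∀ x, q (t x) = x := fun x => LinearMap.congr_fun ht x
    have hq : ∀ x, q x = 0 ↔ x ∈ LinearMap.range A₀ := fun x => Submodule.Quotient.mk_eq_zero _
    have hqA : ∀ x, q (A₀ x) = 0 := fun x => (hq _).2 (LinearMap.mem_range_self _ _)
    have hqU : ∀ x : LinearMap.range A₀, q x = 0 := fun x => (hq _).2 x.2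
    let Y : Submodule ℝ (Module.End D V) := LinearMap.ker (sandwich q s)
    have hY : ∀ y, y ∈ Y ↔ ∀ x, q (y (s x)) = 0 := by
      intro y
      rw [LinearMap.mem_ker]
      exact ⟨fun h x => LinearMap.congr_fun h x, fun h => LinearMap.ext h⟩
    have htrans : ∀ v, ∃ y ∈ Y, ∃ g, v = y + (g * A₀ - A₀ * g) := by
      intro v
      -- As `p A₀ s = 1` and `q A₀ = 0`, this choice gives `q (g A₀ - A₀ g) s = q v s`, so the
      -- remainder lies in `Y`.
      let g : Module.End D V := v ∘ₗ s ∘ₗ p - (LinearMap.range A₀).subtype ∘ₗ p ∘ₗ v ∘ₗ s ∘ₗ p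
      refine ⟨v - (g * A₀ - A₀ * g), ?_, g, by abel⟩
      rw [hY]
      intro x
      simp [g, hs, hp, hqA, hqU]
    refine SubmfdAt.of_slice (rankStratum_conj A₀) (fun k => rfl) htrans ?_
    let K : Y →ₗ[ℝ] (LinearMap.ker A₀ →ₗ[D] (V ⧸ LinearMap.range A₀)) :=
      (sandwich q (LinearMap.ker A₀).subtype) ∘ₗ Y.subtype
    let L : Y →ₗ[ℝ] Module.End D (LinearMap.range A₀) :=
      (sandwich p (LinearMap.range A₀).subtype) ∘ₗ Y.subtype
    have hfinK : FiniteDimensional ℝ (LinearMap.ker A₀ →ₗ[D] (V ⧸ LinearMap.range A₀)) :=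
      FiniteDimensional.of_injective
        (LinearMap.restrictScalarsₗ ℝ D (LinearMap.ker A₀) (V ⧸ LinearMap.range A₀) ℝ)
        (LinearMap.restrictScalars_injective ℝ)
    -- the projection to the kernel along the range of the section
    let π : V →ₗ[D] LinearMap.ker A₀ := (LinearMap.id - s ∘ₗ A₀.rangeRestrict).codRestrict _ (by
      intro x
      simp [hs])
    have hπ : ∀ x, x = π x + s (A₀.rangeRestrict x) := by intro x; simp [π]
    have hπs : ∀ x, π (s x) = 0 := by
      intro x
      ext
      have : A₀.rangeRestrict (s x) = x := Subtype.ext (hs x)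
      simp [π, this]
    have hπk : ∀ x : LinearMap.ker A₀, π x = x := by
      intro x
      ext
      have : A₀.rangeRestrict (x : V) = 0 := Subtype.ext x.2
      simp [π, this]
    have hsurj : ∀ a b, ∃ y, K y = a ∧ L y = b := by
      intro a b
      -- The first summand realizes `b` and is invisible to `q`. The bracket realizes `a`, vanishes
      -- on the image of `s`, and has had its `p`-component removed.
      let z : Module.End D V := (LinearMap.range A₀).subtype ∘ₗ b ∘ₗ p +
        (t ∘ₗ a ∘ₗ π - (LinearMap.range A₀).subtype ∘ₗ p ∘ₗ t ∘ₗ a ∘ₗ π)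
      have hz : z ∈ Y := by
        rw [hY]
        intro x
        simp [z, hqU, hπs]
      refine ⟨⟨z, hz⟩, ?_, ?_⟩
      · ext x
        change q (z x) = a x
        simp [z, hqU, hπk, ht']
      · ext x : 1
        change p (z x) = b x
        simp [z, hp]
    have hcod : cdim A₀ =
        finrank ℝ (LinearMap.ker A₀ →ₗ[D] (V ⧸ LinearMap.range A₀)) + cdim c := by
      have h2 := LinearMap.finrank_range_add_finrank_ker A₀
      have h3 := (LinearMap.range A₀).finrank_quotient_add_finrank
      rw [cdim_eq_cdim_restr_add A₀ rfl hp, finrank_hom,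
        show finrank D (V ⧸ LinearMap.range A₀) = finrank D V - finrank D (LinearMap.range A₀) by
          omega,
        show finrank D (LinearMap.ker A₀) = finrank D V - finrank D (LinearMap.range A₀) by omega]
      ring
    rw [hcod]
    have hmain := SubmfdAt.inter_ker (x := (0 : Y)) K L c hsurj (M := rankStratum c) (k := cdim c)
      (by simpa using hind)
    refine hmain.congr ?_
    have hev : ∀ᶠ y : Y in 𝓝 0,
        IsUnit (M := Module.End D (LinearMap.range A₀)) (p ∘ₗ (A₀ + (y : Module.End D V)) ∘ₗ s) := by
      have h1 : Tendsto (fun y : Y => A₀ + (y : Module.End D V)) (𝓝 0) (𝓝 A₀) := by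
        have : Continuous fun y : Y => A₀ + (y : Module.End D V) := by fun_prop
        simpa using this.tendsto 0
      exact h1.eventually (isUnit_sandwich_eventually A₀ (fun x => by rw [hs, hp]))
    filter_upwards [hev] with y hy
    set A : Module.End D V := A₀ + (y : Module.End D V) with hA
    have hLy : c + L y = p ∘ₗ A ∘ₗ (LinearMap.range A₀).subtype := by
      ext x : 1
      simp [hc, hA, L]
    have hqy : ∀ x, q (A x) = q ((y : Module.End D V) x) := by
      intro x
      simp [hA, hqA]
    have hKy : K y = 0 ↔ ∀ x, q (A x) = 0 := by
      constructor
      · intro h x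
        have h1 : q ((y : Module.End D V) (π x)) = 0 := LinearMap.congr_fun h (π x)
        rw [hqy, hπ x, map_add, map_add, h1, (hY _).1 y.2, add_zero]
      · intro h
        ext x
        exact (hqy _).symm.trans (h x)
    -- On the slice `A` maps the image of `s` into `range A₀`, and onto it because `p A s` is
    -- invertible.
    have hle : LinearMap.range A₀ ≤ LinearMap.range A := by
      intro u hu
      obtain ⟨x, hx⟩ := ((Module.End.isUnit_iff _).1 hy).2 ⟨u, hu⟩
      have h1 : A (s x) ∈ LinearMap.range A₀ := by
        rw [← hq, hqy]
        exact (hY _).1 y.2 x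
      refine ⟨s x, ?_⟩
      have h2 : p (A (s x)) = ⟨u, hu⟩ := hx
      rw [hp ⟨_, h1⟩] at h2
      exact congrArg Subtype.val h2
    have hcase : (∀ x, q (A x) = 0) ↔ LinearMap.range A = LinearMap.range A₀ := by
      constructor
      · intro h
        refine le_antisymm ?_ hle
        rintro _ ⟨x, rfl⟩
        exact (hq _).1 (h x)
      · intro h x
        exact (hq _).2 (h ▸ LinearMap.mem_range_self A x)
    have hiff : LinearMap.range A = LinearMap.range A₀ → ((∀ k,
        finrank D (LinearMap.range (A ^ k)) = finrank D (LinearMap.range (A₀ ^ k))) ↔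
        c + L y ∈ rankStratum c) := by
      intro h
      rw [hLy]
      constructor
      · intro h1 k
        rw [← finrank_range_pow_succ A h hp, ← finrank_range_pow_succ A₀ rfl hp]
        exact h1 _
      · intro h1 k
        cases k with
        | zero => rw [pow_zero, pow_zero]
        | succ k =>
          rw [finrank_range_pow_succ A h hp, finrank_range_pow_succ A₀ rfl hp]
          exact h1 k
    change (∀ k, finrank D (LinearMap.range (A ^ k)) = finrank D (LinearMap.range (A₀ ^ k))) ↔ 
      K y = 0 ∧ c + L y ∈ rankStratum c
    rw [hKy, hcase]
    constructor
    · intro h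
      have h1 : LinearMap.range A = LinearMap.range A₀ := by
        have h2 := h 1
        rw [pow_one, pow_one] at h2
        exact (Submodule.eq_of_le_of_finrank_eq hle h2.symm).symm
      exact ⟨h1, (hiff h1).1 h⟩
    · rintro ⟨h1, h2⟩
      exact (hiff h1).2 h2

variable {V : Type u} [AddCommGroup V] [Module ℝ V] [Module D V] [IsScalarTower ℝ D V]
  [FiniteDimensional ℝ V]

theorem rankStratum_submfdAt (A₀ : Module.End D V) (hA₀ : IsNilpotent A₀) :
    SubmfdAt (rankStratum A₀) (cdim A₀) A₀ :=
  rankStratum_submfdAt_aux _ rfl A₀ hA₀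

/-- The k-th rank drop is the dimension of `ker A ∩ range A ^ k`, and these spaces decrease with k.
-/
theorem finrank_range_pow_convex (A : Module.End D V) (k : ℕ) :
    finrank D (LinearMap.range (A ^ (k + 1))) - finrank D (LinearMap.range (A ^ (k + 2))) ≤
      finrank D (LinearMap.range (A ^ k)) - finrank D (LinearMap.range (A ^ (k + 1))) := by
  have := finite_of_real D V
  have key : ∀ k, finrank D (LinearMap.range (A ^ k)) - finrank D (LinearMap.range (A ^ (k + 1))) =
      finrank D (LinearMap.ker (A.domRestrict (LinearMap.range (A ^ k)))) := by
    intro k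
    have h1 := LinearMap.finrank_range_add_finrank_ker (A.domRestrict (LinearMap.range (A ^ k)))
    have h2 : LinearMap.range (A.domRestrict (LinearMap.range (A ^ k))) =
        LinearMap.range (A ^ (k + 1)) := by
      rw [LinearMap.range_domRestrict, pow_succ', Module.End.mul_eq_comp, LinearMap.range_comp]
    rw [h2] at h1
    omega
  rw [key k, key (k + 1)]
  have hle : LinearMap.range (A ^ (k + 1)) ≤ LinearMap.range (A ^ k) := by
    rw [pow_succ]
    rintro _ ⟨x, rfl⟩
    exact ⟨A x, rfl⟩
  let f : LinearMap.ker (A.domRestrict (LinearMap.range (A ^ (k + 1)))) →ₗ[D]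
      LinearMap.ker (A.domRestrict (LinearMap.range (A ^ k))) :=
    (Submodule.inclusion hle ∘ₗ Submodule.subtype _).codRestrict _ (fun x => x.2)
  refine LinearMap.finrank_le_finrank_of_injective (f := f) ?_
  intro x y h
  have := congrArg (fun z => z.1.1) h
  exact Subtype.ext (Subtype.ext this)

/-- A nonincreasing sequence `b` majorized by `a` with the same sum of squares is equal to `a`; here
`a` and `b` are the difference sequences of `s` and `r`. -/
theorem eq_of_sum_sq_le {r s : ℕ → ℤ} {m : ℕ} (h0 : r 0 = s 0) (hm : r m = s m)
    (hle : ∀ k, s k ≤ r k) (hconv : ∀ k, r (k + 1) - r (k + 2) ≤ r k - r (k + 1))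
    (hsum : ∑ k ∈ Finset.range m, (s k - s (k + 1)) ^ 2 ≤
      ∑ k ∈ Finset.range m, (r k - r (k + 1)) ^ 2) : ∀ k ≤ m, r k = s k := by
  -- Summation by parts for `∑ b (a - b)`. Each term on the right is a product of two nonpositive
  -- factors, and the boundary term vanishes when `r` and `s` agree at the end.
  have abel : ∀ n, ∑ k ∈ Finset.range (n + 1), (r k - r (k + 1)) *
      ((s k - s (k + 1)) - (r k - r (k + 1))) =
      ∑ k ∈ Finset.range n, (s (k + 1) - r (k + 1)) *
        ((r (k + 1) - r (k + 2)) - (r k - r (k + 1))) +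
      (r n - r (n + 1)) * (r (n + 1) - s (n + 1)) := by
    intro n
    induction n with
    | zero => simp [h0]
    | succ n ih =>
      rw [Finset.sum_range_succ, ih, Finset.sum_range_succ _ n]
      ring
  have hcross : 0 ≤ ∑ k ∈ Finset.range m, (r k - r (k + 1)) *
      ((s k - s (k + 1)) - (r k - r (k + 1))) := by
    cases m with
    | zero => simp
    | succ n =>
      rw [abel n, hm, sub_self, mul_zero, add_zero]
      refine Finset.sum_nonneg fun k _ => mul_nonneg_of_nonpos_of_nonpos ?_ ?_
      · linarith [hle (k + 1)]
      · linarith [hconv k]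
  -- `∑ (a - b)² = ∑ a² - ∑ b² - 2 ∑ b (a - b)`, where the cross sum is nonnegative.
  have hsq : ∑ k ∈ Finset.range m, ((s k - s (k + 1)) - (r k - r (k + 1))) ^ 2 ≤ 0 := by
    have : ∑ k ∈ Finset.range m, (s k - s (k + 1)) ^ 2 =
        ∑ k ∈ Finset.range m, (r k - r (k + 1)) ^ 2 +
        ∑ k ∈ Finset.range m, ((s k - s (k + 1)) - (r k - r (k + 1))) ^ 2 +
        2 * ∑ k ∈ Finset.range m, (r k - r (k + 1)) *
          ((s k - s (k + 1)) - (r k - r (k + 1))) := by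
      rw [Finset.mul_sum, ← Finset.sum_add_distrib, ← Finset.sum_add_distrib]
      refine Finset.sum_congr rfl fun k _ => ?_
      ring
    linarith
  have hzero := (Finset.sum_eq_zero_iff_of_nonneg (fun k _ => sq_nonneg _)).1
    (le_antisymm hsq (Finset.sum_nonneg fun k _ => sq_nonneg _))
  intro k
  induction k with
  | zero => exact fun _ => h0
  | succ k ih =>
    intro hk
    have h1 := hzero k (Finset.mem_range.2 hk)
    have h2 := ih (by omega)
    have h3 := pow_eq_zero_iff (two_ne_zero) |>.1 h1
    linarith

theorem pow_finrank_eq_zero (A : Module.End D V) (hA : IsNilpotent A) :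
    A ^ finrank ℝ V = 0 := by
  let f : Module.End D V →ₐ[ℝ] Module.End ℝ V :=
    AlgHom.ofLinearMap (LinearMap.restrictScalarsₗ ℝ D V V ℝ) rfl (fun _ _ => rfl)
  have hf : Function.Injective f := LinearMap.restrictScalars_injective ℝ
  have h1 : (f A).charpoly = Polynomial.X ^ finrank ℝ V :=
    LinearMap.isNilpotent_iff_charpoly (f A) |>.1 (hA.map f)
  have h2 := LinearMap.aeval_self_charpoly (f A)
  rw [h1, map_pow, Polynomial.aeval_X, ← map_pow] at h2
  exact hf (h2.trans (map_zero f).symm)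

/-- Among nilpotent endomorphisms near `A₀`, those whose centralizer is at least as large as that of
`A₀` are those whose powers have the same ranks. -/
theorem rankStratum_eventually (hV : 0 < finrank D V) (A₀ : Module.End D V)
    (hA₀ : IsNilpotent A₀) :
    ∀ᶠ A in 𝓝 A₀, IsNilpotent A → (cdim A₀ ≤ cdim A ↔ A ∈ rankStratum A₀) := by
  -- Finite dimensionality of `D` comes from that of `V ≠ 0`. Positivity is needed to cancel the
  -- factor `finrank ℝ D` in `cdim`.
  have hd : 0 < finrank ℝ D := by
    have := Module.finrank_mul_finrank ℝ D V
    have h1 : 0 < finrank ℝ V := by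
      have : Nontrivial V := Module.nontrivial_of_finrank_pos hV
      exact Module.finrank_pos
    rw [← this] at h1
    exact Nat.pos_of_mul_pos_right h1
  have hfin := finite_of_real D V
  have hnil : ∀ A : Module.End D V, IsNilpotent A → ∀ k, finrank ℝ V ≤ k → A ^ k = 0 :=
    fun A hA k hk => pow_eq_zero_of_le hk (pow_finrank_eq_zero A hA)
  have hr0 : ∀ A : Module.End D V, finrank D (LinearMap.range (A ^ 0)) = finrank D V := by
    intro A
    rw [pow_zero, show LinearMap.range (1 : Module.End D V) = ⊤ from
      LinearMap.range_eq_top.2 (fun x => ⟨x, rfl⟩), finrank_top]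
  have hmono : ∀ (A : Module.End D V) k, finrank D (LinearMap.range (A ^ (k + 1))) ≤
      finrank D (LinearMap.range (A ^ k)) := by
    intro A k
    refine Submodule.finrank_mono ?_
    rw [pow_succ]
    rintro _ ⟨x, rfl⟩
    exact ⟨A x, rfl⟩
  have hcd : ∀ A : Module.End D V, IsNilpotent A → (cdim A : ℤ) = finrank ℝ D *
      ∑ k ∈ Finset.range (finrank ℝ V), ((finrank D (LinearMap.range (A ^ k)) : ℤ) -
        finrank D (LinearMap.range (A ^ (k + 1)))) ^ 2 := by
    intro A hA
    rw [cdim_eq_sum _ A (hnil A hA _ le_rfl)]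
    push_cast
    congr 1
    refine Finset.sum_congr rfl fun k _ => ?_
    rw [Nat.cast_sub (hmono A k)]
  -- Only finitely many powers need watching: from exponent `finrank ℝ V` on, all powers of
  -- nilpotent elements vanish.
  have hev : ∀ᶠ A in 𝓝 A₀, ∀ k ∈ Finset.range (finrank ℝ V + 1),
      finrank D (LinearMap.range (A₀ ^ k)) ≤ finrank D (LinearMap.range (A ^ k)) := by
    rw [Filter.eventually_all_finset]
    intro k _
    have : Tendsto (fun A : Module.End D V => A ^ k) (𝓝 A₀) (𝓝 (A₀ ^ k)) :=
      (continuous_pow k).tendsto A₀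
    exact this.eventually (finrank_range_le_eventually _)
  filter_upwards [hev] with A hle hA
  constructor
  · intro h
    have hzero : ∀ k, finrank ℝ V ≤ k → finrank D (LinearMap.range (A ^ k)) =
        finrank D (LinearMap.range (A₀ ^ k)) := by
      intro k hk
      rw [hnil A hA k hk, hnil A₀ hA₀ k hk]
    have h1 : (cdim A₀ : ℤ) ≤ cdim A := by exact_mod_cast h
    rw [hcd A hA, hcd A₀ hA₀] at h1
    have h2 := le_of_mul_le_mul_left h1 (by exact_mod_cast hd)
    have h3 := eq_of_sum_sq_le (r := fun k => (finrank D (LinearMap.range (A ^ k)) : ℤ))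
      (s := fun k => (finrank D (LinearMap.range (A₀ ^ k)) : ℤ)) (m := finrank ℝ V)
      (by simp only [hr0]) (by simp only [hzero _ le_rfl]) (by
        intro k
        rcases le_or_gt (finrank ℝ V) k with hk | hk
        · simp only [hzero k hk, le_refl]
        · exact_mod_cast hle k (Finset.mem_range.2 (by omega)))
      (by
        intro k
        have h4 := finrank_range_pow_convex A k
        have h5 := hmono A k
        have h6 := hmono A (k + 1)
        omega) h2
    intro k
    rcases le_or_gt (finrank ℝ V) k with hk | hk
    · exact hzero k hk
    · exact_mod_cast h3 k hk.le
  · intro h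
    have h1 : (cdim A₀ : ℤ) = cdim A := by
      rw [hcd A hA, hcd A₀ hA₀]
      congr 1
      refine Finset.sum_congr rfl fun k _ => ?_
      rw [h k, h (k + 1)]
    omega

end RankStrata

/-! ### Nilpotent strata in semisimple algebras -/

section NilStrata

/-- The nilpotent elements with a centralizer of the same dimension as that of `A₀`. -/
def nilStratum {C : Type*} [Ring C] [Algebra ℝ C] (A₀ : C) : Set C :=
  {A | IsNilpotent A ∧ cdim A = cdim A₀}

theorem isNilpotent_conj {C : Type*} [Ring C] {A : C} (hA : IsNilpotent A) (g : Cˣ) :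
    IsNilpotent (g.val * A * g⁻¹.val) := by
  obtain ⟨n, hn⟩ := hA
  exact ⟨n, by rw [conj_pow, hn]; simp⟩

theorem nilStratum_conj {C : Type*} [Ring C] [Algebra ℝ C] (A₀ : C) :
    ∀ A ∈ nilStratum A₀, ∀ g : Cˣ, g.val * A * g⁻¹.val ∈ nilStratum A₀ :=
  fun A hA g => ⟨isNilpotent_conj hA.1 g, (cdim_conj A g).trans hA.2⟩

theorem finrank_range_map_le_eventually {E V : Type*} [NormedAddCommGroup E] [NormedSpace ℝ E]
    [FiniteDimensional ℝ E] [AddCommGroup V] [Module ℝ V] [FiniteDimensional ℝ V]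
    (L : E →ₗ[ℝ] Module.End ℝ V) (x : E) :
    ∀ᶠ y in 𝓝 x, finrank ℝ (LinearMap.range (L x)) ≤ finrank ℝ (LinearMap.range (L y)) :=
  (L.continuous_of_finiteDimensional.tendsto x).eventually (finrank_range_le_eventually (L x))

/-- Upper semicontinuity of the dimension of the centralizer. -/
theorem cdim_le_eventually {C : Type*} [NormedRing C] [NormedAlgebra ℝ C] [FiniteDimensional ℝ C]
    (A₀ : C) : ∀ᶠ A in 𝓝 A₀, cdim A ≤ cdim A₀ := by
  let L : C →ₗ[ℝ] Module.End ℝ C := LinearMap.mul ℝ C - (LinearMap.mul ℝ C).flip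
  have hL : ∀ A, L A = adj A := fun A => rfl
  filter_upwards [finrank_range_map_le_eventually L A₀] with A hA
  rw [hL, hL] at hA
  have h2 := LinearMap.finrank_range_add_finrank_ker (K := ℝ) (V := C) (V₂ := C) (adj A)
  have h3 := LinearMap.finrank_range_add_finrank_ker (K := ℝ) (V := C) (V₂ := C) (adj A₀)
  rw [cdim, cdim]
  omega

/-- Near A₀ this set is the rank stratum. The ranks of powers detect nilpotency, and `cdim` is upper
semicontinuous, so `cdim A₀ ≤ cdim A` is the same as equality there. -/
theorem nilStratum_submfdAt_end {D V : Type*} [DivisionRing D] [Algebra ℝ D] [AddCommGroup V]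
    [Module ℝ V] [Module D V] [IsScalarTower ℝ D V] [FiniteDimensional ℝ V] (A₀ : Module.End D V)
    (hA₀ : IsNilpotent A₀) : SubmfdAt (nilStratum A₀) (cdim A₀) A₀ := by
  have hfin := finite_of_real D V
  refine (rankStratum_submfdAt A₀ hA₀).congr ?_
  rcases Nat.eq_zero_or_pos (finrank D V) with hV | hV
  · have hs : Subsingleton V := Module.finrank_zero_iff.1 hV
    refine Eventually.of_forall fun A => ?_
    rw [Subsingleton.elim A A₀]
    exact ⟨fun _ k => rfl, fun _ => ⟨hA₀, rfl⟩⟩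
  · filter_upwards [rankStratum_eventually hV A₀ hA₀, cdim_le_eventually A₀] with A h1 h2
    constructor
    · rintro ⟨h3, h4⟩
      exact (h1 h3).1 h4.ge
    · intro h
      have h3 : IsNilpotent A := by
        obtain ⟨n, hn⟩ := hA₀
        refine ⟨n, ?_⟩
        have h4 := h n
        rw [hn, LinearMap.range_zero, finrank_bot] at h4
        exact LinearMap.range_eq_bot.1 (Submodule.finrank_eq_zero.1 h4)
      exact ⟨h3, le_antisymm h2 ((h1 h3).2 h)⟩

theorem nilStratum_submfdAt_of_equiv {C B : Type*} [NormedRing C] [NormedAlgebra ℝ C]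
    [FiniteDimensional ℝ C] [NormedRing B] [NormedAlgebra ℝ B] [FiniteDimensional ℝ B]
    (e : C ≃ₐ[ℝ] B) (A₀ : C) (h : SubmfdAt (nilStratum (e A₀)) (cdim (e A₀)) (e A₀)) :
    SubmfdAt (nilStratum A₀) (cdim A₀) A₀ := by
  rw [cdim_equiv] at h
  refine (SubmfdAt.comap_linear e.toLinearMap e.surjective h).congr
    (Eventually.of_forall fun A => ?_)
  change IsNilpotent A ∧ _ ↔ IsNilpotent (e A) ∧ cdim (e A) = cdim (e A₀)
  rw [cdim_equiv, cdim_equiv, IsNilpotent.map_iff e.injective]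

theorem isNilpotent_pi_iff {ι : Type*} [Finite ι] {B : ι → Type*} [∀ i, Ring (B i)]
    (A : ∀ i, B i) : IsNilpotent A ↔ ∀ i, IsNilpotent (A i) := by
  cases nonempty_fintype ι
  constructor
  · rintro ⟨n, hn⟩ i
    exact ⟨n, congrFun hn i⟩
  · intro h
    choose n hn using h
    refine ⟨Finset.univ.sup n, ?_⟩
    funext i
    exact pow_eq_zero_of_le (Finset.le_sup (Finset.mem_univ i)) (hn i)

/-- Near A₀ no component of `cdim` can exceed its value at A₀, so equality of the sums forces
equality in every factor. -/
theorem nilStratum_submfdAt_pi {ι : Type*} [Fintype ι] {B : ι → Type*} [∀ i, NormedRing (B i)]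
    [∀ i, NormedAlgebra ℝ (B i)] [∀ i, FiniteDimensional ℝ (B i)] (A₀ : ∀ i, B i)
    (h : ∀ i, SubmfdAt (nilStratum (A₀ i)) (cdim (A₀ i)) (A₀ i)) :
    SubmfdAt (nilStratum A₀) (cdim A₀) A₀ := by
  rw [cdim_pi]
  refine (SubmfdAt.pi h).congr ?_
  have hev : ∀ᶠ A in 𝓝 A₀, ∀ i, cdim (A i) ≤ cdim (A₀ i) :=
    eventually_all.2 fun i => ((continuous_apply i).tendsto A₀).eventually (cdim_le_eventually _)
  filter_upwards [hev] with A hA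
  simp only [Set.mem_univ_pi]
  change IsNilpotent A ∧ cdim A = cdim A₀ ↔ ∀ i, IsNilpotent (A i) ∧ cdim (A i) = cdim (A₀ i)
  rw [isNilpotent_pi_iff, cdim_pi, cdim_pi, forall_and,
    Finset.sum_eq_sum_iff_of_le fun i _ => hA i]
  simp

/-- Matrices over `D` as endomorphisms. -/
noncomputable def matrixEquivEnd (n : ℕ) (D : Type*) [Ring D] [Algebra ℝ D] :
    Matrix (Fin n) (Fin n) D ≃ₐ[ℝ] Module.End Dᵐᵒᵖ (Fin n → D) :=
  (AlgEquiv.mapMatrix (AlgEquiv.moduleEndSelfOp ℝ)).trans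
    (endVecAlgEquivMatrixEnd (Fin n) ℝ Dᵐᵒᵖ D).symm

/-- Wedderburn–Artin reduces this to matrix algebras. The generality is needed because the result is
later applied inside the centralizer of a semisimple element. -/
theorem nilStratum_submfdAt {C : Type*} [NormedRing C] [NormedAlgebra ℝ C] [FiniteDimensional ℝ C]
    [IsSemisimpleRing C] (A₀ : C) (hA₀ : IsNilpotent A₀) :
    SubmfdAt (nilStratum A₀) (cdim A₀) A₀ := by
  obtain ⟨n, D, d, _, _, hD, -, ⟨e⟩⟩ :=
    IsSemisimpleRing.exists_algEquiv_pi_matrix_divisionRing_finite ℝ C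
  let e' : C ≃ₐ[ℝ] ((i : Fin n) → Module.End (D i)ᵐᵒᵖ (Fin (d i) → D i)) :=
    e.trans (AlgEquiv.piCongrRight fun i => matrixEquivEnd (d i) (D i))
  have := fun i => Module.Finite.equiv (matrixEquivEnd (d i) (D i)).toLinearEquiv
  have h1 : IsNilpotent (e' A₀) := hA₀.map e'
  exact nilStratum_submfdAt_of_equiv e' A₀ (nilStratum_submfdAt_pi _ fun i =>
    nilStratum_submfdAt_end _ ((isNilpotent_pi_iff _).1 h1 i))

end NilStrata

/-! ### Spectral conditions expressed by annihilating polynomials -/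

section SpectralConditions

open Polynomial

variable {C B : Type*} [Ring C] [Algebra ℝ C] [Ring B] [Algebra ℝ B]

/-- All complex roots of some polynomial annihilating `A` have vanishing real part. -/
def IsCen (A : C) : Prop :=
  ∃ P : ℝ[X], P ≠ 0 ∧ (∀ z : ℂ, aeval z P = 0 → z.re = 0) ∧ aeval A P = 0

/-- `A` is annihilated by a squarefree polynomial. -/
def IsSqfree (A : C) : Prop := ∃ P : ℝ[X], Squarefree P ∧ aeval A P = 0

/-- Annihilating polynomials pass along algebra morphisms, and back along injective ones. This is
what makes the polynomial form of the spectral conditions convenient. -/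
theorem IsCen.map {A : C} (h : IsCen A) (f : C →ₐ[ℝ] B) : IsCen (f A) := by
  obtain ⟨P, h0, h1, h2⟩ := h
  exact ⟨P, h0, h1, by rw [aeval_algHom_apply, h2, map_zero]⟩

theorem IsCen.of_map {A : C} (f : C →ₐ[ℝ] B) (hf : Function.Injective f) (h : IsCen (f A)) :
    IsCen A := by
  obtain ⟨P, h0, h1, h2⟩ := h
  exact ⟨P, h0, h1, hf (by rw [← aeval_algHom_apply, h2, map_zero])⟩

theorem IsSqfree.map {A : C} (h : IsSqfree A) (f : C →ₐ[ℝ] B) : IsSqfree (f A) := by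
  obtain ⟨P, h0, h2⟩ := h
  exact ⟨P, h0, by rw [aeval_algHom_apply, h2, map_zero]⟩

theorem IsSqfree.of_map {A : C} (f : C →ₐ[ℝ] B) (hf : Function.Injective f) (h : IsSqfree (f A)) :
    IsSqfree A := by
  obtain ⟨P, h0, h2⟩ := h
  exact ⟨P, h0, hf (by rw [← aeval_algHom_apply, h2, map_zero])⟩

/-- Conjugation by a unit as an automorphism. -/
noncomputable def conjEquiv (g : Cˣ) : C ≃ₐ[ℝ] C :=
  AlgEquiv.ofAlgHom
    (AlgHom.ofLinearMap (LinearMap.mulLeft ℝ g.val ∘ₗ LinearMap.mulRight ℝ g⁻¹.val)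
      (by simp) (fun x y => by simp [mul_assoc]))
    (AlgHom.ofLinearMap (LinearMap.mulLeft ℝ g⁻¹.val ∘ₗ LinearMap.mulRight ℝ g.val)
      (by simp) (fun x y => by simp [mul_assoc]))
    (by ext x; simp [mul_assoc]) (by ext x; simp [mul_assoc])

theorem conjEquiv_apply (g : Cˣ) (x : C) : conjEquiv g x = g.val * x * g⁻¹.val := by
  simp [conjEquiv, mul_assoc]

theorem isCen_pi_iff {ι : Type*} [Finite ι] {B : ι → Type*} [∀ i, Ring (B i)]
    [∀ i, Algebra ℝ (B i)] (A : ∀ i, B i) : IsCen A ↔ ∀ i, IsCen (A i) := by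
  cases nonempty_fintype ι
  constructor
  · intro h i
    exact h.map (Pi.evalAlgHom ℝ B i)
  · intro h
    choose P h0 h1 h2 using h
    refine ⟨∏ i, P i, Finset.prod_ne_zero_iff.2 fun i _ => h0 i, fun z hz => ?_, ?_⟩
    · rw [map_prod, Finset.prod_eq_zero_iff] at hz
      obtain ⟨i, _, hi⟩ := hz
      exact h1 i z hi
    · funext i
      rw [← Pi.evalAlgHom_apply ℝ B i (aeval A _), ← aeval_algHom_apply]
      obtain ⟨Q, hQ⟩ := Finset.dvd_prod_of_mem P (Finset.mem_univ i)
      rw [hQ, map_mul, Pi.evalAlgHom_apply, h2]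
      simp

theorem isCen_prod_iff (A : C × B) : IsCen A ↔ IsCen A.1 ∧ IsCen A.2 := by
  constructor
  · intro h
    exact ⟨h.map (AlgHom.fst ℝ C B), h.map (AlgHom.snd ℝ C B)⟩
  · rintro ⟨⟨P, h0, h1, h2⟩, ⟨P', h0', h1', h2'⟩⟩
    refine ⟨P * P', mul_ne_zero h0 h0', fun z hz => ?_, ?_⟩
    · rw [map_mul, mul_eq_zero] at hz
      exact hz.elim (h1 z) (h1' z)
    · ext
      · rw [← AlgHom.fst_apply (R:=ℝ) (A:=C) (B:=B), ← aeval_algHom_apply]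
        simp [h2]
      · rw [← AlgHom.snd_apply (R:=ℝ) (A:=C) (B:=B), ← aeval_algHom_apply]
        simp [h2']

theorem isNilpotent_prod_iff (A : C × B) : IsNilpotent A ↔ IsNilpotent A.1 ∧ IsNilpotent A.2 := by
  constructor
  · intro h
    exact ⟨h.map (AlgHom.fst ℝ C B), h.map (AlgHom.snd ℝ C B)⟩
  · rintro ⟨⟨n, hn⟩, ⟨m, hm⟩⟩
    refine ⟨n + m, ?_⟩
    ext
    · simp [pow_add, hn]
    · simp [pow_add, hm]

open scoped IsMulCommutative in
/-- If `P(A)` is nilpotent and `A - B` is a commuting nilpotent then `P(B)` is nilpotent. -/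
theorem isNilpotent_aeval_of_commute {A A' : C} (hc : A * A' = A' * A) (hn : IsNilpotent (A - A'))
    (P : ℝ[X]) (hP : IsNilpotent (aeval A P)) : IsNilpotent (aeval A' P) := by
  -- The two commuting elements generate a commutative subalgebra, in which `P(A) - P(A')` is a
  -- multiple of `A - A'`.
  let s : Set C := {A, A'}
  have hs : ∀ a ∈ s, ∀ b ∈ s, a * b = b * a := by
    rintro a (rfl | rfl) b (rfl | rfl)
    · rfl
    · exact hc
    · exact hc.symm
    · rfl
  have := Algebra.isMulCommutative_adjoin ℝ hs
  let _ : CommRing (Algebra.adjoin ℝ s) := inferInstance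
  let a : Algebra.adjoin ℝ s := ⟨A, Algebra.subset_adjoin (by simp [s])⟩
  let a' : Algebra.adjoin ℝ s := ⟨A', Algebra.subset_adjoin (by simp [s])⟩
  have hinj : Function.Injective (Algebra.adjoin ℝ s).val := Subtype.val_injective
  have h1 : IsNilpotent (a - a') := by
    rw [← IsNilpotent.map_iff hinj]
    exact hn
  have h2 : IsNilpotent (aeval a P) := by
    rw [← IsNilpotent.map_iff hinj, ← aeval_algHom_apply]
    exact hP
  have h3 := Polynomial.isNilpotent_aeval_sub_of_isNilpotent_sub P h1
  have h4 : IsNilpotent (aeval a' P) := by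
    have h5 : aeval a' P = aeval a P - (aeval a P - aeval a' P) := by abel
    rw [h5]
    exact (Commute.all _ _).isNilpotent_sub h2 h3
  have := h4.map (Algebra.adjoin ℝ s).val
  rwa [← aeval_algHom_apply] at this

theorem isCen_of_isNilpotent_aeval {A : C} {P : ℝ[X]} (h0 : P ≠ 0)
    (h1 : ∀ z : ℂ, aeval z P = 0 → z.re = 0) (h2 : IsNilpotent (aeval A P)) : IsCen A := by
  obtain ⟨n, hn⟩ := h2
  refine ⟨P ^ n, pow_ne_zero _ h0, fun z hz => h1 z ?_, by rw [map_pow, hn]⟩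
  rw [map_pow] at hz
  exact eq_zero_of_pow_eq_zero hz

theorem IsCen.of_commute {A A' : C} (h : IsCen A) (hc : A * A' = A' * A)
    (hn : IsNilpotent (A - A')) : IsCen A' := by
  obtain ⟨P, h0, h1, h2⟩ := h
  exact isCen_of_isNilpotent_aeval h0 h1
    (isNilpotent_aeval_of_commute hc hn P (by rw [h2]; exact IsNilpotent.zero))

/-- A squarefree polynomial with a power divisible by the minimal polynomial takes a nilpotent value
at `A`, which is zero in a reduced algebra. -/
theorem isSqfree_of_isReduced [FiniteDimensional ℝ C] [IsReduced C] (A : C) : IsSqfree A := by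
  classical
  have h0 : minpoly ℝ A ≠ 0 := minpoly.ne_zero_of_finite ℝ A
  obtain ⟨P, n, hs, -, hd⟩ := exists_squarefree_dvd_pow_of_ne_zero h0
  refine ⟨P, hs, ?_⟩
  have : IsNilpotent (aeval A P) := ⟨n, by
    rw [← map_pow]
    obtain ⟨Q, hQ⟩ := hd
    rw [hQ, map_mul, minpoly.aeval, zero_mul]⟩
  exact this.eq_zero

end SpectralConditions

/-! ### Semisimple elements and the Jordan decomposition -/

section Semisimple

open Polynomial

variable {C : Type*} [Ring C] [Algebra ℝ C]

theorem mulLeft_isSemisimple {S : C} (hS : IsSqfree S) :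
    Module.End.IsSemisimple (LinearMap.mulLeft ℝ S) := by
  obtain ⟨P, h1, h2⟩ := hS
  refine Module.End.isSemisimple_of_squarefree_aeval_eq_zero h1 ?_
  change aeval (Algebra.lmul ℝ C S) P = 0
  rw [aeval_algHom_apply, h2, map_zero]

theorem aeval_mulRight (S : C) (P : ℝ[X]) :
    aeval (LinearMap.mulRight ℝ S) P = LinearMap.mulRight ℝ (aeval S P) := by
  induction P using Polynomial.induction_on' with
  | add p q hp hq => rw [map_add, map_add, hp, hq]; ext; simp [mul_add]
  | monomial n a =>
    rw [aeval_monomial, aeval_monomial, LinearMap.pow_mulRight]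
    ext x
    simp [Algebra.algebraMap_eq_smul_one]

theorem mulRight_isSemisimple {S : C} (hS : IsSqfree S) :
    Module.End.IsSemisimple (LinearMap.mulRight ℝ S) := by
  obtain ⟨P, h1, h2⟩ := hS
  refine Module.End.isSemisimple_of_squarefree_aeval_eq_zero h1 ?_
  rw [aeval_mulRight, h2]
  ext; simp

theorem adj_isSemisimple [FiniteDimensional ℝ C] {S : C} (hS : IsSqfree S) :
    Module.End.IsSemisimple (adj S) :=
  Module.End.IsSemisimple.sub_of_commute (LinearMap.commute_mulLeft_right (R:=ℝ) S S)
    (mulLeft_isSemisimple hS) (mulRight_isSemisimple hS)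

theorem ker_eq_of_pow {V : Type*} [AddCommGroup V] [Module ℝ V] [FiniteDimensional ℝ V]
    {f : Module.End ℝ V} (hf : f.IsSemisimple) {k : ℕ} {x : V} (h : (f ^ k) x = 0) : f x = 0 := by
  have h1 : x ∈ f.maxGenEigenspace 0 := by
    rw [Module.End.mem_maxGenEigenspace]
    exact ⟨k, by simpa using h⟩
  rw [hf.isFinitelySemisimple.maxGenEigenspace_eq_eigenspace] at h1
  simpa using h1

/-- `adj S` is a difference of commuting semisimple maps, hence semisimple, so the kernel of its
square is its kernel. This splits C into the centralizer of S and a complement stable under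
everything that commutes with S. -/
theorem isCompl_ker_range_adj [FiniteDimensional ℝ C] {S : C} (hS : IsSqfree S) :
    IsCompl (LinearMap.ker (adj S)) (LinearMap.range (adj S)) := by
  have h1 : Disjoint (LinearMap.ker (adj S)) (LinearMap.range (adj S)) := by
    rw [Submodule.disjoint_def]
    rintro x hx ⟨y, rfl⟩
    refine ker_eq_of_pow (adj_isSemisimple hS) (k := 2) ?_
    rw [pow_two]
    exact hx
  refine ⟨h1, ?_⟩
  rw [codisjoint_iff]
  apply Submodule.eq_top_of_disjoint _ _ _ h1
  have := LinearMap.finrank_range_add_finrank_ker (K := ℝ) (V := C) (V₂ := C) (adj S)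
  omega

theorem adj_isNilpotent {N : C} (hN : IsNilpotent N) : IsNilpotent (adj N) := by
  refine (LinearMap.commute_mulLeft_right (R:=ℝ) N N).isNilpotent_sub ?_ ?_
  · rwa [LinearMap.isNilpotent_mulLeft_iff]
  · rwa [LinearMap.isNilpotent_mulRight_iff]

/-- The Jordan decomposition. -/
theorem exists_jordan [FiniteDimensional ℝ C] (A : C) :
    ∃ S ∈ Algebra.adjoin ℝ {A}, ∃ N ∈ Algebra.adjoin ℝ {A}, IsSqfree S ∧ IsNilpotent N ∧
      A = S + N := by
  -- The decomposition is taken for left multiplication by `A`. Its parts are polynomials in that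
  -- map, hence left multiplications themselves.
  obtain ⟨n, hn, s, hs, h1, h2, h3⟩ :=
    Module.End.exists_isNilpotent_isSemisimple (f := Algebra.lmul ℝ C A)
  have hinj : Function.Injective (Algebra.lmul ℝ C) := Algebra.lmul_injective
  rw [← Set.image_singleton, ← AlgHom.map_adjoin] at hn hs
  obtain ⟨N, hN, rfl⟩ := hn
  obtain ⟨S, hS, rfl⟩ := hs
  refine ⟨S, hS, N, hN, ?_, ?_, ?_⟩
  · exact IsSqfree.of_map _ hinj ⟨_, h2.minpoly_squarefree, minpoly.aeval _ _⟩
  · exact (IsNilpotent.map_iff hinj).1 h1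
  · apply hinj
    rw [map_add, h3, add_comm]
    rfl

theorem jordan_unique [FiniteDimensional ℝ C] {S N S' N' : C} (hS : IsSqfree S)
    (hN : IsNilpotent N) (hc : S * N = N * S) (hS' : IsSqfree S')
    (hN' : IsNilpotent N') (hc' : S' * N' = N' * S') (h : S + N = S' + N') : S = S' := by
  have hinj : Function.Injective (Algebra.lmul ℝ C) := Algebra.lmul_injective
  have hc1 : Commute N S := hc.symm
  have hc2 : Commute N' S' := hc'.symm
  apply hinj
  refine (Module.End.isNilpotent_isSemisimple_unique (hN.map (Algebra.lmul ℝ C))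
    (mulLeft_isSemisimple hS) (hN'.map (Algebra.lmul ℝ C)) (mulLeft_isSemisimple hS')
    (hc1.map (Algebra.lmul ℝ C)) (hc2.map (Algebra.lmul ℝ C)) ?_).2
  have := congrArg (Algebra.lmul ℝ C) h
  rw [map_add, map_add, add_comm, add_comm (Algebra.lmul ℝ C S')] at this
  exact this

variable [FiniteDimensional ℝ C]

/-- The semisimple part of an element. -/
noncomputable def ssPart (A : C) : C := (exists_jordan A).choose

theorem ssPart_mem (A : C) : ssPart A ∈ Algebra.adjoin ℝ {A} := (exists_jordan A).choose_spec.1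

theorem ssPart_isSqfree (A : C) : IsSqfree (ssPart A) := by
  obtain ⟨-, N, -, h, -⟩ := (exists_jordan A).choose_spec
  exact h

theorem sub_ssPart_isNilpotent (A : C) : IsNilpotent (A - ssPart A) := by
  obtain ⟨-, N, -, -, h, h2⟩ := (exists_jordan A).choose_spec
  have : A - ssPart A = N := by
    rw [sub_eq_iff_eq_add']
    exact h2
  rwa [this]

theorem commute_ssPart {A X : C} (h : X * A = A * X) : X * ssPart A = ssPart A * X :=
  Algebra.commute_of_mem_adjoin_singleton_of_commute (ssPart_mem A) h

theorem ssPart_comm (A : C) : ssPart A * A = A * ssPart A :=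
  (commute_ssPart (A := A) (X := A) rfl).symm

theorem ssPart_eq {S N : C} (hS : IsSqfree S) (hN : IsNilpotent N) (hc : S * N = N * S) :
    ssPart (S + N) = S := by
  refine jordan_unique (ssPart_isSqfree _) (sub_ssPart_isNilpotent (S + N)) ?_ hS hN hc (by abel)
  rw [mul_sub, sub_mul, ssPart_comm]

theorem ssPart_equiv {B : Type*} [Ring B] [Algebra ℝ B] [FiniteDimensional ℝ B] (e : C ≃ₐ[ℝ] B)
    (A : C) : ssPart (e A) = e (ssPart A) := by
  have h : e A = e (ssPart A) + e (A - ssPart A) := by rw [← map_add]; simp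
  rw [h]
  refine ssPart_eq ((ssPart_isSqfree A).map e.toAlgHom) ((sub_ssPart_isNilpotent A).map e) ?_
  rw [← map_mul, ← map_mul, mul_sub, sub_mul, ssPart_comm]

end Semisimple

/-! ### The trace form, centralizers and double centralizers -/

section TraceForm

variable {C : Type*} [Ring C] [Algebra ℝ C]

/-- The trace of the left multiplication. -/
noncomputable def trL : C →ₗ[ℝ] ℝ := LinearMap.trace ℝ C ∘ₗ (Algebra.lmul ℝ C).toLinearMap

theorem trL_mul_comm (x y : C) : trL (x * y) = trL (y * x) := by
  simp only [trL, LinearMap.comp_apply, AlgHom.toLinearMap_apply, map_mul]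
  exact LinearMap.trace_mul_comm ℝ _ _

/-- Invariance of the trace form: commutator maps are skew, so the kernel of `adj y` is orthogonal
to its range. -/
theorem trL_adj_mul (x y z : C) : trL (x * adj y z) = - trL (adj y x * z) := by
  rw [adj_apply, adj_apply, mul_sub, sub_mul, map_sub, map_sub, ← mul_assoc,
    ← mul_assoc x z y, trL_mul_comm (x * z) y, mul_assoc y x z]
  ring

variable [FiniteDimensional ℝ C]

theorem trL_eq_zero_of_isNilpotent {x : C} (hx : IsNilpotent x) : trL x = 0 :=
  (LinearMap.isNilpotent_trace_of_isNilpotent (hx.map (Algebra.lmul ℝ C))).eq_zero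

theorem isIdempotentElem_lmul {e : C} (he : e * e = e) :
    IsIdempotentElem (Algebra.lmul ℝ C e) := by
  rw [IsIdempotentElem, ← map_mul, he]

theorem trL_idempotent_nonneg {e : C} (he : e * e = e) : 0 ≤ trL e := by
  have h := (LinearMap.IsIdempotentElem.isProj_range _ (isIdempotentElem_lmul he)).trace
  change 0 ≤ LinearMap.trace ℝ C (Algebra.lmul ℝ C e)
  rw [h]
  positivity

theorem eq_zero_of_trL_idempotent {e : C} (he : e * e = e) (h : trL e = 0) : e = 0 := by
  have h1 := LinearMap.IsIdempotentElem.eq_zero_of_trace_eq_zero (isIdempotentElem_lmul he) h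
  exact Algebra.lmul_injective (h1.trans (map_zero _).symm)

/-- The trace form of a semisimple algebra is nondegenerate. -/
theorem eq_zero_of_trL [IsSemisimpleRing C] {x : C} (h : ∀ y, trL (x * y) = 0) : x = 0 := by
  -- The left ideal of `x` is generated by an idempotent `e = c x`. The trace of `e` is the rank of
  -- a projection and is zero by hypothesis, so `e = 0`.
  obtain ⟨e, he, hs⟩ := IsSemisimpleRing.ideal_eq_span_idempotent (Ideal.span {x} : Ideal C)
  have h1 : e ∈ Ideal.span {x} := by rw [hs]; exact Ideal.mem_span_singleton_self e
  obtain ⟨c, hc⟩ := Ideal.mem_span_singleton'.1 h1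
  have h2 : e = 0 := by
    refine eq_zero_of_trL_idempotent he ?_
    rw [← hc, trL_mul_comm, h]
  have h3 : x ∈ Ideal.span {e} := by rw [← hs]; exact Ideal.mem_span_singleton_self x
  rw [h2] at h3
  simpa using h3

/-- The centralizer of an element. -/
noncomputable abbrev cent (S : C) : Subalgebra ℝ C := Subalgebra.centralizer ℝ {S}

theorem mem_cent {S x : C} : x ∈ cent S ↔ S * x = x * S := by
  simp [cent, Subalgebra.mem_centralizer_iff]

theorem mem_cent_iff_adj {S x : C} : x ∈ cent S ↔ adj S x = 0 := by
  rw [mem_cent, adj_apply, sub_eq_zero]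

/-- The double centralizer of an element. -/
noncomputable abbrev bicent (S : C) : Subalgebra ℝ C := Subalgebra.centralizer ℝ (cent S : Set C)

theorem mem_bicent {S x : C} : x ∈ bicent S ↔ ∀ z ∈ cent S, z * x = x * z := by
  simp only [bicent, Subalgebra.mem_centralizer_iff, SetLike.mem_coe]

theorem self_mem_cent (S : C) : S ∈ cent S := mem_cent.2 rfl

theorem self_mem_bicent (S : C) : S ∈ bicent S :=
  mem_bicent.2 fun _ hz => (mem_cent.1 hz).symm

theorem bicent_le_cent (S : C) : bicent S ≤ cent S :=
  fun _ hx => mem_cent.2 (mem_bicent.1 hx S (self_mem_cent S))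

theorem bicent_le_of_cent_le {S S' : C} (h : cent S' ≤ cent S) : bicent S ≤ bicent S' :=
  fun _ hx => mem_bicent.2 fun z hz => mem_bicent.1 hx z (h hz)

instance (S : C) : IsMulCommutative (bicent S) :=
  ⟨⟨fun x y => Subtype.ext (mem_bicent.1 y.2 _ (bicent_le_cent S x.2))⟩⟩

variable [IsSemisimpleRing C]

/-- C is the sum of the centralizer of S and the range of `adj S`. The element x is trace-orthogonal
to the range by invariance and to the centralizer because nilpotents have trace zero; the form is
nondegenerate. -/
theorem eq_zero_of_forall_isNilpotent_mul {S : C} (hS : IsSqfree S) {x : C} (hx : x ∈ cent S)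
    (h : ∀ y ∈ cent S, IsNilpotent (x * y)) : x = 0 := by
  refine eq_zero_of_trL fun y => ?_
  have hy : y ∈ LinearMap.ker (adj S) ⊔ LinearMap.range (adj S) := by
    rw [(isCompl_ker_range_adj hS).sup_eq_top]; trivial
  obtain ⟨k, hk, _, ⟨z, rfl⟩, rfl⟩ := Submodule.mem_sup.1 hy
  rw [mul_add, map_add, trL_adj_mul, mem_cent_iff_adj.1 hx, zero_mul, map_zero, neg_zero, add_zero]
  exact trL_eq_zero_of_isNilpotent (h k (mem_cent_iff_adj.2 hk))

/-- The Jacobson radical of the centralizer is a nilpotent ideal, so its elements satisfy the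
nilpotency criterion for being zero. -/
theorem cent_isSemisimpleRing {S : C} (hS : IsSqfree S) : IsSemisimpleRing (cent S) := by
  have : IsArtinianRing (cent S) := IsArtinianRing.of_finite ℝ _
  rw [IsArtinianRing.isSemisimpleRing_iff_jacobson]
  obtain ⟨n, hn⟩ := IsSemiprimaryRing.isNilpotent (R := cent S)
  rw [eq_bot_iff]
  intro x hx
  rw [Ideal.mem_bot]
  refine Subtype.ext (eq_zero_of_forall_isNilpotent_mul hS x.2 fun y hy => ?_)
  have h1 : x * ⟨y, hy⟩ ∈ Ring.jacobson (cent S) := Ideal.mul_mem_right _ _ hx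
  have h2 : (x * ⟨y, hy⟩) ^ n = 0 := by
    have := Ideal.pow_mem_pow h1 n
    rw [hn] at this
    simpa using this
  exact ⟨n, by simpa using congrArg Subtype.val h2⟩

/-- A nilpotent x in the double centralizer commutes with every y in the centralizer, so all
products x y are nilpotent. -/
theorem bicent_isReduced {S : C} (hS : IsSqfree S) : IsReduced (bicent S) := by
  refine ⟨fun x hx => Subtype.ext ?_⟩
  refine eq_zero_of_forall_isNilpotent_mul hS (bicent_le_cent S x.2) fun y hy => ?_
  have hc : Commute (x : C) y := (mem_bicent.1 x.2 y hy).symm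
  exact hc.isNilpotent_mul_right (hx.map (bicent S).val)

end TraceForm

/-! ### Characters of reduced commutative real algebras -/

section Characters

variable {E : Type*} [CommRing E] [Algebra ℝ E] [FiniteDimensional ℝ E] [IsReduced E]

/-- The characters of a finite-dimensional reduced commutative algebra, one from each conjugate
pair, and the corresponding idempotents. -/
theorem exists_characters (E : Type*) [CommRing E] [Algebra ℝ E] [FiniteDimensional ℝ E]
    [IsReduced E] : ∃ (n : ℕ) (χ : Fin n → E →ₐ[ℝ] ℂ) (e : Fin n → E),
    (∀ x y, (∀ i, χ i x = χ i y) → x = y) ∧ ∀ i j, χ j (e i) = if i = j then 1 else 0 := by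
  classical
  have : IsArtinianRing E := IsArtinianRing.of_finite ℝ _
  have hfin : Finite (MaximalSpectrum E) := inferInstance
  obtain ⟨n, ⟨eq⟩⟩ := hfin.exists_equiv_fin
  -- The algebra is the product of its residue fields, each of which is a finite extension of ℝ and
  -- embeds in ℂ.
  have hmax : ∀ m : MaximalSpectrum E, ∃ φ : (E ⧸ m.asIdeal) →ₐ[ℝ] ℂ, Function.Injective φ := by
    intro m
    let _ := Ideal.Quotient.field m.asIdeal
    exact ⟨IsAlgClosed.lift, RingHom.injective _⟩
  choose φ hφ using hmax
  refine ⟨n, fun i => (φ (eq.symm i)).comp (Ideal.Quotient.mkₐ ℝ _),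
    fun i => (IsArtinianRing.equivPi E).symm (Pi.single (eq.symm i) 1), fun x y h => ?_,
    fun i j => ?_⟩
  · apply (IsArtinianRing.equivPi E).injective
    funext m
    have := h (eq m)
    rw [AlgHom.comp_apply, AlgHom.comp_apply] at this
    have h2 := hφ _ this
    rw [Equiv.symm_apply_apply] at h2
    exact h2
  · rw [AlgHom.comp_apply]
    have : Ideal.Quotient.mkₐ ℝ (eq.symm j).asIdeal
        ((IsArtinianRing.equivPi E).symm (Pi.single (eq.symm i) 1)) =
        (Pi.single (eq.symm i) 1 : ∀ I : MaximalSpectrum E, E ⧸ I.asIdeal) (eq.symm j) := by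
      conv_rhs => rw [← (IsArtinianRing.equivPi E).apply_symm_apply (Pi.single (eq.symm i) 1)]
      rfl
    rw [this]
    split_ifs with hij
    · subst hij
      simp
    · rw [Pi.single_eq_of_ne (fun h => hij (eq.symm.injective h).symm), map_zero]

open Polynomial in
theorem isCen_iff_of_characters {n : ℕ} {χ : Fin n → E →ₐ[ℝ] ℂ}
    (hχ : ∀ x y, (∀ i, χ i x = χ i y) → x = y) (l : E) : IsCen l ↔ ∀ i, (χ i l).re = 0 := by
  constructor
  · rintro ⟨P, h0, h1, h2⟩ i
    refine h1 _ ?_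
    rw [aeval_algHom_apply, h2, map_zero]
  · intro h
    -- Each `χ i l` equals `i b` with b real, a root of `X² + b²`; so every character kills the
    -- product evaluated at `l`.
    refine ⟨∏ i, (X ^ 2 + C ((χ i l).im ^ 2)), ?_, ?_, ?_⟩
    · rw [Finset.prod_ne_zero_iff]
      intro i _
      exact (monic_X_pow_add_C _ two_ne_zero).ne_zero
    · intro z hz
      rw [map_prod, Finset.prod_eq_zero_iff] at hz
      obtain ⟨i, -, hi⟩ := hz
      simp only [map_add, map_pow, aeval_X, aeval_C, Complex.coe_algebraMap] at hi
      have h1 := congrArg Complex.re hi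
      have h2 := congrArg Complex.im hi
      simp [pow_two] at h1 h2
      rcases mul_eq_zero.1 (by linarith : z.re * z.im = 0) with h3 | h3
      · exact h3
      · rw [h3] at h1
        nlinarith [mul_self_nonneg z.re, mul_self_nonneg (χ i l).im]
    · apply hχ
      intro i
      rw [← aeval_algHom_apply, map_zero, map_prod]
      refine Finset.prod_eq_zero (Finset.mem_univ i) ?_
      simp only [map_add, map_pow, aeval_X, aeval_C, Complex.coe_algebraMap]
      have : χ i l = (χ i l).im * Complex.I := by
        apply Complex.ext <;> simp [h i]
      rw [this, mul_pow, Complex.I_sq]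
      simp

/-- Through the characters the spectral condition becomes the linear condition that all real parts
vanish. -/
theorem IsCen.add_of_reduced {x y : E} (hx : IsCen x) (hy : IsCen y) : IsCen (x + y) := by
  obtain ⟨n, χ, e, h1, -⟩ := exists_characters E
  rw [isCen_iff_of_characters h1] at *
  intro i
  simp [hx i, hy i]

theorem IsCen.smul_of_reduced {x : E} (hx : IsCen x) (c : ℝ) : IsCen (c • x) := by
  obtain ⟨n, χ, e, h1, -⟩ := exists_characters E
  rw [isCen_iff_of_characters h1] at *
  intro i
  simp [hx i]

theorem isCen_zero {C : Type*} [Ring C] [Algebra ℝ C] : IsCen (0 : C) :=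
  ⟨Polynomial.X, Polynomial.X_ne_zero, by simp, by simp⟩

/-- The trace form is negative definite on imaginary elements: `l² = -∑ b_i² e_i`, where `b_i` is
the imaginary part of `χ i l` and the nonzero idempotents `f (e i)` have positive trace. -/
theorem eq_zero_of_trL_sq {C : Type*} [Ring C] [Algebra ℝ C] [FiniteDimensional ℝ C]
    {f : E →ₐ[ℝ] C} (hf : Function.Injective f) {l : E} (hl : IsCen l)
    (h : trL (f l * f l) = 0) : l = 0 := by
  obtain ⟨n, χ, e, h1, h2⟩ := exists_characters E
  rw [isCen_iff_of_characters h1] at hl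
  have hid : ∀ i, e i * e i = e i := by
    intro i
    apply h1
    intro j
    rw [map_mul, h2]
    split_ifs <;> simp
  have hll : l * l = ∑ i, (-(χ i l).im ^ 2) • e i := by
    apply h1
    intro j
    have : χ j l = (χ j l).im * Complex.I := by
      apply Complex.ext <;> simp [hl j]
    simp only [map_mul, map_sum, map_smul, h2]
    rw [Finset.sum_eq_single j]
    · rw [if_pos rfl, this]
      have hI : Complex.I * Complex.I = -1 := Complex.I_mul_I
      simp
      linear_combination ((χ j l).im : ℂ) ^ 2 * hI
    · intro b _ hb
      simp [hb]
    · simp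
  have hnn : ∀ i, 0 ≤ (χ i l).im ^ 2 * trL (f (e i)) := fun i =>
    mul_nonneg (sq_nonneg _) (trL_idempotent_nonneg (by rw [← map_mul, hid]))
  have hsum : ∑ i, (χ i l).im ^ 2 * trL (f (e i)) = 0 := by
    rw [← map_mul, hll, map_sum, map_sum] at h
    simp only [map_smul, smul_eq_mul, neg_mul, Finset.sum_neg_distrib, neg_eq_zero] at h
    exact h
  rw [Finset.sum_eq_zero_iff_of_nonneg fun i _ => hnn i] at hsum
  apply h1
  intro i
  have h3 := hsum i (Finset.mem_univ i)
  rw [map_zero]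
  apply Complex.ext
  · exact hl i
  · rcases mul_eq_zero.1 h3 with h4 | h4
    · exact pow_eq_zero_iff two_ne_zero |>.1 h4
    · exfalso
      have h5 := eq_zero_of_trL_idempotent (by rw [← map_mul, hid]) h4
      have h6 : e i = 0 := hf (h5.trans (map_zero f).symm)
      have h7 := h2 i i
      rw [h6] at h7
      simp at h7

/-- An imaginary element vanishes at the real characters, so it is determined by one real number at
each non-real character. Each of these characters yields an idempotent `e i` with a complex
structure `J i`. -/
theorem exists_complex_idempotents (E : Type*) [CommRing E] [Algebra ℝ E] [FiniteDimensional ℝ E]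
    [IsReduced E] (L : Submodule ℝ E) (hL : ∀ l ∈ L, IsCen l) :
    ∃ (ι : Type) (_ : Fintype ι) (_ : DecidableEq ι) (e J : ι → E),
      finrank ℝ L ≤ Fintype.card ι ∧ (∀ i, e i ≠ 0) ∧
      (∀ i j, e i * e j = if i = j then e i else 0) ∧
      ∀ i, J i * J i = - e i ∧ J i * e i = J i := by
  classical
  obtain ⟨n, χ, e, h1, h2⟩ := exists_characters E
  let ι := {i : Fin n // ∃ x, (χ i x).im ≠ 0}
  choose x hx using fun i : ι => i.2
  -- Normalized so that `χ i` sends it to `I`; the factor `e i` makes the other characters vanish on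
  -- it.
  let J : ι → E := fun i => ((χ i (x i)).im⁻¹ • (x i - (χ i (x i)).re • 1)) * e i
  have hJ : ∀ i : ι, ∀ j, χ j (J i) = if i = j then Complex.I else 0 := by
    intro i j
    simp only [J, map_mul, h2]
    split_ifs with hij
    · subst hij
      have h3 : χ i (x i) - ((χ i (x i)).re : ℂ) = (χ i (x i)).im * Complex.I := by
        rw [sub_eq_iff_eq_add']
        exact (Complex.re_add_im _).symm
      have h4 : ((χ i (x i)).im : ℂ) ≠ 0 := by exact_mod_cast hx i
      rw [map_smul, map_sub, map_smul, map_one, mul_one, Complex.real_smul, Complex.real_smul,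
        mul_one, h3]
      push_cast
      field_simp
    · simp
  refine ⟨ι, inferInstance, inferInstance, fun i => e i, J, ?_, ?_, ?_, ?_⟩
  · let f : L →ₗ[ℝ] (ι → ℝ) :=
      LinearMap.pi fun i => Complex.imLm ∘ₗ (χ i).toLinearMap ∘ₗ L.subtype
    have hf : Function.Injective f := by
      rw [injective_iff_map_eq_zero]
      intro l hl
      refine Subtype.ext (h1 _ _ fun i => ?_)
      have h3 := (isCen_iff_of_characters h1 _).1 (hL l l.2) i
      rw [ZeroMemClass.coe_zero, map_zero]
      refine Complex.ext h3 ?_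
      by_cases h : ∃ x, (χ i x).im ≠ 0
      · exact congrFun hl ⟨i, h⟩
      · push Not at h
        exact h l
    have := LinearMap.finrank_le_finrank_of_injective hf
    rwa [Module.finrank_fintype_fun_eq_card] at this
  · intro i h
    have := h2 i i
    rw [show e i = 0 from h] at this
    simp at this
  · intro i j
    apply h1
    intro k
    rw [map_mul, h2, h2]
    by_cases hij : i = j
    · subst hij
      rw [if_pos rfl, h2]
      split_ifs <;> simp
    · rw [if_neg hij, map_zero]
      have : (i : Fin n) ≠ j := fun h => hij (Subtype.ext h)
      by_cases h3 : (i : Fin n) = k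
      · rw [if_neg fun h : (j : Fin n) = k => this (h3.trans h.symm), mul_zero]
      · rw [if_neg h3, zero_mul]
  · intro i
    constructor
    · apply h1
      intro k
      rw [map_mul, hJ, map_neg, h2]
      split_ifs <;> simp
    · apply h1
      intro k
      rw [map_mul, hJ, h2]
      split_ifs <;> simp

end Characters

/-! ### Imaginary elements of the double centralizer -/

section ImCenter

variable {C : Type*} [Ring C] [Algebra ℝ C] [FiniteDimensional ℝ C]

/-- The elements of the double centralizer of `S` with purely imaginary spectrum. -/
noncomputable def imCenter (S : C) : Submodule ℝ C :=
  Submodule.span ℝ {l | l ∈ bicent S ∧ IsCen l}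

theorem isCen_coe_iff {B : Subalgebra ℝ C} (x : B) : IsCen (x : C) ↔ IsCen x :=
  ⟨fun h => IsCen.of_map B.val Subtype.val_injective h, fun h => h.map B.val⟩

variable [IsSemisimpleRing C]

-- For semisimple S the span in `imCenter` adds nothing: the double centralizer is commutative and
-- reduced, so its imaginary elements already form a subspace.
open scoped IsMulCommutative in
theorem mem_imCenter {S : C} (hS : IsSqfree S) {l : C} :
    l ∈ imCenter S ↔ l ∈ bicent S ∧ IsCen l := by
  have := bicent_isReduced hS
  constructor
  · intro h
    induction h using Submodule.span_induction with
    | mem x hx => exact hx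
    | zero => exact ⟨zero_mem _, isCen_zero⟩
    | add x y _ _ hx hy =>
      refine ⟨add_mem hx.1 hy.1, ?_⟩
      have h1 := (isCen_coe_iff (B := bicent S) ⟨x, hx.1⟩).1 hx.2
      have h2 := (isCen_coe_iff (B := bicent S) ⟨y, hy.1⟩).1 hy.2
      exact (h1.add_of_reduced h2).map (bicent S).val
    | smul c x _ hx =>
      refine ⟨Subalgebra.smul_mem _ hx.1 c, ?_⟩
      have h1 := (isCen_coe_iff (B := bicent S) ⟨x, hx.1⟩).1 hx.2
      exact (h1.smul_of_reduced c).map (bicent S).val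
  · intro h
    exact Submodule.subset_span h

theorem isSqfree_of_mem_bicent {S : C} (hS : IsSqfree S) {l : C} (hl : l ∈ bicent S) :
    IsSqfree l := by
  have := bicent_isReduced hS
  exact (isSqfree_of_isReduced (⟨l, hl⟩ : bicent S)).map (bicent S).val

open scoped IsMulCommutative in
theorem eq_zero_of_mem_imCenter {S : C} (hS : IsSqfree S) {l : C} (hl : l ∈ imCenter S)
    (h : trL (l * l) = 0) : l = 0 := by
  have := bicent_isReduced hS
  rw [mem_imCenter hS] at hl
  have h1 := (isCen_coe_iff (B := bicent S) ⟨l, hl.1⟩).1 hl.2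
  exact congrArg Subtype.val
    (eq_zero_of_trL_sq (f := (bicent S).val) Subtype.val_injective h1 h)

open scoped IsMulCommutative in
theorem imCenter_idempotents {S : C} (hS : IsSqfree S) :
    ∃ (ι : Type) (_ : Fintype ι) (_ : DecidableEq ι) (e J : ι → C),
      finrank ℝ (imCenter S) ≤ Fintype.card ι ∧ (∀ i, e i ≠ 0) ∧
      (∀ i j, e i * e j = if i = j then e i else 0) ∧
      ∀ i, J i * J i = - e i ∧ J i * e i = J i := by
  have := bicent_isReduced hS
  obtain ⟨ι, i1, i2, e, J, h1, h2, h3, h4⟩ := exists_complex_idempotents (bicent S)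
    ((imCenter S).comap (bicent S).val.toLinearMap)
    (fun l hl => (isCen_coe_iff l).1 ((mem_imCenter hS).1 hl).2)
  refine ⟨ι, i1, i2, fun i => e i, fun i => J i, ?_, fun i h => h2 i (Subtype.ext h), ?_, ?_⟩
  · refine le_trans ?_ h1
    have hle : imCenter S ≤ LinearMap.range (bicent S).val.toLinearMap := fun x hx =>
      ⟨⟨x, ((mem_imCenter hS).1 hx).1⟩, rfl⟩
    have := Submodule.finrank_map_le (bicent S).val.toLinearMap
      ((imCenter S).comap (bicent S).val.toLinearMap)
    rwa [Submodule.map_comap_eq_of_le hle] at this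
  · intro i j
    have := congrArg Subtype.val (h3 i j)
    split_ifs with hij
    · rw [if_pos hij] at this
      exact this
    · rw [if_neg hij] at this
      exact this
  · exact fun i => ⟨congrArg Subtype.val (h4 i).1, congrArg Subtype.val (h4 i).2⟩

end ImCenter

/-! ### Elements commuting with S and close to S + N -/

section NearSemisimple

theorem adj_commute {C : Type*} [Ring C] [Algebra ℝ C] {a b : C} (h : a * b = b * a) :
    Commute (adj a) (adj b) := by
  ext x
  simp only [Module.End.mul_apply, adj_apply, mul_sub, sub_mul]
  have h1 : a * (b * x) = b * (a * x) := by rw [← mul_assoc, h, mul_assoc]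
  have h2 : x * b * a = x * a * b := by rw [mul_assoc, ← h, mul_assoc]
  rw [h1, h2]
  noncomm_ring

theorem injective_eventually {E V : Type*} [NormedAddCommGroup E] [NormedSpace ℝ E]
    [FiniteDimensional ℝ E] [AddCommGroup V] [Module ℝ V] [FiniteDimensional ℝ V]
    (L : E →ₗ[ℝ] Module.End ℝ V) (P : Module.End ℝ V) (x : E)
    (h : Function.Injective (L x + P)) : ∀ᶠ y in 𝓝 x, Function.Injective (L y + P) := by
  have h1 : Tendsto (fun y => L y + P) (𝓝 x) (𝓝 (L x + P)) :=
    (L.continuous_of_finiteDimensional.tendsto x).add_const P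
  filter_upwards [h1.eventually (finrank_range_le_eventually (L x + P))] with y hy
  rw [LinearMap.finrank_range_of_inj h] at hy
  rw [LinearMap.injective_iff_surjective, ← LinearMap.range_eq_top]
  exact Submodule.eq_top_of_finrank_eq (le_antisymm (Submodule.finrank_le _) hy)

variable {C : Type*} [NormedRing C] [NormedAlgebra ℝ C] [FiniteDimensional ℝ C]

theorem mem_cent_of_mem_cent_add {S N : C} (hS : IsSqfree S) (hN : IsNilpotent N)
    (hc : S * N = N * S) {x : C} (hx : x ∈ cent (S + N)) : x ∈ cent S := by
  rw [mem_cent] at hx ⊢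
  have := commute_ssPart hx.symm
  rw [ssPart_eq hS hN hc] at this
  exact this.symm

/-- The semisimple part of S + N is S and is a polynomial in S + N, so whatever commutes with S + N
commutes with S and with N separately. -/
theorem mem_cent_add_iff {S N : C} (hS : IsSqfree S) (hN : IsNilpotent N)
    (hc : S * N = N * S) {x : C} : x ∈ cent (S + N) ↔ x ∈ cent S ∧ N * x = x * N := by
  constructor
  · intro h
    have h1 := mem_cent_of_mem_cent_add hS hN hc h
    refine ⟨h1, ?_⟩
    rw [mem_cent] at h h1
    rw [add_mul, mul_add, h1] at h
    exact add_left_cancel h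
  · rintro ⟨h1, h2⟩
    rw [mem_cent] at h1 ⊢
    rw [add_mul, mul_add, h1, h2]

/-- The sum of the commutator map of `A` and the projection onto the centralizer of `S`. -/
noncomputable def adjProj {S : C} (hS : IsSqfree S) (A : C) : Module.End ℝ C :=
  adj A + (LinearMap.ker (adj S)).projection (LinearMap.range (adj S)) (isCompl_ker_range_adj hS)

theorem adjProj_apply {S : C} (hS : IsSqfree S) (A : C) {k r : C} (hk : k ∈ cent S)
    (hr : r ∈ LinearMap.range (adj S)) :
    adjProj hS A (k + r) = (adj A k + k) + adj A r := by
  have h1 := Submodule.projection_apply_left (isCompl_ker_range_adj hS) ⟨k, mem_cent_iff_adj.1 hk⟩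
  have h2 := (Submodule.projection_apply_eq_zero_iff (isCompl_ker_range_adj hS)).2 hr
  rw [adjProj, LinearMap.add_apply, map_add, map_add, h2]
  change _ + ((LinearMap.ker (adj S)).projection (LinearMap.range (adj S)) _ k + 0) = _
  rw [h1]
  abel

theorem exists_cent_add_range {S : C} (hS : IsSqfree S) (x : C) :
    ∃ k ∈ cent S, ∃ r ∈ LinearMap.range (adj S), x = k + r := by
  have hy : x ∈ LinearMap.ker (adj S) ⊔ LinearMap.range (adj S) := by
    rw [(isCompl_ker_range_adj hS).sup_eq_top]; trivial
  obtain ⟨k, hk, r, hr, rfl⟩ := Submodule.mem_sup.1 hy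
  exact ⟨k, mem_cent_iff_adj.2 hk, r, hr, rfl⟩

theorem eq_zero_of_cent_add_range {S : C} (hS : IsSqfree S) {k r : C} (hk : k ∈ cent S)
    (hr : r ∈ LinearMap.range (adj S)) (h : k + r = 0) : k = 0 ∧ r = 0 := by
  have h1 : k = -r := eq_neg_of_add_eq_zero_left h
  have h2 := Submodule.disjoint_def.1 (isCompl_ker_range_adj hS).disjoint k
    (mem_cent_iff_adj.1 hk) (by rw [h1]; exact neg_mem hr)
  refine ⟨h2, ?_⟩
  rwa [h2, zero_add] at h

theorem adj_mem_cent {S A k : C} (hA : A ∈ cent S) (hk : k ∈ cent S) : adj A k ∈ cent S :=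
  sub_mem (mul_mem hA hk) (mul_mem hk hA)

theorem adj_mem_range {S A r : C} (hA : A ∈ cent S) (hr : r ∈ LinearMap.range (adj S)) :
    adj A r ∈ LinearMap.range (adj S) := by
  obtain ⟨z, rfl⟩ := hr
  refine ⟨adj A z, ?_⟩
  exact LinearMap.congr_fun (adj_commute (mem_cent.1 hA)) z

theorem adj_pow_mem_cent {S A k : C} (hA : A ∈ cent S) (hk : k ∈ cent S) (n : ℕ) :
    (adj A ^ n) k ∈ cent S := by
  induction n with
  | zero => exact hk
  | succ n ih => rw [pow_succ']; exact adj_mem_cent hA ih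

theorem adj_pow_mem_range {S A r : C} (hA : A ∈ cent S) (hr : r ∈ LinearMap.range (adj S))
    (n : ℕ) : (adj A ^ n) r ∈ LinearMap.range (adj S) := by
  induction n with
  | zero => exact hr
  | succ n ih => rw [pow_succ']; exact adj_mem_range hA ih

theorem eq_zero_of_adj_add_self {S N k : C} (hN : IsNilpotent N)
    (hk : k ∈ cent S) (h : adj (S + N) k + k = 0) : k = 0 := by
  have h1 : adj (S + N) k = adj N k := by
    have := mem_cent.1 hk
    rw [adj_apply, adj_apply, add_mul, mul_add, this]
    abel
  rw [h1] at h
  obtain ⟨u, hu⟩ := (adj_isNilpotent hN).isUnit_one_add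
  have h2 : u.val k = 0 := by
    rw [hu, LinearMap.add_apply, add_comm]
    exact h
  have h3 : (u⁻¹.val * u.val) k = k := by simp
  rw [← h3, Module.End.mul_apply, h2, map_zero]

variable {S N : C}

/-- On the centralizer of S the map is `1 + adj N`, which is unipotent. On the range of `adj S` it
is `adj (S + N)`, whose kernel lies in the centralizer of S and so meets that range in zero. -/
theorem adjProj_injective (hS : IsSqfree S) (hN : IsNilpotent N) (hc : S * N = N * S) :
    Function.Injective (adjProj hS (S + N)) := by
  have hA : S + N ∈ cent S := add_mem (self_mem_cent S) (mem_cent.2 hc)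
  rw [injective_iff_map_eq_zero]
  intro x hx
  obtain ⟨k, hk, r, hr, rfl⟩ := exists_cent_add_range hS x
  rw [adjProj_apply hS _ hk hr] at hx
  obtain ⟨h1, h2⟩ := eq_zero_of_cent_add_range hS (add_mem (adj_mem_cent hA hk) hk)
    (adj_mem_range hA hr) hx
  have h3 := eq_zero_of_adj_add_self hN hk h1
  have h4 := mem_cent_of_mem_cent_add hS hN hc (mem_cent_iff_adj.2 h2)
  have h5 := Submodule.disjoint_def.1 (isCompl_ker_range_adj hS).disjoint r
    (mem_cent_iff_adj.1 h4) hr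
  rw [h3, h5, add_zero]

/-- `adjProj` is bijective and preserves the decomposition, so `adj (S + N)` maps the range of `adj
S` onto itself. -/
theorem range_adj_le (hS : IsSqfree S) (hN : IsNilpotent N) (hc : S * N = N * S) :
    LinearMap.range (adj S) ≤ LinearMap.range (adj (S + N)) := by
  have hA : S + N ∈ cent S := add_mem (self_mem_cent S) (mem_cent.2 hc)
  intro x hx
  obtain ⟨y, rfl⟩ := LinearMap.injective_iff_surjective.1 (adjProj_injective hS hN hc) x
  obtain ⟨k, hk, r, hr, rfl⟩ := exists_cent_add_range hS y
  rw [adjProj_apply hS _ hk hr] at hx ⊢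
  have h1 : adj (S + N) k + k ∈ LinearMap.range (adj S) := by
    have := sub_mem hx (adj_mem_range hA hr)
    rwa [add_sub_cancel_right] at this
  have h2 := Submodule.disjoint_def.1 (isCompl_ker_range_adj hS).disjoint _
    (mem_cent_iff_adj.1 (add_mem (adj_mem_cent hA hk) hk)) h1
  rw [h2, zero_add]
  exact ⟨r, rfl⟩

/-- Injectivity of `adjProj` is an open condition, so `adj A` stays injective on the range of `adj
S`, and its generalized kernel cannot leave the centralizer of S. In terms of spectra: distinct
eigenvalues do not merge under a small perturbation. -/
theorem cent_eventually (hS : IsSqfree S) (hN : IsNilpotent N) (hc : S * N = N * S) :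
    ∀ᶠ A in 𝓝 (S + N), A ∈ cent S → ∀ x k, (adj A ^ k) x = 0 → x ∈ cent S := by
  let L : C →ₗ[ℝ] Module.End ℝ C := LinearMap.mul ℝ C - (LinearMap.mul ℝ C).flip
  filter_upwards [injective_eventually L _ (S + N) (adjProj_injective hS hN hc)] with A hinj hA x n hx
  obtain ⟨k, hk, r, hr, rfl⟩ := exists_cent_add_range hS x
  rw [map_add] at hx
  have h1 := (eq_zero_of_cent_add_range hS (adj_pow_mem_cent hA hk n)
    (adj_pow_mem_range hA hr n) hx).2
  have h2 : r = 0 := by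
    clear hx
    induction n generalizing r with
    | zero => exact h1
    | succ n ih =>
      rw [pow_succ, Module.End.mul_apply] at h1
      have h3 := ih _ (adj_mem_range hA hr) h1
      apply hinj
      change adjProj hS A r = adjProj hS A 0
      have h4 := adjProj_apply hS A (zero_mem _) hr
      rw [zero_add, map_zero, add_zero, zero_add, h3] at h4
      rw [h4, map_zero]
  rw [h2, add_zero]
  exact hk

/-- On the centralizer of S the map `adj (S + N)` coincides with the nilpotent map `adj N`. This is
the counterpart of `cent_eventually`, used to compare centralizers of semisimple parts. -/
theorem exists_adj_pow_eq_zero (hN : IsNilpotent N) (hc : S * N = N * S) {x : C}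
    (hx : x ∈ cent S) : ∃ k, (adj (S + N) ^ k) x = 0 := by
  obtain ⟨n, hn⟩ := adj_isNilpotent hN
  refine ⟨n, ?_⟩
  have h : ∀ m, (adj (S + N) ^ m) x = (adj N ^ m) x := by
    intro m
    induction m with
    | zero => rfl
    | succ m ih =>
      rw [pow_succ', pow_succ', Module.End.mul_apply, Module.End.mul_apply, ih]
      have h1 := mem_cent.1 (adj_pow_mem_cent (S := S) (mem_cent.2 hc) hx m)
      rw [adj_apply, adj_apply, add_mul, mul_add, h1]
      abel
  rw [h, hn, LinearMap.zero_apply]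

theorem cdim_eq_cdim_subalgebra {C : Type*} [Ring C] [Algebra ℝ C] {A : C} (B : Subalgebra ℝ C)
    (n : B) (h : ∀ x, A * x = x * A ↔ x ∈ B ∧ (n : C) * x = x * n) : cdim A = cdim n := by
  have : LinearMap.ker (adj A) = (LinearMap.ker (adj n)).map B.val.toLinearMap := by
    ext x
    rw [mem_ker_adj, h]
    constructor
    · rintro ⟨h1, h2⟩
      exact ⟨⟨x, h1⟩, mem_ker_adj.2 (Subtype.ext h2), rfl⟩
    · rintro ⟨y, hy, rfl⟩
      exact ⟨y.2, congrArg Subtype.val (mem_ker_adj.1 hy)⟩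
  rw [cdim, this]
  exact (Submodule.equivMapOfInjective _ Subtype.val_injective _).finrank_eq.symm

end NearSemisimple

/-! ### Strata of elements with imaginary spectrum -/

section CenterStrata

variable {C : Type*} [NormedRing C] [NormedAlgebra ℝ C] [FiniteDimensional ℝ C]

/-- The number of parameters of the spectrum on the imaginary axis. -/
noncomputable def imDim {C : Type*} [Ring C] [Algebra ℝ C] [FiniteDimensional ℝ C] (A : C) : ℕ :=
  finrank ℝ (imCenter (ssPart A))

/-- The elements with purely imaginary spectrum and the same invariants as `A₀`. -/
def cenStratum {C : Type*} [Ring C] [Algebra ℝ C] [FiniteDimensional ℝ C] (A₀ : C) : Set C :=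
  {A | IsCen A ∧ imDim A = imDim A₀ ∧ cdim A = cdim A₀}

theorem cent_equiv {C B : Type*} [Ring C] [Algebra ℝ C] [FiniteDimensional ℝ C]
    [Ring B] [Algebra ℝ B] [FiniteDimensional ℝ B] (e : C ≃ₐ[ℝ] B) (S x : C) :
    e x ∈ cent (e S) ↔ x ∈ cent S := by
  rw [mem_cent, mem_cent, ← map_mul, ← map_mul, e.injective.eq_iff]

theorem bicent_equiv {C B : Type*} [Ring C] [Algebra ℝ C] [FiniteDimensional ℝ C]
    [Ring B] [Algebra ℝ B] [FiniteDimensional ℝ B] (e : C ≃ₐ[ℝ] B) (S x : C) :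
    e x ∈ bicent (e S) ↔ x ∈ bicent S := by
  rw [mem_bicent, mem_bicent]
  constructor
  · intro h z hz
    have := h (e z) ((cent_equiv e S z).2 hz)
    rwa [← map_mul, ← map_mul, e.injective.eq_iff] at this
  · intro h z hz
    obtain ⟨z, rfl⟩ := e.surjective z
    rw [← map_mul, ← map_mul, h z ((cent_equiv e S z).1 hz)]

theorem imDim_equiv {C B : Type*} [Ring C] [Algebra ℝ C] [FiniteDimensional ℝ C]
    [Ring B] [Algebra ℝ B] [FiniteDimensional ℝ B] (e : C ≃ₐ[ℝ] B) (A : C) :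
    imDim (e A) = imDim A := by
  have h : imCenter (e (ssPart A)) = (imCenter (ssPart A)).map e.toLinearMap := by
    rw [imCenter, imCenter, Submodule.map_span]
    congr 1
    ext x
    obtain ⟨x, rfl⟩ := e.surjective x
    constructor
    · rintro ⟨h1, h2⟩
      exact ⟨x, ⟨(bicent_equiv e _ x).1 h1, IsCen.of_map e.toAlgHom e.injective h2⟩, rfl⟩
    · rintro ⟨y, ⟨h1, h2⟩, h3⟩
      obtain rfl : y = x := e.injective h3
      exact ⟨(bicent_equiv e _ y).2 h1, h2.map e.toAlgHom⟩
  rw [imDim, ssPart_equiv, h]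
  exact (Submodule.equivMapOfInjective _ e.injective _).finrank_eq.symm

theorem cenStratum_conj {C : Type*} [Ring C] [Algebra ℝ C] [FiniteDimensional ℝ C] (A₀ : C) :
    ∀ A ∈ cenStratum A₀, ∀ g : Cˣ, g.val * A * g⁻¹.val ∈ cenStratum A₀ := by
  rintro A ⟨h1, h2, h3⟩ g
  rw [← conjEquiv_apply]
  exact ⟨h1.map (conjEquiv g).toAlgHom, (imDim_equiv _ _).trans h2, (cdim_equiv _ _).trans h3⟩

variable [IsSemisimpleRing C]

/-- Definiteness of the trace form on `imCenter S` gives the orthogonal projection Q onto it. Being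
linear and continuous, Q extracts the displacement of the semisimple part from a small perturbation.
-/
theorem exists_trace_projection {S : C} (hS : IsSqfree S) :
    ∃ Q : C →ₗ[ℝ] C, ∀ w, ∀ l ∈ imCenter S, (∀ l' ∈ imCenter S, trL (l' * w) = trL (l' * l)) →
      Q w = l := by
  let B : C →ₗ[ℝ] Module.Dual ℝ (imCenter S) :=
    (LinearMap.lcomp ℝ ℝ (imCenter S).subtype ∘ₗ
      LinearMap.llcomp ℝ C C ℝ trL ∘ₗ (LinearMap.mul ℝ C).flip)
  have hB : ∀ w l, B w l = trL ((l : C) * w) := fun _ _ => rfl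
  have hinj : Function.Injective (B ∘ₗ (imCenter S).subtype) := by
    rw [injective_iff_map_eq_zero]
    intro l hl
    refine Subtype.ext (eq_zero_of_mem_imCenter hS l.2 ?_)
    rw [← hB, ← Submodule.coe_subtype, ← LinearMap.comp_apply, hl, LinearMap.zero_apply]
  let e := LinearEquiv.ofInjectiveOfFinrankEq _ hinj Subspace.dual_finrank_eq.symm
  refine ⟨(imCenter S).subtype ∘ₗ e.symm.toLinearMap ∘ₗ B, fun w l hl h => ?_⟩
  have h1 : B w = e ⟨l, hl⟩ := by
    ext l'
    rw [hB, h l' l'.2]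
    rfl
  rw [LinearMap.comp_apply, LinearMap.comp_apply, h1]
  simp

/-- A transversal to the nilpotent orbit in the centralizer of `S`, meeting the stratum of the
orbit only at the base point. -/
theorem exists_transversal {S N : C} (hS : IsSqfree S) (hN : IsNilpotent N) (hc : S * N = N * S) :
    ∃ Y : Submodule ℝ C, (∀ y ∈ Y, y ∈ cent S) ∧ imCenter S ≤ Y ∧ finrank ℝ Y = cdim (S + N) ∧
      (∀ v ∈ cent S, ∃ y ∈ Y, ∃ g ∈ cent S, v = y + (g * N - N * g)) ∧
      ∀ᶠ w in 𝓝 (0 : C), w ∈ Y → IsNilpotent (N + w) →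
        ∀ A, (∀ x, A * x = x * A ↔ x ∈ cent S ∧ (N + w) * x = x * (N + w)) →
          cdim A = cdim (S + N) → w = 0 := by
  have := cent_isSemisimpleRing hS
  let N' : cent S := ⟨N, mem_cent.2 hc⟩
  let L' : Submodule ℝ (cent S) := (imCenter S).comap (cent S).val.toLinearMap
  -- If `l = adj N z` is in `imCenter S`, then `trL (l * l) = -trL (adj N l * z) = 0` since `l`
  -- commutes with `N`; so `l = 0`. Hence the complement can be chosen to contain `imCenter S`.
  have hdis : Disjoint L' (LinearMap.range (adj N')) := by
    rw [Submodule.disjoint_def]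
    rintro l hl ⟨z, hz⟩
    refine Subtype.ext (eq_zero_of_mem_imCenter hS hl ?_)
    have h1 : (l : C) = adj N (z : C) := by rw [← hz]; rfl
    have h2 : adj N (l : C) = 0 := by
      have h3 := mem_bicent.1 ((mem_imCenter hS).1 hl).1 N (mem_cent.2 hc)
      rw [adj_apply, sub_eq_zero]
      exact h3
    change trL ((l : C) * l) = 0
    nth_rewrite 2 [h1]
    rw [trL_adj_mul, h2, zero_mul, map_zero, neg_zero]
  obtain ⟨Y', hLY, hY'⟩ := hdis.exists_isCompl
  have hfin : finrank ℝ Y' = cdim N' := by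
    have h1 := Submodule.finrank_add_eq_of_isCompl hY'
    have h2 := LinearMap.finrank_range_add_finrank_ker (K := ℝ) (V := cent S) (V₂ := cent S) (adj N')
    rw [cdim]
    omega
  have hcd : cdim (S + N) = cdim N' :=
    cdim_eq_cdim_subalgebra (cent S) N' fun x => by
      rw [← mem_cent]
      exact mem_cent_add_iff hS hN hc
  have hsl : ∀ v : cent S, ∃ y ∈ Y', ∃ g, v = y + (g * N' - N' * g) := by
    intro v
    have hv : v ∈ Y' ⊔ LinearMap.range (adj N') := by rw [hY'.sup_eq_top]; trivial
    obtain ⟨y, hy, _, ⟨g, rfl⟩, rfl⟩ := Submodule.mem_sup.1 hv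
    refine ⟨y, hy, -g, ?_⟩
    rw [adj_apply]
    noncomm_ring
  have hN' : IsNilpotent N' := by
    rw [← IsNilpotent.map_iff (f := (cent S).val) Subtype.val_injective]
    exact hN
  -- The centralizer of S is semisimple, so the nilpotent stratum of `N` in it is a submanifold of
  -- codimension `dim Y'` and meets the transversal only at `N`.
  have hiso := SubmfdAt.isolated_of_conj (nilStratum_conj N') ⟨hN', rfl⟩ hsl
    (hfin ▸ nilStratum_submfdAt N' hN')
  refine ⟨Y'.map (cent S).val.toLinearMap, ?_, ?_, ?_, ?_, ?_⟩
  · rintro _ ⟨y, -, rfl⟩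
    exact y.2
  · intro l hl
    exact ⟨⟨l, bicent_le_cent S ((mem_imCenter hS).1 hl).1⟩, hLY hl, rfl⟩
  · rw [hcd, ← hfin]
    exact (Submodule.equivMapOfInjective _ Subtype.val_injective _).finrank_eq.symm
  · intro v hv
    obtain ⟨y, hy, g, h⟩ := hsl ⟨v, hv⟩
    exact ⟨y, ⟨y, hy, rfl⟩, g, g.2, congrArg Subtype.val h⟩
  · have hind : IsInducing (fun y : Y' => ((y : cent S) : C)) :=
      IsInducing.subtypeVal.comp IsInducing.subtypeVal
    rw [hind.nhds_eq_comap, eventually_comap] at hiso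
    filter_upwards [hiso] with w hw
    rintro ⟨y, hy, rfl⟩ hnil A hA' hA
    have h1 := hw ⟨y, hy⟩ rfl ⟨?_, ?_⟩
    · change ((y : cent S) : C) = 0
      have : y = 0 := congrArg Subtype.val h1
      rw [this]
      rfl
    · rw [← IsNilpotent.map_iff (f := (cent S).val) Subtype.val_injective]
      exact hnil
    · rw [← hcd, ← hA]
      symm
      exact cdim_eq_cdim_subalgebra (cent S) _ hA'

end CenterStrata

section CenterStrata

variable {C : Type*} [NormedRing C] [NormedAlgebra ℝ C] [FiniteDimensional ℝ C]
  [IsSemisimpleRing C]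

theorem imCenter_eq_of_cent_eq {S S' : C} (h : cent S = cent S') : imCenter S = imCenter S' := by
  rw [imCenter, imCenter, bicent, bicent, h]

/-- Adding l only moves the semisimple part to S + l. By `hcent` the centralizer of S + l is still
that of S, so both invariants are unchanged. -/
theorem mem_cenStratum_of_mem_imCenter {S N l : C} (hS : IsSqfree S) (hN : IsNilpotent N)
    (hc : S * N = N * S) (hcen : IsCen (S + N)) (hl : l ∈ imCenter S)
    (hcent : ∀ x k, (adj (S + N + l) ^ k) x = 0 → x ∈ cent S) :
    S + N + l ∈ cenStratum (S + N) := by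
  have hlb := ((mem_imCenter hS).1 hl).1
  have hNS : N ∈ cent S := mem_cent.2 hc
  have hSl : S + l ∈ bicent S := add_mem (self_mem_bicent S) hlb
  have hSlq : IsSqfree (S + l) := isSqfree_of_mem_bicent hS hSl
  have hc' : (S + l) * N = N * (S + l) := (mem_bicent.1 hSl N hNS).symm
  have hA : S + N + l = (S + l) + N := by abel
  have hss : ssPart (S + N + l) = S + l := by rw [hA, ssPart_eq hSlq hN hc']
  have hcenS : IsCen S := hcen.of_commute
    (by rw [add_mul, mul_add, hc]) (by rwa [add_sub_cancel_left])
  have hSmem : S ∈ imCenter S := (mem_imCenter hS).2 ⟨self_mem_bicent S, hcenS⟩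
  have hcent' : cent (S + l) = cent S := by
    refine le_antisymm (fun x hx => ?_) (fun x hx => mem_cent.2 (mem_bicent.1 hSl x hx).symm)
    obtain ⟨k, hk⟩ := exists_adj_pow_eq_zero hN hc' hx
    rw [← hA] at hk
    exact hcent x k hk
  refine ⟨?_, ?_, ?_⟩
  · rw [hA]
    refine (((mem_imCenter hS).1 (add_mem hSmem hl)).2).of_commute ?_ ?_
    · rw [mul_add, add_mul _ N, hc']
    · rw [sub_add_cancel_left]
      exact hN.neg
  · rw [imDim, imDim, hss, ssPart_eq hS hN hc, imCenter_eq_of_cent_eq hcent']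
  · rw [cdim, cdim]
    suffices h : LinearMap.ker (adj (S + N + l)) = LinearMap.ker (adj (S + N)) by rw [h]
    ext x
    rw [mem_ker_adj, mem_ker_adj, ← mem_cent, ← mem_cent, hA, mem_cent_add_iff hSlq hN hc',
      mem_cent_add_iff hS hN hc, hcent']

/-- For A = S + N + w in the stratum, constancy of `imDim` keeps the semisimple part inside
`imCenter S` with the same centralizer. Constancy of `cdim` then prevents the nilpotent part from
moving in the transversal, so w is a pure displacement of eigenvalues. -/
theorem cenStratum_eventually {S N : C} (hS : IsSqfree S) (hN : IsNilpotent N)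
    (hc : S * N = N * S) (hcen : IsCen (S + N)) :
    ∃ Y : Submodule ℝ C, imCenter S ≤ Y ∧ finrank ℝ Y = cdim (S + N) ∧
      (∀ v, ∃ y ∈ Y, ∃ g, v = y + (g * (S + N) - (S + N) * g)) ∧
      ∀ᶠ w in 𝓝 (0 : C), w ∈ Y → (S + N + w ∈ cenStratum (S + N) ↔ w ∈ imCenter S) := by
  obtain ⟨Y, hYc, hLY, hfin, hsl, hiso⟩ := exists_transversal hS hN hc
  obtain ⟨Q, hQ⟩ := exists_trace_projection hS
  have hNS : N ∈ cent S := mem_cent.2 hc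
  refine ⟨Y, hLY, hfin, fun v => ?_, ?_⟩
  · obtain ⟨k, hk, r, hr, rfl⟩ := exists_cent_add_range hS v
    obtain ⟨z, rfl⟩ := range_adj_le hS hN hc hr
    obtain ⟨y, hy, g, hg, rfl⟩ := hsl k hk
    -- The part of `v` in the range of `adj S` is the commutator of `S + N` with `z`. As `g`
    -- commutes with `S`, its commutator with `N` is that with `S + N`.
    refine ⟨y, hy, g - z, ?_⟩
    have := mem_cent.1 hg
    rw [adj_apply, sub_mul, mul_sub, mul_add g, add_mul S N g, this]
    abel
  · have t1 : Tendsto (fun w => S + N + w) (𝓝 (0 : C)) (𝓝 (S + N)) := by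
      have : Continuous fun w : C => S + N + w := by fun_prop
      simpa using this.tendsto 0
    have t2 : Tendsto (fun w => w - Q w) (𝓝 (0 : C)) (𝓝 0) := by
      have h1 := Q.continuous_of_finiteDimensional
      have : Continuous fun w : C => w - Q w := by fun_prop
      simpa using this.tendsto 0
    filter_upwards [t1.eventually (cent_eventually hS hN hc), t2.eventually hiso] with w h1 h2 hwY
    have hAS : S + N + w ∈ cent S := add_mem (add_mem (self_mem_cent S) hNS) (hYc w hwY)
    have hcent := h1 hAS
    refine ⟨fun hA => ?_, fun hl => mem_cenStratum_of_mem_imCenter hS hN hc hcen hl hcent⟩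
    obtain ⟨hA1, hA2, hA3⟩ := hA
    set A := S + N + w with hAdef
    set S1 := ssPart A with hS1def
    have hS1 : IsSqfree S1 := ssPart_isSqfree A
    have hN1 : IsNilpotent (A - S1) := sub_ssPart_isNilpotent A
    have hc1 : S1 * (A - S1) = (A - S1) * S1 := by
      rw [mul_sub, sub_mul, ssPart_comm]
    have hA' : S1 + (A - S1) = A := by abel
    have hle : cent S1 ≤ cent S := by
      intro x hx
      obtain ⟨k, hk⟩ := exists_adj_pow_eq_zero hN1 hc1 hx
      rw [hA'] at hk
      exact hcent x k hk
    have hble := bicent_le_of_cent_le hle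
    -- The centralizer of `S1` lies in that of `S`, which reverses to an inclusion of the double
    -- centralizers; equal `imDim` makes it an equality on imaginary elements.
    have hL : imCenter S = imCenter S1 := by
      refine Submodule.eq_of_le_of_finrank_eq
        (Submodule.span_mono fun l hl => ⟨hble hl.1, hl.2⟩) ?_
      rw [imDim, imDim, ssPart_eq hS hN hc] at hA2
      exact hA2.symm
    have hcenS : IsCen S := hcen.of_commute
      (by rw [add_mul, mul_add, hc]) (by rwa [add_sub_cancel_left])
    have hcenS1 : IsCen S1 := hA1.of_commute (ssPart_comm A).symm hN1
    have hSmem : S ∈ imCenter S := (mem_imCenter hS).2 ⟨self_mem_bicent S, hcenS⟩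
    have hS1mem : S1 ∈ imCenter S := hL ▸ (mem_imCenter hS1).2 ⟨self_mem_bicent S1, hcenS1⟩
    have hS1b : S1 ∈ bicent S := ((mem_imCenter hS).1 hS1mem).1
    have hcenteq : cent S1 = cent S :=
      le_antisymm hle fun x hx => mem_cent.2 (mem_bicent.1 hS1b x hx).symm
    have hlmem : S1 - S ∈ imCenter S := sub_mem hS1mem hSmem
    have hN1c : A - S1 ∈ cent S := sub_mem hAS (bicent_le_cent S hS1b)
    have hw : w = (S1 - S) + ((A - S1) - N) := by rw [hAdef]; abel
    -- Both nilpotent parts commute with `imCenter S`, so they are trace-orthogonal to it and Q does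
    -- not see them.
    have hQw : Q w = S1 - S := by
      refine hQ w _ hlmem fun l' hl' => ?_
      have hl'b := ((mem_imCenter hS).1 hl').1
      have e1 : trL (l' * (A - S1)) = 0 := by
        refine trL_eq_zero_of_isNilpotent ?_
        have hcom : Commute l' (A - S1) := (mem_bicent.1 hl'b _ hN1c).symm
        exact hcom.isNilpotent_mul_left hN1
      have e2 : trL (l' * N) = 0 := by
        refine trL_eq_zero_of_isNilpotent ?_
        have hcom : Commute l' N := (mem_bicent.1 hl'b _ hNS).symm
        exact hcom.isNilpotent_mul_left hN
      rw [hw, mul_add, map_add, mul_sub l' (A - S1), map_sub, e1, e2, sub_zero, add_zero]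
    have hdiff : N + (w - Q w) = A - S1 := by rw [hQw, hAdef]; abel
    -- `N + (w - Q w)` is the nilpotent part of `A`, with centralizer in `cent S` of the same
    -- dimension as that of `N`; isolation in the transversal applies.
    have h3 : w - Q w = 0 := by
      refine h2 (sub_mem hwY (hLY (hQw ▸ hlmem))) (by rwa [hdiff]) A (fun x => ?_) hA3
      rw [hdiff, ← mem_cent, ← hcenteq, ← mem_cent_add_iff hS1 hN1 hc1, hA']
    rw [sub_eq_zero.1 h3, hQw]
    exact hlmem

/-- The stratum of an element with purely imaginary spectrum is a submanifold. -/
theorem cenStratum_submfdAt (A₀ : C) (hA₀ : IsCen A₀) :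
    SubmfdAt (cenStratum A₀) (cdim A₀ - imDim A₀) A₀ := by
  have hS := ssPart_isSqfree A₀
  have hN := sub_ssPart_isNilpotent A₀
  have hc : ssPart A₀ * (A₀ - ssPart A₀) = (A₀ - ssPart A₀) * ssPart A₀ := by
    rw [mul_sub, sub_mul, ssPart_comm]
  have hA : ssPart A₀ + (A₀ - ssPart A₀) = A₀ := by abel
  obtain ⟨Y, hLY, hfin, hsl, hev⟩ := cenStratum_eventually hS hN hc (by rwa [hA])
  rw [hA] at hfin hsl hev
  refine SubmfdAt.of_slice (cenStratum_conj A₀) ⟨hA₀, rfl, rfl⟩ hsl ?_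
  have h1 := SubmfdAt.submodule ((imCenter (ssPart A₀)).comap Y.subtype) (0 : Y)
  rw [(Submodule.comapSubtypeEquivOfLe hLY).finrank_eq, hfin] at h1
  refine h1.congr ?_
  have h2 : Tendsto (fun y : Y => (y : C)) (𝓝 0) (𝓝 0) :=
    continuous_subtype_val.tendsto (0 : Y)
  filter_upwards [h2.eventually hev] with y hy
  exact hy y.2

end CenterStrata

/-! ### Minimal centralizers -/

section Regular

-- A minor of `M + t N` is a polynomial in t. If one of size greater than r were nonzero at t = 1,
-- it would have finitely many zeros and could not vanish for all t near 0.
open Polynomial in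
theorem finrank_range_add_le_of_eventually {V W : Type*} [AddCommGroup V] [Module ℝ V]
    [FiniteDimensional ℝ V] [AddCommGroup W] [Module ℝ W] [FiniteDimensional ℝ W]
    (M N : V →ₗ[ℝ] W) (r : ℕ)
    (h : ∀ᶠ t in 𝓝 (0 : ℝ), finrank ℝ (LinearMap.range (M + t • N)) ≤ r) :
    finrank ℝ (LinearMap.range (M + N)) ≤ r := by
  by_contra hlt
  push Not at hlt
  set s := finrank ℝ (LinearMap.range (M + N)) with hs
  let b := finBasisOfFinrankEq ℝ (LinearMap.range (M + N)) hs.symm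
  obtain ⟨g, hg⟩ := LinearMap.exists_leftInverse_of_injective (LinearMap.range (M + N)).subtype
    (Submodule.ker_subtype _)
  obtain ⟨i, hi⟩ := LinearMap.exists_rightInverse_of_surjective (M + N).rangeRestrict
    (LinearMap.range_rangeRestrict _)
  let p : W →ₗ[ℝ] (Fin s → ℝ) := b.equivFun.toLinearMap ∘ₗ g
  let j : (Fin s → ℝ) →ₗ[ℝ] V := i ∘ₗ b.equivFun.symm.toLinearMap
  have hid : p ∘ₗ (M + N) ∘ₗ j = LinearMap.id := by
    refine LinearMap.ext fun x => ?_
    have h1 : (M + N) (i (b.equivFun.symm x)) = (LinearMap.range (M + N)).subtype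
        (b.equivFun.symm x) := by
      conv_rhs => rw [← LinearMap.id_apply (R := ℝ) (b.equivFun.symm x), ← hi]
      rfl
    simp only [p, j, LinearMap.comp_apply, LinearEquiv.coe_coe, h1]
    rw [← LinearMap.comp_apply g, hg]
    exact b.equivFun.apply_symm_apply x
  let M' := LinearMap.toMatrix' (p ∘ₗ M ∘ₗ j)
  let N' := LinearMap.toMatrix' (p ∘ₗ N ∘ₗ j)
  let q : ℝ[X] := (M'.map Polynomial.C + (X : ℝ[X]) • N'.map Polynomial.C).det
  have hq : ∀ t, q.eval t = LinearMap.det (p ∘ₗ (M + t • N) ∘ₗ j) := by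
    intro t
    have h1 : p ∘ₗ (M + t • N) ∘ₗ j = p ∘ₗ M ∘ₗ j + t • (p ∘ₗ N ∘ₗ j) := by
      refine LinearMap.ext fun x => ?_
      simp
    rw [h1, ← LinearMap.det_toMatrix', map_add, map_smul]
    have h2 : q.eval t = (Polynomial.evalRingHom t) q := rfl
    rw [h2, RingHom.map_det]
    congr 1
    ext a c
    simp [M', N']
    ring
  have hq1 : q ≠ 0 := by
    intro h0
    have := hq 1
    rw [h0, one_smul, hid, LinearMap.det_id] at this
    simp at this
  apply hq1
  apply Polynomial.eq_zero_of_infinite_isRoot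
  refine (infinite_of_mem_nhds (0 : ℝ) h).mono fun t ht => ?_
  by_contra hne
  rw [Set.mem_ofPred_eq, Polynomial.IsRoot, hq] at hne
  have hsurj : LinearMap.range (p ∘ₗ (M + t • N) ∘ₗ j) = ⊤ :=
    LinearMap.range_eq_top.2 (LinearMap.equivOfDetNeZero _ hne).surjective
  have h3 : s ≤ finrank ℝ (LinearMap.range (M + t • N)) := by
    have h4 : LinearMap.range (p ∘ₗ (M + t • N) ∘ₗ j) ≤ (LinearMap.range (M + t • N)).map p := by
      rw [← LinearMap.range_comp, ← LinearMap.comp_assoc]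
      exact LinearMap.range_comp_le_range _ _
    have h5 := Submodule.finrank_mono h4
    rw [hsurj, finrank_top, Module.finrank_fintype_fun_eq_card, Fintype.card_fin] at h5
    exact h5.trans (Submodule.finrank_map_le _ _)
  exact absurd (h3.trans ht) (not_le.2 hlt)

theorem cdim_add_finrank_range {C : Type*} [Ring C] [Algebra ℝ C] [FiniteDimensional ℝ C] (A : C) :
    finrank ℝ (LinearMap.range (adj A)) + cdim A = finrank ℝ C :=
  LinearMap.finrank_range_add_finrank_ker (K := ℝ) (V := C) (V₂ := C) (adj A)

/-- A semisimple element with commutative centralizer has the smallest centralizer. -/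
theorem cdim_le_of_commutative {C : Type*} [NormedRing C] [NormedAlgebra ℝ C]
    [FiniteDimensional ℝ C] {B : C} (hB : IsSqfree B)
    (hcomm : ∀ x ∈ cent B, ∀ y ∈ cent B, x * y = y * x) (A : C) : cdim B ≤ cdim A := by
  have hY : ∀ v, ∃ y ∈ Subalgebra.toSubmodule (cent B), ∃ g, v = y + (g * B - B * g) := by
    intro v
    obtain ⟨k, hk, _, ⟨z, rfl⟩, rfl⟩ := exists_cent_add_range hB v
    refine ⟨k, hk, -z, ?_⟩
    rw [adj_apply]
    noncomm_ring
  -- Near `B` every element is conjugate to `B + y` with `y` in the centralizer of `B`. As this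
  -- centralizer is commutative, it centralizes `B + y` too.
  have hev : ∀ᶠ z in 𝓝 B, cdim B ≤ cdim z := by
    filter_upwards [eventually_conj_slice hY] with z ⟨y, hy, u, hz⟩
    rw [hz, cdim_conj]
    refine Submodule.finrank_mono fun x hx => ?_
    have hx' : x ∈ cent B := mem_cent_iff_adj.2 hx
    rw [mem_ker_adj, add_mul, mul_add, mem_cent.1 hx', hcomm y hy x hx']
  have ht : Tendsto (fun t : ℝ => B + t • (A - B)) (𝓝 0) (𝓝 B) := by
    have : Continuous fun t : ℝ => B + t • (A - B) := by fun_prop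
    simpa using this.tendsto 0
  have hadj : ∀ t : ℝ, adj (B + t • (A - B)) = adj B + t • adj (A - B) := by
    intro t
    ext x
    simp only [adj_apply, LinearMap.add_apply, LinearMap.smul_apply, add_mul, mul_add,
      smul_mul_assoc, mul_smul_comm]
    rw [smul_sub]
    abel
  -- The local bound passes from near `B` to `A` along the line through both.
  have h1 := finrank_range_add_le_of_eventually (adj B) (adj (A - B))
    (finrank ℝ (LinearMap.range (adj B))) (by
      filter_upwards [ht.eventually hev] with t h2
      rw [← hadj]
      have h3 := cdim_add_finrank_range (B + t • (A - B))
      have h4 := cdim_add_finrank_range B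
      omega)
  have h5 : adj B + adj (A - B) = adj A := by
    have := hadj 1
    rw [one_smul, one_smul, add_sub_cancel] at this
    exact this.symm
  rw [h5] at h1
  have h3 := cdim_add_finrank_range A
  have h4 := cdim_add_finrank_range B
  omega

variable {C : Type*} [Ring C] [Algebra ℝ C] [FiniteDimensional ℝ C]

/-- The powers of A₀ below the degree of its minimal polynomial are independent and lie in the
centralizer; under `h` they span it. -/
theorem cent_commutative_of_minpoly {A₀ : C} (h : cdim A₀ ≤ (minpoly ℝ A₀).natDegree) :
    (∀ x ∈ cent A₀, ∀ y ∈ cent A₀, x * y = y * x) ∧ cdim A₀ = (minpoly ℝ A₀).natDegree := by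
  set P := Submodule.span ℝ (Set.range fun i : Fin (minpoly ℝ A₀).natDegree => A₀ ^ (i : ℕ)) with hP
  have hfin : finrank ℝ P = (minpoly ℝ A₀).natDegree := by
    rw [hP, finrank_span_eq_card (linearIndependent_pow A₀), Fintype.card_fin]
  have hle : P ≤ LinearMap.ker (adj A₀) := by
    rw [hP, Submodule.span_le]
    rintro _ ⟨i, rfl⟩
    rw [SetLike.mem_coe, mem_ker_adj]
    exact ((Commute.refl A₀).pow_right i)
  have heq : P = LinearMap.ker (adj A₀) :=
    Submodule.eq_of_le_of_finrank_le hle (by rw [hfin]; exact h)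
  have hadj : P ≤ Subalgebra.toSubmodule (Algebra.adjoin ℝ {A₀}) := by
    rw [hP, Submodule.span_le]
    rintro _ ⟨i, rfl⟩
    exact pow_mem (Algebra.self_mem_adjoin_singleton ℝ A₀) _
  refine ⟨fun x hx y hy => ?_, by rw [cdim, ← heq, hfin]⟩
  have hy' : y ∈ Algebra.adjoin ℝ {A₀} := hadj (heq ▸ mem_cent_iff_adj.1 hy)
  exact Algebra.commute_of_mem_adjoin_singleton_of_commute hy' (mem_cent.1 hx).symm

theorem ssPart_of_isSqfree {A : C} (hA : IsSqfree A) : ssPart A = A := by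
  have := ssPart_eq hA IsNilpotent.zero (by simp)
  rwa [add_zero] at this

variable [IsSemisimpleRing C]

open scoped IsMulCommutative in
theorem isCen_pow_odd {A : C} (hA : IsSqfree A) (hc : IsCen A) (j : ℕ) :
    IsCen (A ^ (2 * j + 1)) := by
  have := bicent_isReduced hA
  have h1 := (isCen_coe_iff (B := bicent A) ⟨A, self_mem_bicent A⟩).1 hc
  suffices h : IsCen ((⟨A, self_mem_bicent A⟩ : bicent A) ^ (2 * j + 1)) from
    h.map (bicent A).val
  obtain ⟨n, χ, e, h2, -⟩ := exists_characters (bicent A)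
  rw [isCen_iff_of_characters h2] at h1 ⊢
  intro i
  rw [map_pow]
  have h3 : χ i ⟨A, self_mem_bicent A⟩ = (χ i ⟨A, self_mem_bicent A⟩).im * Complex.I := by
    apply Complex.ext <;> simp [h1 i]
  have h4 : (Complex.I ^ 2) ^ j = (((-1 : ℝ) ^ j : ℝ) : ℂ) := by
    rw [Complex.I_sq]; push_cast; rfl
  rw [h3, mul_pow, pow_succ Complex.I, pow_mul Complex.I, h4, ← Complex.ofReal_pow, ← mul_assoc,
    ← Complex.ofReal_mul, Complex.re_ofReal_mul, Complex.I_re, mul_zero]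

/-- Odd powers of an imaginary element are imaginary, and those below the degree of the minimal
polynomial are independent elements of `imCenter A`. -/
theorem half_natDegree_minpoly_le_imDim {A : C} (hA : IsSqfree A) (hc : IsCen A) :
    (minpoly ℝ A).natDegree / 2 ≤ imDim A := by
  set d := (minpoly ℝ A).natDegree
  let f : Fin (d / 2) → Fin d := fun j => ⟨2 * j + 1, by omega⟩
  have hf : Function.Injective f := fun a b h => by
    have := congrArg Fin.val h
    simp only [f] at this
    exact Fin.ext (by omega)
  have hli : LinearIndependent ℝ fun j : Fin (d / 2) => A ^ (2 * (j : ℕ) + 1) :=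
    (linearIndependent_pow A).comp f hf
  have h1 := finrank_span_eq_card hli
  rw [Fintype.card_fin] at h1
  rw [imDim, ssPart_of_isSqfree hA, ← h1]
  refine Submodule.finrank_mono (Submodule.span_le.2 ?_)
  rintro _ ⟨j, rfl⟩
  exact (mem_imCenter hA).2 ⟨pow_mem (self_mem_bicent A) _, isCen_pow_odd hA hc j⟩

end Regular

/-! ### Upper bound for the number of imaginary parameters -/

section ImDimBound

variable {V : Type*} [AddCommGroup V] [Module ℝ V] [FiniteDimensional ℝ V]

/-- J is a complex structure on the range of e, which therefore is not a line: no real c satisfies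
c² = -1. -/
theorem two_le_finrank_range {e J : Module.End ℝ V} (he : e * e = e) (hne : e ≠ 0)
    (hJ : J * J = -e) (hJe : J * e = J) : 2 ≤ finrank ℝ (LinearMap.range e) := by
  by_contra hlt
  have h0 : finrank ℝ (LinearMap.range e) ≠ 0 := by
    intro h
    exact hne (LinearMap.range_eq_bot.1 (Submodule.finrank_eq_zero.1 h))
  obtain ⟨v, hv, hspan⟩ := finrank_eq_one_iff'.1 (show finrank ℝ (LinearMap.range e) = 1 by omega)
  have heJ : e * J = J := by
    have h1 : e = - (J * J) := by rw [hJ, neg_neg]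
    rw [h1, neg_mul, mul_assoc, hJ, mul_neg, neg_neg, hJe]
  obtain ⟨c, hc⟩ := hspan ⟨J v, J v, LinearMap.congr_fun heJ v⟩
  have hc' : c • (v : V) = J v := congrArg Subtype.val hc
  have hev : e (v : V) = v := by
    obtain ⟨w, hw⟩ := v.2
    rw [← hw]
    exact LinearMap.congr_fun he w
  have h2 : (c * c) • (v : V) = - (v : V) := by
    have h3 := LinearMap.congr_fun hJ (v : V)
    rw [LinearMap.neg_apply, hev, Module.End.mul_apply, ← hc', map_smul, ← hc', smul_smul] at h3
    exact h3
  have h4 : (c * c + 1) • (v : V) = 0 := by rw [add_smul, h2, one_smul, neg_add_cancel]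
  rcases smul_eq_zero.1 h4 with h5 | h5
  · nlinarith [mul_self_nonneg c]
  · exact hv (Subtype.ext h5)

theorem sum_finrank_range_le {ι : Type*} [Fintype ι] [DecidableEq ι] {e : ι → Module.End ℝ V}
    (he : ∀ i j, e i * e j = if i = j then e i else 0) :
    ∑ i, finrank ℝ (LinearMap.range (e i)) ≤ finrank ℝ V := by
  have hid : ∀ i, IsIdempotentElem (e i) := fun i => by rw [IsIdempotentElem, he, if_pos rfl]
  have hsum : IsIdempotentElem (∑ i, e i) := by
    rw [IsIdempotentElem, Finset.sum_mul_sum]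
    simp [he]
  have h1 := (LinearMap.IsIdempotentElem.isProj_range _ hsum).trace
  rw [map_sum] at h1
  have h2 : ∀ i, LinearMap.trace ℝ V (e i) = finrank ℝ (LinearMap.range (e i)) :=
    fun i => (LinearMap.IsIdempotentElem.isProj_range _ (hid i)).trace
  simp only [h2] at h1
  have h3 : ∑ i, finrank ℝ (LinearMap.range (e i)) =
      finrank ℝ (LinearMap.range (∑ i, e i)) := by exact_mod_cast h1
  rw [h3]
  exact Submodule.finrank_le _

variable {D : Type*} [DivisionRing D] [Algebra ℝ D] [Module D V] [IsScalarTower ℝ D V]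

/-- Restriction of scalars as a morphism of algebras. -/
def restrictScalarsAlgHom : Module.End D V →ₐ[ℝ] Module.End ℝ V :=
  AlgHom.ofLinearMap
    { toFun := fun A => A.restrictScalars ℝ
      map_add' := fun _ _ => rfl
      map_smul' := fun _ _ => rfl } rfl (fun _ _ => rfl)

/-- The orthogonal idempotents from `imCenter_idempotents` have ranges of real dimension at least c:
2 because of the complex structure, `finrank ℝ D` because the range is a D-space. The first choice
is the sharp one over ℝ, the second over ℍ. -/
theorem imDim_mul_le [IsSemisimpleRing (Module.End D V)] (A : Module.End D V) (c : ℕ)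
    (hc : c = 2 ∨ c = finrank ℝ D) : imDim A * c ≤ finrank ℝ V := by
  obtain ⟨ι, _, _, e, J, h1, h2, h3, h4⟩ := imCenter_idempotents (ssPart_isSqfree A)
  let f : Module.End D V →ₐ[ℝ] Module.End ℝ V := restrictScalarsAlgHom
  have hf : Function.Injective f := LinearMap.restrictScalars_injective ℝ
  have h5 : ∀ i, c ≤ finrank ℝ (LinearMap.range (f (e i))) := by
    intro i
    rcases hc with rfl | rfl
    · refine two_le_finrank_range (J := f (J i)) ?_ ?_ ?_ ?_
      · rw [← map_mul, h3, if_pos rfl]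
      · exact fun h => h2 i (hf (h.trans (map_zero f).symm))
      · rw [← map_mul, (h4 i).1, map_neg]
      · rw [← map_mul, (h4 i).2]
    · have : Module.Finite D V := finite_of_real D V
      have h6 : LinearMap.range (f (e i)) = (LinearMap.range (e i)).restrictScalars ℝ := rfl
      rw [h6]
      change _ ≤ finrank ℝ (LinearMap.range (e i))
      rw [← Module.finrank_mul_finrank ℝ D (LinearMap.range (e i))]
      refine Nat.le_mul_of_pos_right _ (Nat.pos_of_ne_zero fun h => h2 i ?_)
      exact LinearMap.range_eq_bot.1 (Submodule.finrank_eq_zero.1 h)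
  have h7 := sum_finrank_range_le (e := fun i => f (e i)) (fun i j => by
    rw [← map_mul, h3]; split_ifs <;> simp)
  calc imDim A * c ≤ Fintype.card ι * c := Nat.mul_le_mul_right _ h1
    _ = ∑ _i : ι, c := by simp
    _ ≤ _ := (Finset.sum_le_sum fun i _ => h5 i).trans h7

end ImDimBound

/-! ### The regular nilpotent -/

section Shift

variable {D V : Type*} [DivisionRing D] [Algebra ℝ D] [AddCommGroup V] [Module ℝ V] [Module D V]
  [IsScalarTower ℝ D V] [FiniteDimensional ℝ V]

/-- There is a nilpotent endomorphism with a centralizer of the smallest dimension. -/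
theorem exists_isNilpotent_cdim (n : ℕ) (hn : finrank D V = n) :
    ∃ A : Module.End D V, IsNilpotent A ∧ cdim A = finrank ℝ D * n := by
  have hfin : Module.Finite D V := finite_of_real D V
  let b : Basis (Fin n) D V := finBasisOfFinrankEq D V hn
  -- A single Jordan block: each basis vector goes to the next, and the last one to zero.
  let A : Module.End D V := b.constr ℕ fun k => if h : (k : ℕ) + 1 < n then b ⟨k + 1, h⟩ else 0
  have hA : ∀ k, A (b k) = if h : (k : ℕ) + 1 < n then b ⟨k + 1, h⟩ else 0 := fun k =>
    b.constr_basis ℕ _ k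
  have hpow : ∀ m k, (A ^ m) (b k) = if h : (k : ℕ) + m < n then b ⟨k + m, h⟩ else 0 := by
    intro m
    induction m with
    | zero => intro k; simp
    | succ m ih =>
      intro k
      rw [pow_succ, Module.End.mul_apply, hA]
      split_ifs with h1 h2 h2
      · rw [ih]
        have h3 : (k : ℕ) + 1 + m = k + (m + 1) := by ring
        rw [dif_pos (by simpa [h3] using h2)]
        simp [h3]
      · rw [ih, dif_neg]
        simp only
        omega
      · omega
      · rw [map_zero]
  have hnil : IsNilpotent A := by
    refine ⟨n, b.ext fun k => ?_⟩
    rw [hpow, dif_neg (by omega), LinearMap.zero_apply]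
  refine ⟨A, hnil, le_antisymm ?_ (le_cdim_of_isNilpotent n hn A hnil)⟩
  rw [← hn, Module.finrank_mul_finrank ℝ D V]
  rcases Nat.eq_zero_or_pos n with h0 | hpos
  · have hs : Subsingleton V := Module.finrank_zero_iff.1 (hn.trans h0)
    have hs2 : Subsingleton (Module.End D V) := inferInstance
    rw [cdim, Module.finrank_zero_of_subsingleton]
    exact Nat.zero_le _
  -- The first basis vector is cyclic, so an endomorphism commuting with `A` is determined by its
  -- value there.
  · let ev : LinearMap.ker (adj A) →ₗ[ℝ] V :=
      { toFun := fun T => T.1 (b ⟨0, hpos⟩)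
        map_add' := fun _ _ => rfl
        map_smul' := fun _ _ => rfl }
    refine LinearMap.finrank_le_finrank_of_injective (f := ev) ?_
    rw [injective_iff_map_eq_zero]
    intro T hT
    refine Subtype.ext (b.ext fun k => ?_)
    have h1 : b k = (A ^ (k : ℕ)) (b ⟨0, hpos⟩) := by
      rw [hpow, dif_pos (by simp)]
      simp
    have h2 : Commute A T.1 := mem_ker_adj.1 T.2
    have h3 := LinearMap.congr_fun (h2.pow_left k) (b ⟨0, hpos⟩)
    rw [Module.End.mul_apply, Module.End.mul_apply] at h3
    have h4 : T.1 (b ⟨0, hpos⟩) = 0 := hT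
    rw [h1, ← h3, h4, map_zero]
    rfl

end Shift

/-! ### Semisimple elements with distinct imaginary eigenvalues -/

section RegularElements

open Polynomial

/-- A polynomial with the simple roots `± i k`, `1 ≤ k ≤ n`. -/
noncomputable def imagPoly (n : ℕ) : ℝ[X] := ∏ k : Fin n, (X ^ 2 + C (((k : ℝ) + 1) ^ 2))

theorem imagPoly_factor_root {z : ℂ} {y : ℝ}
    (hz : aeval z (X ^ 2 + C (y ^ 2) : ℝ[X]) = 0) : z.re = 0 := by
  simp only [map_add, map_pow, aeval_X, aeval_C, Complex.coe_algebraMap] at hz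
  have h1 := congrArg Complex.re hz
  have h2 := congrArg Complex.im hz
  simp [pow_two] at h1 h2
  rcases mul_eq_zero.1 (by linarith : z.re * z.im = 0) with h3 | h3
  · exact h3
  · rw [h3] at h1
    nlinarith [mul_self_nonneg z.re, mul_self_nonneg y]

theorem imagPoly_root {n : ℕ} {z : ℂ} (hz : aeval z (imagPoly n) = 0) : z.re = 0 := by
  rw [imagPoly, map_prod, Finset.prod_eq_zero_iff] at hz
  obtain ⟨i, -, hi⟩ := hz
  exact imagPoly_factor_root hi

theorem imagPoly_separable (n : ℕ) : (imagPoly n).Separable := by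
  refine separable_prod (fun i j hij => ?_) fun i => ?_
  · have hne : ((j : ℝ) + 1) ^ 2 - ((i : ℝ) + 1) ^ 2 ≠ 0 := by
      have h1 : (j : ℝ) ≠ i := fun h => hij (Fin.ext (by exact_mod_cast h.symm))
      have h2 : ((j : ℝ) + 1) ^ 2 - ((i : ℝ) + 1) ^ 2 = ((j : ℝ) - i) * (j + i + 2) := by ring
      rw [h2]
      exact mul_ne_zero (sub_ne_zero.2 h1) (by positivity)
    refine ⟨-C ((((j : ℝ) + 1) ^ 2 - ((i : ℝ) + 1) ^ 2)⁻¹),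
      C ((((j : ℝ) + 1) ^ 2 - ((i : ℝ) + 1) ^ 2)⁻¹), ?_⟩
    have h3 : -C ((((j : ℝ) + 1) ^ 2 - ((i : ℝ) + 1) ^ 2)⁻¹) * (X ^ 2 + C (((i : ℝ) + 1) ^ 2)) +
        C ((((j : ℝ) + 1) ^ 2 - ((i : ℝ) + 1) ^ 2)⁻¹) * (X ^ 2 + C (((j : ℝ) + 1) ^ 2)) =
        C ((((j : ℝ) + 1) ^ 2 - ((i : ℝ) + 1) ^ 2)⁻¹ *
          (((j : ℝ) + 1) ^ 2 - ((i : ℝ) + 1) ^ 2)) := by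
      rw [C_mul, C_sub]
      ring
    rw [h3, inv_mul_cancel₀ hne, C_1]
  · have h1 : (X ^ 2 + C (((i : ℝ) + 1) ^ 2) : ℝ[X]) = X ^ 2 - C (-((i : ℝ) + 1) ^ 2) := by
      rw [C_neg, sub_neg_eq_add]
    rw [h1]
    exact separable_X_pow_sub_C _ (by norm_num) (neg_ne_zero.2 (by positivity))

theorem imagPoly_monic (n : ℕ) : (imagPoly n).Monic :=
  monic_prod_of_monic _ _ fun _ _ => monic_X_pow_add_C _ two_ne_zero

theorem imagPoly_natDegree (n : ℕ) : (imagPoly n).natDegree = 2 * n := by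
  rw [imagPoly, natDegree_prod_of_monic _ _ fun _ _ => monic_X_pow_add_C _ two_ne_zero]
  simp only [natDegree_X_pow_add_C]
  simp [mul_comm]

theorem isCoprime_imagPoly_X (n : ℕ) : IsCoprime (imagPoly n) X := by
  refine IsCoprime.prod_left fun i _ => ?_
  have hne : ((i : ℝ) + 1) ^ 2 ≠ 0 := by positivity
  refine ⟨C ((((i : ℝ) + 1) ^ 2)⁻¹), - C ((((i : ℝ) + 1) ^ 2)⁻¹) * X, ?_⟩
  have h3 : C ((((i : ℝ) + 1) ^ 2)⁻¹) * (X ^ 2 + C (((i : ℝ) + 1) ^ 2)) +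
      -C ((((i : ℝ) + 1) ^ 2)⁻¹) * X * X = C ((((i : ℝ) + 1) ^ 2)⁻¹ * ((i : ℝ) + 1) ^ 2) := by
    rw [C_mul]
    ring
  rw [h3, inv_mul_cancel₀ hne, C_1]

/-- Nonzero imaginary roots come in conjugate pairs; in odd degree the simple root 0 is added. This
is the source of the ceiling in the real case. -/
theorem exists_imag_poly (n : ℕ) : ∃ P : ℝ[X], P.Monic ∧ Squarefree P ∧ P.natDegree = n ∧
    ∀ z : ℂ, aeval z P = 0 → z.re = 0 := by
  rcases Nat.even_or_odd' n with ⟨m, rfl | rfl⟩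
  · exact ⟨imagPoly m, imagPoly_monic m, (imagPoly_separable m).squarefree, imagPoly_natDegree m,
      fun z => imagPoly_root⟩
  · refine ⟨imagPoly m * X, (imagPoly_monic m).mul monic_X,
      ((imagPoly_separable m).mul separable_X (isCoprime_imagPoly_X m)).squarefree, ?_, ?_⟩
    · rw [(imagPoly_monic m).natDegree_mul monic_X, imagPoly_natDegree, natDegree_X]
    · intro z hz
      rw [map_mul, aeval_X, mul_eq_zero] at hz
      rcases hz with hz | rfl
      · exact imagPoly_root hz
      · simp

/-- A semisimple element with purely imaginary spectrum and smallest possible centralizer. -/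
def IsRegularCen {C : Type*} [Ring C] [Algebra ℝ C] (A : C) (R : ℕ) : Prop :=
  IsSqfree A ∧ IsCen A ∧ R ≤ (minpoly ℝ A).natDegree ∧ cdim A ≤ R

theorem IsRegularCen.map {C B : Type*} [Ring C] [Algebra ℝ C] [Ring B] [Algebra ℝ B] {A : C}
    {R : ℕ} (h : IsRegularCen A R) (e : C ≃ₐ[ℝ] B) : IsRegularCen (e A) R := by
  obtain ⟨h1, h2, h3, h4⟩ := h
  refine ⟨h1.map e.toAlgHom, h2.map e.toAlgHom, ?_, ?_⟩
  · rwa [minpoly.algEquiv_eq]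
  · rwa [cdim_equiv]

/-- The companion matrix: multiplication by the root on `ℝ[X] / P`. The vector 1 is cyclic, so
commuting endomorphisms are determined by their value at 1. -/
theorem exists_isRegularCen_real (n : ℕ) :
    ∃ A : Matrix (Fin n) (Fin n) ℝ, IsRegularCen A n := by
  obtain ⟨P, hm, hs, hd, hr⟩ := exists_imag_poly n
  have hfin : FiniteDimensional ℝ (AdjoinRoot P) := (AdjoinRoot.powerBasis hm.ne_zero).finite
  have hfr : finrank ℝ (AdjoinRoot P) = n := by
    rw [(AdjoinRoot.powerBasis hm.ne_zero).finrank, AdjoinRoot.powerBasis_dim, hd]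
  let b := finBasisOfFinrankEq ℝ (AdjoinRoot P) hfr
  have hroot : aeval (AdjoinRoot.root P) P = 0 := by
    rw [AdjoinRoot.aeval_eq, AdjoinRoot.mk_self]
  have hreg : IsRegularCen (Algebra.lmul ℝ (AdjoinRoot P) (AdjoinRoot.root P)) n := by
    refine ⟨IsSqfree.map ⟨P, hs, hroot⟩ _, IsCen.map ⟨P, hm.ne_zero, hr, hroot⟩ _, ?_, ?_⟩
    · rw [minpoly.algHom_eq _ Algebra.lmul_injective, AdjoinRoot.minpoly_root hm.ne_zero,
        hm.leadingCoeff, inv_one, C_1, mul_one, hd]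
    · rw [cdim]
      refine le_trans ?_ hfr.le
      let ev : LinearMap.ker (adj (Algebra.lmul ℝ (AdjoinRoot P) (AdjoinRoot.root P))) →ₗ[ℝ]
          AdjoinRoot P :=
        { toFun := fun T => T.1 1
          map_add' := fun _ _ => rfl
          map_smul' := fun _ _ => rfl }
      refine LinearMap.finrank_le_finrank_of_injective (f := ev) ?_
      rw [injective_iff_map_eq_zero]
      intro T hT
      refine Subtype.ext (LinearMap.ext fun x => ?_)
      have h1 : x ∈ Algebra.adjoin ℝ {AdjoinRoot.root P} := by
        rw [AdjoinRoot.adjoinRoot_eq_top]; trivial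
      have h2 : Algebra.lmul ℝ _ x ∈
          Algebra.adjoin ℝ {Algebra.lmul ℝ (AdjoinRoot P) (AdjoinRoot.root P)} := by
        rw [← AlgHom.map_adjoin_singleton]
        exact ⟨x, h1, rfl⟩
      have h3 := Algebra.commute_of_mem_adjoin_singleton_of_commute h2
        (mem_ker_adj.1 T.2).symm
      have h4 := LinearMap.congr_fun h3 1
      have h5 : T.1 1 = 0 := hT
      rw [Module.End.mul_apply, Module.End.mul_apply, h5, map_zero] at h4
      simpa using h4
  exact ⟨_, hreg.map (algEquivMatrix b)⟩

variable {D : Type*} [NormedDivisionRing D] [NormedAlgebra ℝ D] [FiniteDimensional ℝ D]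

theorem minpoly_diagonal_natDegree {u : D} (hu : u * u = -1) (n : ℕ) :
    2 * n ≤ (minpoly ℝ (Matrix.diagonal fun k : Fin n => ((k : ℝ) + 1) • u)).natDegree := by
  set A := Matrix.diagonal fun k : Fin n => ((k : ℝ) + 1) • u with hA
  set Q := minpoly ℝ A with hQ
  let φ : ℂ →ₐ[ℝ] D := Complex.lift ⟨u, hu⟩
  have h1 : ∀ k : Fin n, aeval ((((k : ℝ) + 1 : ℝ) : ℂ) * Complex.I) Q = 0 := by
    intro k
    have h2 : aeval (Matrix.diagonalAlgHom ℝ fun k : Fin n => ((k : ℝ) + 1) • u) Q = 0 :=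
      minpoly.aeval ℝ A
    rw [aeval_algHom_apply] at h2
    have h3 : Pi.evalAlgHom ℝ (fun _ : Fin n => D) k
        (aeval (fun k : Fin n => ((k : ℝ) + 1) • u) Q) = 0 :=
      congrFun (Matrix.diagonal_injective (h2.trans Matrix.diagonal_zero.symm)) k
    rw [← aeval_algHom_apply] at h3
    have h4 : Pi.evalAlgHom ℝ (fun _ : Fin n => D) k (fun k : Fin n => ((k : ℝ) + 1) • u) =
        φ ((((k : ℝ) + 1 : ℝ) : ℂ) * Complex.I) := by
      rw [← Complex.real_smul, map_smul]
      simp [φ]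
    rw [h4, aeval_algHom_apply] at h3
    exact φ.toRingHom.injective (h3.trans (map_zero φ).symm)
  by_contra hlt
  have hne : Q ≠ 0 := minpoly.ne_zero_of_finite ℝ A
  let f : Fin n ⊕ Fin n → ℂ := Sum.elim (fun k => (((k : ℝ) + 1 : ℝ) : ℂ) * Complex.I)
    (fun k => (starRingEnd ℂ) ((((k : ℝ) + 1 : ℝ) : ℂ) * Complex.I))
  have him1 : ∀ k : Fin n, ((((k : ℝ) + 1 : ℝ) : ℂ) * Complex.I).im = k + 1 := by
    intro k
    rw [Complex.im_ofReal_mul, Complex.I_im, mul_one]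
  have hf : Function.Injective f := by
    rintro (a | a) (b | b) h
    · have := congrArg Complex.im h
      simp only [f, Sum.elim_inl, him1] at this
      exact congrArg _ (Fin.ext (by exact_mod_cast add_right_cancel this))
    · have := congrArg Complex.im h
      simp only [f, Sum.elim_inl, Sum.elim_inr, Complex.conj_im, him1] at this
      have h1 : (0 : ℝ) ≤ a := Nat.cast_nonneg _
      have h2 : (0 : ℝ) ≤ b := Nat.cast_nonneg _
      linarith
    · have := congrArg Complex.im h
      simp only [f, Sum.elim_inl, Sum.elim_inr, Complex.conj_im, him1] at this
      have h1 : (0 : ℝ) ≤ a := Nat.cast_nonneg _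
      have h2 : (0 : ℝ) ≤ b := Nat.cast_nonneg _
      linarith
    · have := congrArg Complex.im h
      simp only [f, Sum.elim_inr, Complex.conj_im, him1] at this
      exact congrArg _ (Fin.ext (by exact_mod_cast add_right_cancel (neg_injective this)))
  have h5 := eq_zero_of_natDegree_lt_card_of_eval_eq_zero (Q.map (algebraMap ℝ ℂ)) hf
    (by
      rintro (a | a)
      · rw [eval_map_algebraMap]
        exact h1 a
      · rw [eval_map_algebraMap]
        change aeval ((starRingEnd ℂ) _) Q = 0
        rw [aeval_conj, h1 a, map_zero])
    (by
      rw [natDegree_map, Fintype.card_sum, Fintype.card_fin]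
      omega)
  exact hne ((Polynomial.map_eq_zero _).1 h5)

/-- A matrix commuting with this one is diagonal with entries in the centralizer of u, which leaves
at most 2 real parameters for each of the n entries. -/
theorem isRegularCen_diagonal {u : D} (hu : u * u = -1) (h2 : cdim u ≤ 2) (n : ℕ) :
    IsRegularCen (Matrix.diagonal fun k : Fin n => ((k : ℝ) + 1) • u) (2 * n) := by
  have haev : aeval (Matrix.diagonal fun k : Fin n => ((k : ℝ) + 1) • u) (imagPoly n) = 0 := by
    change aeval (Matrix.diagonalAlgHom ℝ fun k : Fin n => ((k : ℝ) + 1) • u) (imagPoly n) = 0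
    rw [aeval_algHom_apply]
    refine (congrArg _ ?_).trans (map_zero _)
    funext k
    change Pi.evalAlgHom ℝ (fun _ : Fin n => D) k
        (aeval (fun k : Fin n => ((k : ℝ) + 1) • u) (imagPoly n)) = 0
    rw [← aeval_algHom_apply]
    obtain ⟨Q, hQ⟩ := Finset.dvd_prod_of_mem
      (fun k : Fin n => (X ^ 2 + C (((k : ℝ) + 1) ^ 2) : ℝ[X])) (Finset.mem_univ k)
    rw [imagPoly, hQ, map_mul]
    have h3 : aeval (Pi.evalAlgHom ℝ (fun _ : Fin n => D) k fun k : Fin n => ((k : ℝ) + 1) • u)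
        (X ^ 2 + C (((k : ℝ) + 1) ^ 2) : ℝ[X]) = 0 := by
      rw [map_add, map_pow, aeval_X, aeval_C, Pi.evalAlgHom_apply, pow_two, smul_mul_smul_comm, hu,
        Algebra.algebraMap_eq_smul_one, pow_two, smul_neg, neg_add_cancel]
    rw [h3, zero_mul]
  refine ⟨⟨_, (imagPoly_separable n).squarefree, haev⟩,
    ⟨_, (imagPoly_monic n).ne_zero, fun z => imagPoly_root, haev⟩,
    minpoly_diagonal_natDegree hu n, ?_⟩
  have hu0 : u ≠ 0 := by
    rintro rfl
    simp at hu
  set A := Matrix.diagonal fun k : Fin n => ((k : ℝ) + 1) • u with hA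
  have key : ∀ Z ∈ LinearMap.ker (adj A), ∀ j k : Fin n, ((j : ℝ) + 1) • (u * Z j k) =
      ((k : ℝ) + 1) • (Z j k * u) := by
    intro Z hZ j k
    have h3 : (A * Z) j k = (Z * A) j k := by rw [mem_ker_adj.1 hZ]
    rw [hA, Matrix.diagonal_mul, Matrix.mul_diagonal] at h3
    rwa [smul_mul_assoc, mul_smul_comm] at h3
  -- Multiplicativity of the norm of `D` removes the noncommutativity: `(j + 1) ‖u‖ ‖z‖ = (k + 1)
  -- ‖z‖ ‖u‖`.
  have hoff : ∀ Z ∈ LinearMap.ker (adj A), ∀ j k : Fin n, j ≠ k → Z j k = 0 := by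
    intro Z hZ j k hjk
    have h3 := congrArg norm (key Z hZ j k)
    rw [norm_smul, norm_smul, norm_mul, norm_mul, Real.norm_of_nonneg (by positivity),
      Real.norm_of_nonneg (by positivity)] at h3
    by_contra hne
    have h4 : 0 < ‖u‖ * ‖Z j k‖ := mul_pos (norm_pos_iff.2 hu0) (norm_pos_iff.2 hne)
    have h5 : ((j : ℝ) + 1) * (‖u‖ * ‖Z j k‖) = ((k : ℝ) + 1) * (‖u‖ * ‖Z j k‖) := by
      rw [h3, mul_comm ‖u‖]
    have h6 := mul_right_cancel₀ h4.ne' h5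
    exact hjk (Fin.ext (by exact_mod_cast add_right_cancel h6))
  let ev : LinearMap.ker (adj A) →ₗ[ℝ] (Fin n → LinearMap.ker (adj u)) :=
    { toFun := fun Z j => ⟨Z.1 j j, mem_ker_adj.2
        (smul_right_injective D (by positivity : ((j : ℝ) + 1) ≠ 0) (key Z.1 Z.2 j j))⟩
      map_add' := fun _ _ => rfl
      map_smul' := fun _ _ => rfl }
  have hev : Function.Injective ev := by
    rw [injective_iff_map_eq_zero]
    intro Z hZ
    refine Subtype.ext ?_
    ext j k
    by_cases hjk : j = k
    · subst hjk
      exact congrArg Subtype.val (congrFun hZ j)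
    · exact hoff Z.1 Z.2 j k hjk
  have h7 := LinearMap.finrank_le_finrank_of_injective hev
  rw [Module.finrank_pi_fintype, Finset.sum_const, Finset.card_univ, Fintype.card_fin,
    smul_eq_mul] at h7
  calc cdim A ≤ n * cdim u := h7
    _ ≤ 2 * n := by rw [mul_comm 2]; exact Nat.mul_le_mul_left _ h2

theorem exists_isRegularCen_complex (n : ℕ) :
    ∃ A : Matrix (Fin n) (Fin n) ℂ, IsRegularCen A (2 * n) :=
  ⟨_, isRegularCen_diagonal Complex.I_mul_I (by
    rw [cdim]
    exact (Submodule.finrank_le _).trans Complex.finrank_real_complex.le) n⟩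

theorem exists_isRegularCen_quaternion (n : ℕ) :
    ∃ A : Matrix (Fin n) (Fin n) ℍ[ℝ], IsRegularCen A (2 * n) := by
  obtain ⟨u, e1, e2, e3, e4⟩ :
      ∃ u : ℍ[ℝ], u.re = 0 ∧ u.imI = 1 ∧ u.imJ = 0 ∧ u.imK = 0 := ⟨⟨0, 1, 0, 0⟩, by simp⟩
  refine ⟨_, isRegularCen_diagonal (u := u) ?_ ?_ n⟩
  · ext <;> simp [e1, e2, e3, e4]
  · have key : ∀ q ∈ LinearMap.ker (adj u), q.imJ = 0 ∧ q.imK = 0 := by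
      intro q hq
      rw [mem_ker_adj] at hq
      have h1 := congrArg QuaternionAlgebra.imJ hq
      have h2 := congrArg QuaternionAlgebra.imK hq
      simp [e1, e2, e3, e4] at h1 h2
      constructor <;> linarith
    let ev : LinearMap.ker (adj u) →ₗ[ℝ] ℝ × ℝ :=
      { toFun := fun q => (q.1.re, q.1.imI)
        map_add' := fun _ _ => rfl
        map_smul' := fun _ _ => rfl }
    have hev : Function.Injective ev := by
      rw [injective_iff_map_eq_zero]
      intro q hq
      have h1 := congrArg Prod.fst hq
      have h2 := congrArg Prod.snd hq
      obtain ⟨h3, h4⟩ := key q.1 q.2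
      refine Subtype.ext ?_
      ext
      · exact h1
      · exact h2
      · exact h3
      · exact h4
    have := LinearMap.finrank_le_finrank_of_injective hev
    simpa [cdim] using this

end RegularElements

/-! ### The codimension is well defined -/

section Codimension

variable {E : Type*} [NormedAddCommGroup E] [NormedSpace ℝ E] [FiniteDimensional ℝ E]

/-- The codimension is determined by a submersion defining the set near one of its points. -/
theorem codim_eq_of_hasStrictFDerivAt {M : Set E} {k l : ℕ} {x : E} (hx : x ∈ M)
    {f : E → Fin k → ℝ} {f' : E →L[ℝ] Fin k → ℝ} (hf : HasStrictFDerivAt f f' x)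
    (hfs : Function.Surjective f') (hfM : ∀ᶠ y in 𝓝 x, y ∈ M ↔ f y = 0)
    {g : E → Fin l → ℝ} {g' : E →L[ℝ] Fin l → ℝ} (hg : HasStrictFDerivAt g g' x)
    (hgs : Function.Surjective g') (hgM : ∀ᶠ y in 𝓝 x, y ∈ M ↔ g y = 0) : k = l := by
  have hfx : f x = 0 := hfM.self_of_nhds.1 hx
  have hgx : g x = 0 := hgM.self_of_nhds.1 hx
  -- Both kernels are the tangent space of `M` at `x`.
  have hker : LinearMap.ker f'.toLinearMap = LinearMap.ker g'.toLinearMap := by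
    ext v
    constructor
    · intro hv
      refine deriv_eq_zero_of_const_on_fibre hf hfs hg.hasFDerivAt ?_ hv
      filter_upwards [hfM, hgM] with y h1 h2 h3
      rw [hgx, ← h2, h1, h3, hfx]
    · intro hv
      refine deriv_eq_zero_of_const_on_fibre hg hgs hf.hasFDerivAt ?_ hv
      filter_upwards [hfM, hgM] with y h1 h2 h3
      rw [hfx, ← h1, h2, h3, hgx]
  have h1 := LinearMap.finrank_range_add_finrank_ker f'.toLinearMap
  have h2 := LinearMap.finrank_range_add_finrank_ker g'.toLinearMap
  rw [LinearMap.range_eq_top.2 hfs, finrank_top] at h1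
  rw [LinearMap.range_eq_top.2 hgs, finrank_top, ← hker] at h2
  simp at h1 h2
  omega

theorem IsEmbeddedSubmanifold.codim_eq {M : Set E} {k l : ℕ} {x : E} (h : IsEmbeddedSubmanifold M k)
    (hx : x ∈ M) (hl : SubmfdAt M l x) : k = l := by
  obtain ⟨g, g', -, hg, hgs, hgM⟩ := hl.exists_hasStrictFDerivAt
  obtain ⟨O, hO, hxO, f, hf, hs, hM⟩ := h x hx
  have hfx : HasStrictFDerivAt f (fderiv ℝ f x) x :=
    (hf.contDiffAt (hO.mem_nhds hxO)).hasStrictFDerivAt (by simp)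
  refine codim_eq_of_hasStrictFDerivAt hx hfx (hs x hxO) ?_ hg hgs hgM
  filter_upwards [hO.mem_nhds hxO] with y hy
  have := Set.ext_iff.1 hM y
  constructor
  · exact fun h1 => (this.1 ⟨h1, hy⟩).2
  · exact fun h1 => (this.2 ⟨hy, h1⟩).1

end Codimension

/-! ### Stratifications by conjugacy invariants -/

section Strata

variable {C B : Type*} [NormedRing C] [NormedAlgebra ℝ C] [NormedRing B] [NormedAlgebra ℝ B]

/-- The conjugacy invariant set `X` is stratified by the values of a conjugacy invariant function
taking finitely many values; the strata have codimension at least `K`, with equality exactly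
once. -/
def HasStrat (C : Type*) [NormedRing C] [NormedAlgebra ℝ C] (X : Set C) (K : ℕ) : Prop :=
  ∃ (T : Type) (t : C → T) (κ : T → ℕ) (t₀ : T), (t '' X).Finite ∧
    (∀ A ∈ X, ∀ g : Cˣ, g.val * A * g⁻¹.val ∈ X ∧ t (g.val * A * g⁻¹.val) = t A) ∧
    (∀ A ∈ X, SubmfdAt {A' | A' ∈ X ∧ t A' = t A} (κ (t A)) A) ∧
    (∀ A ∈ X, K ≤ κ (t A)) ∧ (∃ A ∈ X, t A = t₀ ∧ κ t₀ = K) ∧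
    ∀ A ∈ X, κ (t A) = K → t A = t₀

theorem hasStrat_nilpotent [FiniteDimensional ℝ C] [IsSemisimpleRing C] {K : ℕ}
    (h1 : ∀ A : C, IsNilpotent A → K ≤ cdim A) (h2 : ∃ A : C, IsNilpotent A ∧ cdim A = K) :
    HasStrat C {A | IsNilpotent A} K := by
  refine ⟨ℕ, cdim, id, K, ?_, ?_, ?_, h1, ?_, fun A _ h => h⟩
  · refine (Set.finite_Iic (finrank ℝ C)).subset ?_
    rintro _ ⟨A, -, rfl⟩
    exact Submodule.finrank_le _
  · exact fun A hA g => ⟨isNilpotent_conj hA g, cdim_conj A g⟩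
  · exact fun A hA => nilStratum_submfdAt A hA
  · obtain ⟨A, hA, h⟩ := h2
    exact ⟨A, hA, h, rfl⟩

/-- The regular element has `cdim = R`, minimal because its centralizer is commutative, and `imDim =
R / 2`, maximal by `h1`. Hence `cdim - imDim` is least only when both invariants take these values,
which singles out one stratum. -/
theorem hasStrat_cen [FiniteDimensional ℝ C] [IsSemisimpleRing C] {R : ℕ}
    (h1 : ∀ A : C, imDim A ≤ R / 2) {A₀ : C} (h2 : IsRegularCen A₀ R) :
    HasStrat C {A | IsCen A} (R - R / 2) := by
  obtain ⟨hq, hc, hR, hcd⟩ := h2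
  obtain ⟨hcomm, heq⟩ := cent_commutative_of_minpoly (hcd.trans hR)
  have hmin := cdim_le_of_commutative hq hcomm
  have him := half_natDegree_minpoly_le_imDim hq hc
  have h1' := h1 A₀
  have hA₀ : cdim A₀ = R := by omega
  have hA₀' : imDim A₀ = R / 2 := by omega
  refine ⟨ℕ × ℕ, fun A => (imDim A, cdim A), fun p => p.2 - p.1, (R / 2, R), ?_, ?_, ?_, ?_, ?_, ?_⟩
  · refine ((Set.finite_Iic (R / 2)).prod (Set.finite_Iic (finrank ℝ C))).subset ?_
    rintro _ ⟨A, -, rfl⟩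
    exact ⟨h1 A, Submodule.finrank_le _⟩
  · intro A hA g
    have := cenStratum_conj A A ⟨hA, rfl, rfl⟩ g
    exact ⟨this.1, Prod.ext this.2.1 this.2.2⟩
  · intro A hA
    refine (cenStratum_submfdAt A hA).congr (Eventually.of_forall fun A' => ?_)
    change IsCen A' ∧ (imDim A', cdim A') = _ ↔ IsCen A' ∧ _ ∧ _
    rw [Prod.mk_inj]
  · intro A _
    have := hmin A
    have := h1 A
    simp only
    omega
  · exact ⟨A₀, hc, by simp only [hA₀, hA₀'], rfl⟩
  · intro A _ h
    have h3 := hmin A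
    have h4 := h1 A
    simp only at h
    exact Prod.ext (by simp only; omega) (by simp only; omega)

/-- The codimension of a product stratum is the sum of two codimensions bounded below by K and L, so
K + L is reached only when both are minimal. -/
theorem HasStrat.prod [FiniteDimensional ℝ C] [FiniteDimensional ℝ B] {X : Set C} {Y : Set B}
    {K L : ℕ} (hX : HasStrat C X K) (hY : HasStrat B Y L) : HasStrat (C × B) (X ×ˢ Y) (K + L) := by
  obtain ⟨T, t, κ, t₀, f1, c1, s1, k1, ⟨A₀, m1, e1, e1'⟩, u1⟩ := hX
  obtain ⟨T', t', κ', t₀', f2, c2, s2, k2, ⟨B₀, m2, e2, e2'⟩, u2⟩ := hY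
  refine ⟨T × T', fun p => (t p.1, t' p.2), fun q => κ q.1 + κ' q.2, (t₀, t₀'), ?_, ?_, ?_, ?_,
    ⟨(A₀, B₀), ⟨m1, m2⟩, by simp only [e1, e2], by simp only [e1', e2']⟩, ?_⟩
  · refine (f1.prod f2).subset ?_
    rintro _ ⟨p, hp, rfl⟩
    exact ⟨⟨p.1, hp.1, rfl⟩, ⟨p.2, hp.2, rfl⟩⟩
  · rintro p ⟨h1, h2⟩ g
    have h3 := c1 p.1 h1 (Units.map (RingHom.fst C B).toMonoidHom g)
    have h4 := c2 p.2 h2 (Units.map (RingHom.snd C B).toMonoidHom g)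
    exact ⟨⟨h3.1, h4.1⟩, Prod.ext h3.2 h4.2⟩
  · rintro ⟨A, A'⟩ ⟨h1, h2⟩
    refine ((s1 A h1).prod (s2 A' h2)).congr (Eventually.of_forall fun p => ?_)
    change (_ ∧ _) ∧ (_, _) = (_, _) ↔ (_ ∧ _) ∧ (_ ∧ _)
    rw [Prod.mk_inj]
    tauto
  · exact fun p hp => Nat.add_le_add (k1 _ hp.1) (k2 _ hp.2)
  · intro p hp h
    have h1 := k1 _ hp.1
    have h2 := k2 _ hp.2
    simp only at h
    exact Prod.ext (u1 _ hp.1 (by omega)) (u2 _ hp.2 (by omega))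

theorem HasStrat.pi {ι : Type} [Fintype ι] {B : ι → Type*} [∀ i, NormedRing (B i)]
    [∀ i, NormedAlgebra ℝ (B i)] [∀ i, FiniteDimensional ℝ (B i)] {X : ∀ i, Set (B i)} {K : ι → ℕ}
    (h : ∀ i, HasStrat (B i) (X i) (K i)) : HasStrat (∀ i, B i) (Set.univ.pi X) (∑ i, K i) := by
  unfold HasStrat at h
  choose T t κ t₀ f c s k hA u using h
  choose A₀ m e e' using hA
  refine ⟨∀ i, T i, fun A i => t i (A i), fun q => ∑ i, κ i (q i), t₀, ?_, ?_, ?_, ?_,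
    ⟨A₀, fun i _ => m i, funext e, by simp only [e']⟩, ?_⟩
  · refine (Set.Finite.pi f).subset ?_
    rintro _ ⟨A, hA, rfl⟩ i -
    exact ⟨A i, hA i trivial, rfl⟩
  · intro A hA g
    have h1 := fun i => c i (A i) (hA i trivial) (Units.map (Pi.evalMonoidHom B i) g)
    exact ⟨fun i _ => (h1 i).1, funext fun i => (h1 i).2⟩
  · intro A hA
    refine (SubmfdAt.pi fun i => s i (A i) (hA i trivial)).congr
      (Eventually.of_forall fun A' => ?_)
    constructor
    · rintro ⟨h1, h2⟩ i -
      exact ⟨h1 i trivial, congrFun h2 i⟩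
    · intro h1
      exact ⟨fun i _ => (h1 i trivial).1, funext fun i => (h1 i trivial).2⟩
  · exact fun A hA => Finset.sum_le_sum fun i _ => k i _ (hA i trivial)
  · intro A hA h1
    have h2 := (Finset.sum_eq_sum_iff_of_le fun i _ => k i _ (hA i trivial)).1 h1.symm
    exact funext fun i => u i _ (hA i trivial) (h2 i (Finset.mem_univ i)).symm

/-- The strata are the nonempty level sets of `t ∘ π` in `X'`. As π is linear and onto, they have
the codimensions of their images; as it is multiplicative, conjugacy invariance lifts. -/
theorem HasStrat.isUnionOfInvariantSubmanifolds [FiniteDimensional ℝ C] {X : Set C} {K : ℕ}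
    (h : HasStrat C X K) {S : Type*} [Monoid S] {V : Type*} [AddCommGroup V] [Module ℝ V]
    [FiniteDimensional ℝ V] {ρ : Representation ℝ S V} (π : EquivEnd ρ →ₐ[ℝ] C)
    (hπ : Function.Surjective π) {X' : Set (EquivEnd ρ)} (hX : ∀ A, A ∈ X' ↔ π A ∈ X) :
    IsUnionOfInvariantSubmanifolds ρ X' K := by
  obtain ⟨T, t, κ, t₀, hf, hc, hs, hk, ⟨A₀, m, e, e'⟩, hu⟩ := h
  let str : T → Set (EquivEnd ρ) := fun τ => {A | A ∈ X' ∧ t (π A) = τ}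
  let b := (Module.finBasis ℝ (EquivEnd ρ)).equivFun
  have hsub : ∀ A ∈ X', ∀ x ∈ b '' str (t (π A)), SubmfdAt (b '' str (t (π A))) (κ (t (π A))) x := by
    rintro A hA _ ⟨A', ⟨hA', hA''⟩, rfl⟩
    have h1 := hs (π A') ((hX A').1 hA')
    rw [hA''] at h1
    have h2 : π.toLinearMap (b.symm (b A')) = π A' := by
      rw [LinearEquiv.symm_apply_apply]; rfl
    have h3 := SubmfdAt.comap_linear (x := b A') (π.toLinearMap ∘ₗ b.symm.toLinearMap)
      (hπ.comp b.symm.surjective) (by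
        rw [LinearMap.comp_apply, LinearEquiv.coe_coe, h2]
        exact h1)
    refine h3.congr (Eventually.of_forall fun y => ?_)
    constructor
    · rintro ⟨z, ⟨hz, hz'⟩, rfl⟩
      have h4 : π.toLinearMap (b.symm (b z)) = π z := by
        rw [LinearEquiv.symm_apply_apply]; rfl
      change π.toLinearMap (b.symm (b z)) ∈ X ∧ t (π.toLinearMap (b.symm (b z))) = _
      rw [h4]
      exact ⟨(hX z).1 hz, hz'⟩
    · rintro ⟨h4, h5⟩
      exact ⟨b.symm y, ⟨(hX _).2 h4, h5⟩, by simp⟩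
  have hemb : ∀ A ∈ X', IsEmbeddedSubmanifoldOf (EquivEnd ρ) (str (t (π A))) (κ (t (π A))) :=
    fun A hA => isEmbeddedSubmanifold_of_submfdAt (hsub A hA)
  refine ⟨(fun A => str (t (π A))) '' X', ?_, ?_, ?_, ?_, ?_, ?_, ?_⟩
  · refine (hf.image str).subset ?_
    rintro _ ⟨A, hA, rfl⟩
    exact ⟨_, ⟨π A, (hX A).1 hA, rfl⟩, rfl⟩
  · rintro _ ⟨A, hA, rfl⟩ _ ⟨A', hA', rfl⟩ hne
    change Disjoint (str (t (π A))) (str (t (π A')))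
    rw [Set.disjoint_left]
    intro Z h1 h2
    exact hne (by simp only; rw [← h1.2, ← h2.2])
  · ext Z
    constructor
    · rintro ⟨_, ⟨A, hA, rfl⟩, hZ⟩
      exact hZ.1
    · intro hZ
      exact ⟨_, ⟨Z, hZ, rfl⟩, hZ, rfl⟩
  · rintro _ ⟨A, hA, rfl⟩
    exact ⟨A, hA, rfl⟩
  · rintro _ ⟨A, hA, rfl⟩ Z ⟨hZ, hZ'⟩ g
    have h1 := hc (π Z) ((hX Z).1 hZ) (Units.map (π : EquivEnd ρ →* C) g)
    have h2 : π (g.val * Z * g⁻¹.val) = (Units.map (π : EquivEnd ρ →* C) g).val * π Z *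
        (Units.map (π : EquivEnd ρ →* C) g)⁻¹.val := by
      rw [map_mul, map_mul]; rfl
    refine ⟨(hX _).2 ?_, ?_⟩
    · rw [h2]; exact h1.1
    · rw [h2, h1.2, hZ']
  · rintro _ ⟨A, hA, rfl⟩
    exact ⟨_, hk _ ((hX A).1 hA), hemb A hA⟩
  · obtain ⟨Z, rfl⟩ := hπ A₀
    have hZ := (hX Z).2 m
    have hκ : κ (t (π Z)) = K := by rw [e, e']
    refine ⟨str (t (π Z)), ⟨⟨Z, hZ, rfl⟩, hκ ▸ hemb Z hZ⟩, ?_⟩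
    rintro _ ⟨⟨A, hA, rfl⟩, hA'⟩
    have h1 : b A ∈ b '' str (t (π A)) := ⟨A, ⟨hA, rfl⟩, rfl⟩
    -- Being a submanifold of codimension K is a mere existence statement; at a point of the stratum
    -- it forces K to be the assigned codimension.
    have h2 := IsEmbeddedSubmanifold.codim_eq hA' h1 (hsub A hA _ h1)
    simp only
    rw [hu _ ((hX A).1 hA) h2.symm, e]

end Strata

/-! ### Matrix algebras over ℝ, ℂ, ℍ and their products -/

section Blocks

/-- The algebra of `n × n` matrices over `D`, as endomorphisms of the right `D`-module `Dⁿ`. -/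
abbrev MatEnd (D : Type*) [Ring D] (n : ℕ) : Type _ := Module.End Dᵐᵒᵖ (Fin n → D)

variable (D : Type*) [DivisionRing D] [Algebra ℝ D] [FiniteDimensional ℝ D] (n : ℕ)

instance : FiniteDimensional ℝ (MatEnd D n) :=
  Module.Finite.equiv (matrixEquivEnd n D).toLinearEquiv

instance : IsSemisimpleRing (MatEnd D n) :=
  (matrixEquivEnd n D).toRingEquiv.isSemisimpleRing

theorem finrank_mulOpposite : finrank ℝ Dᵐᵒᵖ = finrank ℝ D :=
  (MulOpposite.opLinearEquiv ℝ).symm.finrank_eq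

theorem finrank_column_real : finrank ℝ (Fin n → D) = n * finrank ℝ D := by
  rw [Module.finrank_pi_fintype, Finset.sum_const, Finset.card_univ, Fintype.card_fin, smul_eq_mul]

theorem finrank_column : finrank Dᵐᵒᵖ (Fin n → D) = n := by
  have := finite_of_real Dᵐᵒᵖ (Fin n → D)
  have h := Module.finrank_mul_finrank ℝ Dᵐᵒᵖ (Fin n → D)
  rw [finrank_column_real, finrank_mulOpposite, mul_comm n] at h
  exact Nat.eq_of_mul_eq_mul_left Module.finrank_pos h

theorem hasStrat_nilpotent_matEnd :
    HasStrat (MatEnd D n) {A | IsNilpotent A} (finrank ℝ D * n) := by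
  rw [← finrank_mulOpposite]
  exact hasStrat_nilpotent (fun A hA => le_cdim_of_isNilpotent n (finrank_column D n) A hA)
    (exists_isNilpotent_cdim n (finrank_column D n))

variable {D n}

theorem imDim_matEnd_mul_le (A : MatEnd D n) (c : ℕ) (hc : c = 2 ∨ c = finrank ℝ D) :
    imDim A * c ≤ n * finrank ℝ D := by
  rw [← finrank_column_real]
  exact imDim_mul_le A c (by rwa [finrank_mulOpposite])

theorem hasStrat_cen_real (n : ℕ) : HasStrat (MatEnd ℝ n) {A | IsCen A} ((n + 1) / 2) := by
  obtain ⟨A, hA⟩ := exists_isRegularCen_real n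
  have h := hasStrat_cen (R := n) (fun B => by
    have := imDim_matEnd_mul_le B 2 (Or.inl rfl)
    rw [Module.finrank_self] at this
    omega) (hA.map (matrixEquivEnd n ℝ))
  rwa [show n - n / 2 = (n + 1) / 2 by omega] at h

theorem hasStrat_cen_complex (n : ℕ) : HasStrat (MatEnd ℂ n) {A | IsCen A} n := by
  obtain ⟨A, hA⟩ := exists_isRegularCen_complex n
  have h := hasStrat_cen (R := 2 * n) (fun B => by
    have := imDim_matEnd_mul_le B 2 (Or.inl rfl)
    rw [Complex.finrank_real_complex] at this
    omega) (hA.map (matrixEquivEnd n ℂ))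
  rwa [show 2 * n - 2 * n / 2 = n by omega] at h

theorem hasStrat_cen_quaternion (n : ℕ) : HasStrat (MatEnd ℍ[ℝ] n) {A | IsCen A} n := by
  obtain ⟨A, hA⟩ := exists_isRegularCen_quaternion n
  have h4 : finrank ℝ ℍ[ℝ] = 4 := Quaternion.finrank_eq_four
  -- The factor 4 = dim ℍ is essential here: with 2 the bound on `imDim` would be 2n instead of n.
  have h := hasStrat_cen (R := 2 * n) (fun B => by
    have := imDim_matEnd_mul_le B 4 (Or.inr h4.symm)
    rw [h4] at this
    omega) (hA.map (matrixEquivEnd n ℍ[ℝ]))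
  rwa [show 2 * n - 2 * n / 2 = n by omega] at h

/-- The product of matrix algebras attached to the multiplicities. -/
abbrev BlockAlg {u v w : ℕ} (r : Fin u → ℕ) (c : Fin v → ℕ) (h : Fin w → ℕ) : Type :=
  (∀ i, MatEnd ℝ (r i)) × (∀ i, MatEnd ℂ (c i)) × (∀ i, MatEnd ℍ[ℝ] (h i))

theorem hasStrat_nilpotent_blockAlg {u v w : ℕ} (r : Fin u → ℕ) (c : Fin v → ℕ) (h : Fin w → ℕ) :
    HasStrat (BlockAlg r c h) {A | IsNilpotent A} (∑ i, r i + ∑ i, 2 * c i + ∑ i, 4 * h i) := by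
  have h1 := HasStrat.pi fun i => hasStrat_nilpotent_matEnd ℝ (r i)
  have h2 := HasStrat.pi fun i => hasStrat_nilpotent_matEnd ℂ (c i)
  have h3 := HasStrat.pi fun i => hasStrat_nilpotent_matEnd ℍ[ℝ] (h i)
  simp only [Module.finrank_self, one_mul] at h1
  simp only [Complex.finrank_real_complex] at h2
  simp only [Quaternion.finrank_eq_four] at h3
  have h4 := h1.prod (h2.prod h3)
  rw [← add_assoc] at h4
  convert h4 using 1
  ext A
  simp only [Set.mem_ofPred_eq, Set.mem_prod, Set.mem_univ_pi, isNilpotent_prod_iff,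
    isNilpotent_pi_iff]

theorem hasStrat_cen_blockAlg {u v w : ℕ} (r : Fin u → ℕ) (c : Fin v → ℕ) (h : Fin w → ℕ) :
    HasStrat (BlockAlg r c h) {A | IsCen A}
      (∑ i, ⌈(r i : ℚ) / 2⌉₊ + ∑ i, c i + ∑ i, h i) := by
  have h1 := HasStrat.pi fun i => hasStrat_cen_real (r i)
  have h2 := HasStrat.pi fun i => hasStrat_cen_complex (c i)
  have h3 := HasStrat.pi fun i => hasStrat_cen_quaternion (h i)
  have h4 := h1.prod (h2.prod h3)
  rw [← add_assoc] at h4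
  have hceil : ∀ n : ℕ, ⌈(n : ℚ) / 2⌉₊ = (n + 1) / 2 := by
    intro n
    rcases Nat.even_or_odd' n with ⟨m, rfl | rfl⟩
    · have : ((2 * m : ℕ) : ℚ) / 2 = m := by push_cast; ring
      rw [this, Nat.ceil_natCast]
      omega
    · rw [Nat.ceil_eq_iff (by omega)]
      have : (2 * m + 1 + 1) / 2 = m + 1 := by omega
      rw [this]
      push_cast
      constructor
      · linarith
      · linarith
  simp only [hceil]
  convert h4 using 1
  ext A
  simp only [Set.mem_ofPred_eq, Set.mem_prod, Set.mem_univ_pi, isCen_prod_iff, isCen_pi_iff]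

end Blocks

/-! ### The endomorphism algebra and nil kernels -/

section EndAlgebra

variable {S : Type*} [Monoid S] {V : Type*} [AddCommGroup V] [Module ℝ V]
  {ρ : Representation ℝ S V}

instance : Ring (EquivEnd ρ) :=
  { (inferInstance : Semiring (EquivEnd ρ)), (inferInstance : AddCommGroup (EquivEnd ρ)) with }

/-- Forgetting the equivariance. -/
def toEnd (ρ : Representation ℝ S V) : EquivEnd ρ →ₐ[ℝ] Module.End ℝ V :=
  AlgHom.ofLinearMap (Representation.IntertwiningMap.toLinearMapl ρ ρ) rfl fun _ _ => rfl

theorem toEnd_injective : Function.Injective (toEnd ρ) :=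
  Representation.IntertwiningMap.toLinearMap_injective ρ ρ

-- An annihilating polynomial vanishes at every eigenvalue of the complexification; conversely the
-- characteristic polynomial annihilates A and has only these roots.
open Polynomial in
theorem isCen_iff_eigenvalues [FiniteDimensional ℝ V] (A : EquivEnd ρ) :
    IsCen A ↔ ∀ μ : ℂ, (complexify A).HasEigenvalue μ → μ.re = 0 := by
  constructor
  · rintro ⟨P, h0, h1, h2⟩ μ hμ
    obtain ⟨x, hx⟩ := hμ.exists_hasEigenvector
    apply h1
    have h3 := Module.End.aeval_apply_of_hasEigenvector (p := P.map (algebraMap ℝ ℂ)) hx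
    have h4 : aeval (complexify A) P = 0 := by
      have : complexify A = Module.End.baseChangeHom ℝ ℂ V (toEnd ρ A) := rfl
      rw [this, aeval_algHom_apply, aeval_algHom_apply, h2, map_zero, map_zero]
    rw [aeval_map_algebraMap, h4, LinearMap.zero_apply, eq_comm, smul_eq_zero] at h3
    rw [← eval_map_algebraMap]
    exact h3.resolve_right hx.2
  · intro h
    refine IsCen.of_map (toEnd ρ) toEnd_injective
      ⟨LinearMap.charpoly (toEnd ρ A), (LinearMap.charpoly_monic _).ne_zero, fun z hz => ?_,
        LinearMap.aeval_self_charpoly _⟩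
    apply h
    rw [Module.End.hasEigenvalue_iff_isRoot_charpoly]
    change (LinearMap.charpoly ((toEnd ρ A).baseChange ℂ)).IsRoot z
    rw [LinearMap.charpoly_baseChange, IsRoot.def, eval_map_algebraMap, hz]

theorem mem_cenSet_self_iff_isCen [FiniteDimensional ℝ V] (A : EquivEnd ρ) :
    A ∈ cenSet ρ ρ ↔ IsCen A :=
  (mem_cenSet_self ρ A).trans (isCen_iff_eigenvalues A).symm

open Polynomial in
/-- A two-sided ideal consisting of elements of trace zero is nil. -/
theorem isNilpotent_of_trace_eq_zero [FiniteDimensional ℝ V] {C : Type*} [Ring C] [Algebra ℝ C]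
    (π : EquivEnd ρ →ₐ[ℝ] C) (hπ : ∀ A, π A = 0 → LinearMap.trace ℝ V A.toLinearMap = 0)
    {A : EquivEnd ρ} (hA : π A = 0) : IsNilpotent A := by
  obtain ⟨Q, hQ, hX⟩ := exists_eq_pow_rootMultiplicity_mul_and_not_dvd (minpoly ℝ A)
    (minpoly.ne_zero (Algebra.IsIntegral.isIntegral A)) 0
  set k := rootMultiplicity 0 (minpoly ℝ A)
  rw [C_0, sub_zero] at hQ hX
  have hm : aeval A (X ^ k * Q) = 0 := by rw [← hQ, minpoly.aeval]
  obtain ⟨a, b, hab⟩ : IsCoprime (X ^ (k + 1)) Q :=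
    ((irreducible_X.coprime_iff_not_dvd).2 hX).pow_left
  -- The idempotent of `A` away from the eigenvalue 0. The exponent `k + 1` makes it a multiple of
  -- `A` even if k = 0, so it lies in the kernel of π. Its rank is its trace, zero, so it vanishes
  -- and `A ^ k = 0`.
  set e := aeval A (a * X ^ (k + 1)) with he
  have hf : aeval A (b * Q) = 1 - e := by
    rw [eq_sub_iff_add_eq', he, ← map_add, hab, map_one]
  have hid : e * e = e := by
    have h1 : e * aeval A (b * Q) = 0 := by
      rw [he, ← map_mul, show a * X ^ (k + 1) * (b * Q) = (a * X * b) * (X ^ k * Q) by ring,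
        map_mul, hm, mul_zero]
    rw [hf, mul_sub, mul_one, sub_eq_zero] at h1
    exact h1.symm
  have he0 : π e = 0 := by
    rw [he, map_mul, map_pow, aeval_X, map_mul, map_pow, hA, zero_pow (by omega), mul_zero]
  have he1 : e = 0 := toEnd_injective (by
    rw [map_zero]
    refine LinearMap.IsIdempotentElem.eq_zero_of_trace_eq_zero ?_ (hπ e he0)
    rw [IsIdempotentElem]
    exact congrArg (toEnd ρ) hid)
  refine ⟨k, ?_⟩
  have h2 : aeval A (b * (X ^ k * Q)) = A ^ k := by
    rw [show b * (X ^ k * Q) = X ^ k * (b * Q) by ring, map_mul, hf, he1, sub_zero, mul_one,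
      map_pow, aeval_X]
  rw [← h2, map_mul, hm, mul_zero]

theorem isNilpotent_iff_of_ker {E C : Type*} [Ring E] [Algebra ℝ E] [Ring C] [Algebra ℝ C]
    (π : E →ₐ[ℝ] C) (hπ : ∀ A, π A = 0 → IsNilpotent A) (A : E) :
    IsNilpotent A ↔ IsNilpotent (π A) := by
  refine ⟨fun h => h.map π, ?_⟩
  rintro ⟨n, hn⟩
  rw [← map_pow] at hn
  obtain ⟨m, hm⟩ := hπ _ hn
  exact ⟨n * m, by rw [pow_mul, hm]⟩

theorem isCen_iff_of_ker {E C : Type*} [Ring E] [Algebra ℝ E] [Ring C] [Algebra ℝ C]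
    (π : E →ₐ[ℝ] C) (hπ : ∀ A, π A = 0 → IsNilpotent A) (A : E) :
    IsCen A ↔ IsCen (π A) := by
  refine ⟨fun h => h.map π, ?_⟩
  rintro ⟨P, h0, h1, h2⟩
  refine isCen_of_isNilpotent_aeval h0 h1 (hπ _ ?_)
  rw [← Polynomial.aeval_algHom_apply, h2]

end EndAlgebra

open Representation (IntertwiningMap)

/-! ### Maps between indecomposable representations -/

section Schur

variable {S : Type*} [Monoid S] {V : Type*} [AddCommGroup V] [Module ℝ V]
  {V' : Type*} [AddCommGroup V'] [Module ℝ V']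
  {σ : Representation ℝ S V} {τ : Representation ℝ S V'}

/-- `f g = 1` splits τ into the range of g and the kernel of f. The range is nonzero since V is, so
indecomposability leaves no kernel. -/
theorem bijective_of_leftInverse (hσ : Nontrivial V) (hτ : IsIndecomposable τ)
    {f : IntertwiningMap τ σ} {g : IntertwiningMap σ τ} (h : ∀ x, f (g x) = x) :
    Function.Bijective f := by
  have hc : IsCompl g.range f.ker := by
    constructor
    · rw [disjoint_iff]
      apply Subrepresentation.toSubmodule_injective
      rw [Subrepresentation.toSubmodule_inf]
      refine eq_bot_iff.2 ?_
      rintro _ ⟨⟨x, rfl⟩, hx⟩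
      have hx' : f (g x) = 0 := hx
      rw [h] at hx'
      rw [hx']
      exact map_zero g.toLinearMap
    · rw [codisjoint_iff]
      apply Subrepresentation.toSubmodule_injective
      rw [Subrepresentation.toSubmodule_sup]
      refine eq_top_iff.2 fun y _ => ?_
      refine Submodule.mem_sup.2 ⟨g (f y), ⟨f y, rfl⟩, y - g (f y), ?_, add_sub_cancel _ _⟩
      change f.toLinearMap (y - g (f y)) = 0
      rw [map_sub]
      exact sub_eq_zero.2 (h (f y)).symm
  refine ⟨?_, fun x => ⟨g x, h x⟩⟩
  rcases hτ.2 _ _ hc with h0 | h0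
  · obtain ⟨x, hx⟩ := exists_ne (0 : V)
    exfalso
    apply hx
    have h1 : g x ∈ (⊥ : Subrepresentation τ).toSubmodule := h0 ▸ ⟨x, rfl⟩
    have h2 : g x = 0 := h1
    rw [← h x, h2]
    exact map_zero f.toLinearMap
  · exact LinearMap.ker_eq_bot.1 (congrArg Subrepresentation.toSubmodule h0)

/-- An endomorphism factoring through an indecomposable representation not isomorphic to the given
one is nilpotent. -/
theorem map_comp_eq_zero {D : Type*} [DivisionRing D] [Algebra ℝ D] (hσ : Nontrivial V)
    (hτ : IsIndecomposable τ) (hne : IsEmpty (τ.Equiv σ)) (θ : EquivEnd σ →ₐ[ℝ] D)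
    (hs : Function.Surjective θ) (hθ : ∀ A, θ A = 0 → IsNilpotent A)
    (f : IntertwiningMap τ σ) (g : IntertwiningMap σ τ) : θ (f.comp g) = 0 := by
  by_contra h0
  -- With `y` lifting the inverse, `1 - y f g` is nilpotent and `y f g` is a unit. Then `g` has a
  -- left inverse and τ is isomorphic to σ.
  obtain ⟨y, hy⟩ := hs (θ (f.comp g))⁻¹
  have h1 : θ (1 - y * f.comp g) = 0 := by
    rw [map_sub, map_one, map_mul, hy, inv_mul_cancel₀ h0, sub_self]
  have h2 := (hθ _ h1).isUnit_one_sub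
  rw [sub_sub_cancel] at h2
  obtain ⟨z, hz⟩ := h2.exists_left_inv
  exact hne.elim (((z * y).comp f).ofBijective (bijective_of_leftInverse hσ hτ (g := g)
    fun x => congrArg (fun A : EquivEnd σ => A x) (mul_assoc z y (f.comp g) ▸ hz)))

/-- Conjugation by an isomorphism of representations. -/
def conjEnd (e : σ.Equiv τ) : EquivEnd σ ≃ₐ[ℝ] EquivEnd τ :=
  AlgEquiv.ofAlgHom
    (AlgHom.ofLinearMap
      { toFun := fun A => e.toIntertwiningMap.comp (A.comp e.symm.toIntertwiningMap)
        map_add' := fun A B => by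
          rw [IntertwiningMap.comp_add, IntertwiningMap.add_comp]
        map_smul' := fun c A => by
          rw [IntertwiningMap.smul_comp, IntertwiningMap.comp_smul]; rfl }
      (by ext x; simp) (fun A B => by ext x; simp))
    (AlgHom.ofLinearMap
      { toFun := fun A => e.symm.toIntertwiningMap.comp (A.comp e.toIntertwiningMap)
        map_add' := fun A B => by
          rw [IntertwiningMap.comp_add, IntertwiningMap.add_comp]
        map_smul' := fun c A => by
          rw [IntertwiningMap.smul_comp, IntertwiningMap.comp_smul]; rfl }
      (by ext x; simp) (fun A B => by ext x; simp))
    (by ext A x; simp) (by ext A x; simp)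

/-- The nilpotent elements are preserved by conjugation, so the dimension of the quotient is an
isomorphism invariant. It separates the three types, so non-isomorphism has to be assumed only
within each type. -/
theorem HasEndType.finrank_eq [FiniteDimensional ℝ V] {D D' : Type*} [Ring D] [Algebra ℝ D]
    [Ring D'] [Algebra ℝ D'] (h : HasEndType σ D) (h' : HasEndType τ D') (e : σ.Equiv τ) :
    finrank ℝ D = finrank ℝ D' := by
  obtain ⟨θ, hs, hθ⟩ := h
  obtain ⟨θ', hs', hθ'⟩ := h'
  have h1 := LinearMap.finrank_range_add_finrank_ker θ.toLinearMap
  have h2 := LinearMap.finrank_range_add_finrank_ker (θ'.comp (conjEnd e).toAlgHom).toLinearMap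
  have hk : LinearMap.ker θ.toLinearMap =
      LinearMap.ker (θ'.comp (conjEnd e).toAlgHom).toLinearMap := by
    ext A
    change θ A = 0 ↔ θ' (conjEnd e A) = 0
    rw [hθ, hθ']
    exact (IsNilpotent.map_iff (conjEnd e).injective).symm
  rw [LinearMap.range_eq_top.2 hs, finrank_top] at h1
  rw [LinearMap.range_eq_top.2 (hs'.comp (conjEnd e).surjective), finrank_top, ← hk] at h2
  omega

end Schur

/-! ### Isotypic summands and their matrix blocks -/

section Copies

variable {S : Type*} [Monoid S] {V : Type*} [AddCommGroup V] [Module ℝ V]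
  {V' : Type*} [AddCommGroup V'] [Module ℝ V']
  {W : Type*} [AddCommGroup W] [Module ℝ W] {W' : Type*} [AddCommGroup W'] [Module ℝ W']

/-- A direct summand of `ρ` isomorphic to `σ ^ n`, given by inclusions and projections. -/
structure Copies (ρ : Representation ℝ S W) (σ : Representation ℝ S V) (n : ℕ) where
  inj : Fin n → IntertwiningMap σ ρ
  pr : Fin n → IntertwiningMap ρ σ
  pr_inj : ∀ a b, (pr a).comp (inj b) = if a = b then (1 : EquivEnd σ) else 0

variable {ρ : Representation ℝ S W} {ρ' : Representation ℝ S W'} {σ : Representation ℝ S V}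
  {τ : Representation ℝ S V'} {n m : ℕ}

/-- The projection to the summand. -/
def Copies.proj (P : Copies ρ σ n) : EquivEnd ρ := ∑ a, (P.inj a).comp (P.pr a)

/-- The summand of a representation of which `ρ'` is a summand. -/
def Copies.map (P : Copies ρ' σ n) (i : IntertwiningMap ρ' ρ) (p : IntertwiningMap ρ ρ')
    (h : p.comp i = (1 : EquivEnd ρ')) : Copies ρ σ n where
  inj a := i.comp (P.inj a)
  pr a := (P.pr a).comp p
  pr_inj a b := by
    rw [← P.pr_inj]
    ext x
    exact congrArg (P.pr a) (congrArg (fun A : EquivEnd ρ' => A (P.inj b x)) h)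

theorem comp_sum {ι : Type*} (s : Finset ι) (f : IntertwiningMap ρ ρ')
    (g : ι → IntertwiningMap σ ρ) : f.comp (∑ a ∈ s, g a) = ∑ a ∈ s, f.comp (g a) :=
  map_sum (IntertwiningMap.llcomp σ ρ ρ' f) g s

theorem sum_comp {ι : Type*} (s : Finset ι) (f : ι → IntertwiningMap ρ ρ')
    (g : IntertwiningMap σ ρ) : (∑ a ∈ s, f a).comp g = ∑ a ∈ s, (f a).comp g := by
  ext x
  change (∑ a ∈ s, f a) (g x) = (∑ a ∈ s, (f a).comp g) x
  rw [IntertwiningMap.sum_apply, IntertwiningMap.sum_apply]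
  rfl

theorem Copies.proj_map (P : Copies ρ' σ n) (i : IntertwiningMap ρ' ρ) (p : IntertwiningMap ρ ρ')
    (h : p.comp i = (1 : EquivEnd ρ')) : (P.map i p h).proj = i.comp (P.proj.comp p) := by
  rw [Copies.proj, Copies.proj, sum_comp, comp_sum]
  rfl

/-- `q` acts by zero between copies of `σ`, modulo the kernel of `θ`. -/
def Negligible {D : Type*} [Ring D] [Algebra ℝ D] (θ : EquivEnd σ →ₐ[ℝ] D) (q : EquivEnd ρ) :
    Prop :=
  ∀ (f : IntertwiningMap ρ σ) (g : IntertwiningMap σ ρ), θ (f.comp (q.comp g)) = 0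

section Negligible

variable {D : Type*} [Ring D] [Algebra ℝ D] {θ : EquivEnd σ →ₐ[ℝ] D}

theorem Negligible.add {q q' : EquivEnd ρ} (h : Negligible θ q) (h' : Negligible θ q') :
    Negligible θ (q + q') := fun f g => by
  rw [IntertwiningMap.comp_add, IntertwiningMap.add_comp, map_add, h, h', add_zero]

theorem Negligible.sum {ι : Type*} (s : Finset ι) {q : ι → EquivEnd ρ}
    (h : ∀ i ∈ s, Negligible θ (q i)) : Negligible θ (∑ i ∈ s, q i) := fun f g => by
  rw [sum_comp, comp_sum, map_sum]
  exact Finset.sum_eq_zero fun i hi => h i hi f g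

theorem negligible_comp (h : ∀ (f : IntertwiningMap τ σ) (g : IntertwiningMap σ τ),
    θ (f.comp g) = 0) (i : IntertwiningMap τ ρ) (p : IntertwiningMap ρ τ) :
    Negligible θ (i.comp p) := fun f g => h (f.comp i) (p.comp g)

theorem Copies.negligible_proj (h : ∀ (f : IntertwiningMap τ σ) (g : IntertwiningMap σ τ),
    θ (f.comp g) = 0) (P : Copies ρ τ n) : Negligible θ P.proj :=
  Negligible.sum _ fun _ _ => negligible_comp h _ _

/-- The action of an endomorphism on a summand `σ ^ n`, as a matrix modulo the kernel of `θ`. -/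
noncomputable def Copies.blockHom (P : Copies ρ σ n) (θ : EquivEnd σ →ₐ[ℝ] D)
    (h : Negligible θ (1 - P.proj)) : EquivEnd ρ →ₐ[ℝ] Matrix (Fin n) (Fin n) D :=
  AlgHom.ofLinearMap
    { toFun := fun A => Matrix.of fun a b => θ ((P.pr a).comp (A.comp (P.inj b)))
      map_add' := fun A B => by
        ext a b
        simp [IntertwiningMap.comp_add, IntertwiningMap.add_comp]
      map_smul' := fun c A => by
        ext a b
        simp [IntertwiningMap.smul_comp, IntertwiningMap.comp_smul] }
    (by
      ext a b
      change θ ((P.pr a).comp (P.inj b)) = _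
      rw [P.pr_inj, Matrix.one_apply, apply_ite θ, map_one, map_zero])
    (fun A B => by
      ext a b
      change θ ((P.pr a).comp ((A * B).comp (P.inj b))) =
        ∑ c, θ ((P.pr a).comp (A.comp (P.inj c))) * θ ((P.pr c).comp (B.comp (P.inj b)))
      -- Between `A` and `B` the projection to the summand produces the matrix product, and its
      -- complement is killed by θ.
      have h1 : A * B = A * (1 - P.proj) * B + A * P.proj * B := by
        rw [← add_mul, ← mul_add, sub_add_cancel, mul_one]
      have h2 : A * P.proj * B = ∑ c, A.comp (((P.inj c).comp (P.pr c)).comp B) := by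
        rw [mul_assoc, Copies.proj, Finset.sum_mul, Finset.mul_sum]
        rfl
      rw [h1, IntertwiningMap.comp_add, IntertwiningMap.add_comp, map_add, h2, sum_comp, comp_sum,
        map_sum]
      refine (congrArg₂ _ (h ((P.pr a).comp A) (B.comp (P.inj b))) rfl).trans ?_
      rw [zero_add]
      refine Finset.sum_congr rfl fun c _ => ?_
      rw [← map_mul]
      rfl)

theorem Copies.blockHom_apply (P : Copies ρ σ n) (h : Negligible θ (1 - P.proj)) (A : EquivEnd ρ)
    (a b : Fin n) : P.blockHom θ h A a b = θ ((P.pr a).comp (A.comp (P.inj b))) := rfl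

theorem Copies.blockHom_eq_zero (P : Copies ρ σ n) (h : Negligible θ (1 - P.proj))
    {A : EquivEnd ρ} (hA : Negligible θ A) : P.blockHom θ h A = 0 := by
  ext a b
  exact hA _ _

/-- The endomorphism of a summand `σ ^ n` given by a matrix. -/
def Copies.ofMatrix (P : Copies ρ σ n) (M : Matrix (Fin n) (Fin n) (EquivEnd σ)) : EquivEnd ρ :=
  ∑ a, ∑ b, (P.inj a).comp ((M a b).comp (P.pr b))

theorem Copies.blockHom_ofMatrix (P : Copies ρ σ n) (h : Negligible θ (1 - P.proj))
    (M : Matrix (Fin n) (Fin n) (EquivEnd σ)) : P.blockHom θ h (P.ofMatrix M) = M.map θ := by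
  ext a b
  rw [blockHom_apply, ofMatrix, Matrix.map_apply]
  congr 1
  have key : ∀ c d, (P.pr a).comp (((P.inj c).comp ((M c d).comp (P.pr d))).comp (P.inj b)) =
      (if a = c then (1 : EquivEnd σ) else 0) * M c d * (if d = b then 1 else 0) := by
    intro c d
    rw [← P.pr_inj, ← P.pr_inj]
    rfl
  simp only [sum_comp, comp_sum, key]
  simp

theorem Copies.negligible_ofMatrix (h : ∀ (f : IntertwiningMap τ σ) (g : IntertwiningMap σ τ),
    θ (f.comp g) = 0) (P : Copies ρ τ n) (M : Matrix (Fin n) (Fin n) (EquivEnd τ)) :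
    Negligible θ (P.ofMatrix M) :=
  Negligible.sum _ fun _ _ => Negligible.sum _ fun _ _ => negligible_comp h _ _

/-- By cyclicity the trace is the sum of the traces of the diagonal entries `pr a ∘ A ∘ inj a`. Each
is killed by θ, hence nilpotent, hence of trace zero. -/
theorem Copies.trace_mul_proj [FiniteDimensional ℝ V] [FiniteDimensional ℝ W] (P : Copies ρ σ n)
    (hθ : ∀ A, θ A = 0 → IsNilpotent A) (h : Negligible θ (1 - P.proj)) {A : EquivEnd ρ}
    (hA : P.blockHom θ h A = 0) : LinearMap.trace ℝ W (toEnd ρ (A * P.proj)) = 0 := by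
  rw [Copies.proj, Finset.mul_sum, map_sum, map_sum]
  refine Finset.sum_eq_zero fun a _ => ?_
  have h1 : θ ((P.pr a).comp (A.comp (P.inj a))) = 0 := by
    rw [← P.blockHom_apply h, hA, Matrix.zero_apply]
  have h2 := (LinearMap.isNilpotent_trace_of_isNilpotent ((hθ _ h1).map (toEnd σ))).eq_zero
  rw [← h2]
  exact LinearMap.trace_comp_comm' (P.pr a).toLinearMap (A.comp (P.inj a)).toLinearMap

end Negligible

/-- The copies of `σ i` in a direct sum with multiplicities. -/
noncomputable def sumCopies {k : ℕ} {V : Fin k → Type*} [∀ i, AddCommGroup (V i)]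
    [∀ i, Module ℝ (V i)] (σ : ∀ i, Representation ℝ S (V i)) (m : Fin k → ℕ) (i : Fin k) :
    Copies (sumWithMult σ m) (σ i) (m i) where
  inj a := ⟨DirectSum.lof ℝ (Σ i, Fin (m i)) (fun p => V p.1) ⟨i, a⟩, fun g => by
    refine LinearMap.ext fun x => ?_
    exact (DirectSum.lmap_lof (fun p : (Σ i, Fin (m i)) => σ p.1 g) ⟨i, a⟩ x).symm⟩
  pr a := ⟨DirectSum.component ℝ (Σ i, Fin (m i)) (fun p => V p.1) ⟨i, a⟩, fun g => by
    ext x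
    rfl⟩
  pr_inj a b := by
    ext x
    split_ifs with hab
    · subst hab
      exact DirectSum.component.lof_self ℝ (M := fun p : (Σ i, Fin (m i)) => V p.1) ⟨i, a⟩ x
    · refine (DirectSum.component.of ℝ (M := fun p : (Σ i, Fin (m i)) => V p.1)
        ⟨i, a⟩ ⟨i, b⟩ x).trans (dif_neg fun h => hab ?_)
      simpa [eq_comm] using h

theorem sum_proj_sumCopies {k : ℕ} {V : Fin k → Type*} [∀ i, AddCommGroup (V i)]
    [∀ i, Module ℝ (V i)] (σ : ∀ i, Representation ℝ S (V i)) (m : Fin k → ℕ) :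
    ∑ i, (sumCopies σ m i).proj = 1 := by
  have h1 : ∑ i, (sumCopies σ m i).proj = ∑ p : (Σ i, Fin (m i)),
      ((sumCopies σ m p.1).inj p.2).comp ((sumCopies σ m p.1).pr p.2) := by
    rw [Fintype.sum_sigma]
    rfl
  rw [h1]
  apply IntertwiningMap.ext
  rw [IntertwiningMap.toLinearMap_sum]
  refine LinearMap.ext fun x => ?_
  rw [LinearMap.sum_apply]
  refine (Finset.sum_congr rfl fun p _ => ?_).trans
    (DirectSum.sum_univ_of (β := fun p : (Σ i, Fin (m i)) => V p.1) x)
  rfl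

end Copies

/-! ### All isotypic summands of one type -/

section Families

variable {S : Type*} [Monoid S] {W : Type*} [AddCommGroup W] [Module ℝ W]
  {ρ : Representation ℝ S W}
  {k : ℕ} {V : Fin k → Type*} [∀ i, AddCommGroup (V i)] [∀ i, Module ℝ (V i)]
  {σ : ∀ i, Representation ℝ S (V i)} {m : Fin k → ℕ} {D : Type*} [Ring D] [Algebra ℝ D]

theorem negligible_one_sub_proj (P : ∀ i, Copies ρ (σ i) (m i)) {i : Fin k}
    {θ : EquivEnd (σ i) →ₐ[ℝ] D} (h : ∀ j, i ≠ j → Negligible θ (P j).proj) {R : EquivEnd ρ}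
    (hR : Negligible θ R) (hsum : ∑ j, (P j).proj + R = 1) : Negligible θ (1 - (P i).proj) := by
  have h1 : 1 - (P i).proj = ∑ j ∈ Finset.univ.erase i, (P j).proj + R := by
    rw [← hsum, ← Finset.add_sum_erase _ _ (Finset.mem_univ i), add_assoc, add_sub_cancel_left]
  rw [h1]
  exact (Negligible.sum _ fun j hj => h j (Finset.ne_of_mem_erase hj).symm).add hR

theorem blockHom_sum_ofMatrix (P : ∀ i, Copies ρ (σ i) (m i)) {i : Fin k}
    {θ : EquivEnd (σ i) →ₐ[ℝ] D} (hq : Negligible θ (1 - (P i).proj))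
    (M : ∀ i, Matrix (Fin (m i)) (Fin (m i)) (EquivEnd (σ i)))
    (h : ∀ j, i ≠ j → Negligible θ ((P j).ofMatrix (M j)))
    {R : EquivEnd ρ} (hR : Negligible θ R) :
    (P i).blockHom θ hq (∑ j, (P j).ofMatrix (M j) + R) = (M i).map θ := by
  rw [map_add, (P i).blockHom_eq_zero hq hR, add_zero, map_sum,
    Finset.sum_eq_single_of_mem i (Finset.mem_univ i) fun j _ hj =>
      (P i).blockHom_eq_zero hq (h j hj.symm), (P i).blockHom_ofMatrix]

/-- The actions of an endomorphism on the isotypic summands. -/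
noncomputable def blocksHom (P : ∀ i, Copies ρ (σ i) (m i)) (θ : ∀ i, EquivEnd (σ i) →ₐ[ℝ] D)
    (hq : ∀ i, Negligible (θ i) (1 - (P i).proj)) : EquivEnd ρ →ₐ[ℝ] (∀ i, MatEnd D (m i)) :=
  AlgHom.pi fun i => (matrixEquivEnd (m i) D).toAlgHom.comp ((P i).blockHom (θ i) (hq i))

theorem trace_mul_sum_proj [∀ i, FiniteDimensional ℝ (V i)] [FiniteDimensional ℝ W]
    (P : ∀ i, Copies ρ (σ i) (m i)) (θ : ∀ i, EquivEnd (σ i) →ₐ[ℝ] D)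
    (hθ : ∀ i A, θ i A = 0 → IsNilpotent A)
    (hq : ∀ i, Negligible (θ i) (1 - (P i).proj)) {A : EquivEnd ρ} (hA : blocksHom P θ hq A = 0) :
    LinearMap.trace ℝ W (toEnd ρ (A * ∑ i, (P i).proj)) = 0 := by
  rw [Finset.mul_sum, map_sum, map_sum]
  refine Finset.sum_eq_zero fun i _ => (P i).trace_mul_proj (hθ i) (hq i) ?_
  exact (matrixEquivEnd (m i) D).injective ((congrFun hA i).trans (map_zero _).symm)

/-- R leaves room for lifts on the summands of the other two types. The choice of M is independent
of R, so the three types can be lifted separately and added. -/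
theorem exists_blocksHom_eq (P : ∀ i, Copies ρ (σ i) (m i)) (θ : ∀ i, EquivEnd (σ i) →ₐ[ℝ] D)
    (hs : ∀ i, Function.Surjective (θ i)) (hq : ∀ i, Negligible (θ i) (1 - (P i).proj))
    (h : ∀ i j, i ≠ j → ∀ (f : IntertwiningMap (σ j) (σ i)) (g : IntertwiningMap (σ i) (σ j)),
      θ i (f.comp g) = 0) (x : ∀ i, MatEnd D (m i)) :
    ∃ M : ∀ i, Matrix (Fin (m i)) (Fin (m i)) (EquivEnd (σ i)), ∀ R : EquivEnd ρ,
      (∀ i, Negligible (θ i) R) → blocksHom P θ hq (∑ j, (P j).ofMatrix (M j) + R) = x := by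
  choose M hM using fun i => fun a b => hs i ((matrixEquivEnd (m i) D).symm (x i) a b)
  refine ⟨M, fun R hR => funext fun i => ?_⟩
  change matrixEquivEnd (m i) D ((P i).blockHom (θ i) (hq i) _) = x i
  rw [blockHom_sum_ofMatrix P (hq i) M (fun j hj => (P j).negligible_ofMatrix (h i j hj) _) (hR i),
    ← (matrixEquivEnd (m i) D).apply_symm_apply (x i)]
  congr 1
  ext a b
  exact hM i a b

end Families

/-! ### End(W) modulo a nil ideal -/

section Decomposition

variable {S : Type*} [Monoid S]
    {W : Type*} [AddCommGroup W] [Module ℝ W] [FiniteDimensional ℝ W]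
    (ρ : Representation ℝ S W)
    {u v w : ℕ}
    {VR : Fin u → Type*} [∀ i, AddCommGroup (VR i)] [∀ i, Module ℝ (VR i)]
    [∀ i, FiniteDimensional ℝ (VR i)]
    (σR : ∀ i, Representation ℝ S (VR i))
    {VC : Fin v → Type*} [∀ i, AddCommGroup (VC i)] [∀ i, Module ℝ (VC i)]
    [∀ i, FiniteDimensional ℝ (VC i)]
    (σC : ∀ i, Representation ℝ S (VC i))
    {VH : Fin w → Type*} [∀ i, AddCommGroup (VH i)] [∀ i, Module ℝ (VH i)]
    [∀ i, FiniteDimensional ℝ (VH i)]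
    (σH : ∀ i, Representation ℝ S (VH i))
    (r : Fin u → ℕ) (c : Fin v → ℕ) (h : Fin w → ℕ)

theorem exists_copies (e : ρ.Equiv ((sumWithMult σR r).prod
      ((sumWithMult σC c).prod (sumWithMult σH h)))) :
    ∃ (PR : ∀ i, Copies ρ (σR i) (r i)) (PC : ∀ i, Copies ρ (σC i) (c i))
      (PH : ∀ i, Copies ρ (σH i) (h i)),
      ∑ i, (PR i).proj + (∑ i, (PC i).proj + ∑ i, (PH i).proj) = 1 := by
  let τR := sumWithMult σR r
  let τC := sumWithMult σC c
  let τH := sumWithMult σH h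
  let E := e.toIntertwiningMap
  let F := e.symm.toIntertwiningMap
  have hEF : ∀ x, E (F x) = x := e.apply_symm_apply
  have hFE : ∀ x, F (E x) = x := e.symm_apply_apply
  let iR : IntertwiningMap τR ρ := F.comp (.inl ℝ τR (τC.prod τH))
  let iC : IntertwiningMap τC ρ := F.comp ((IntertwiningMap.inr ℝ τR (τC.prod τH)).comp
    (.inl ℝ τC τH))
  let iH : IntertwiningMap τH ρ := F.comp ((IntertwiningMap.inr ℝ τR (τC.prod τH)).comp
    (.inr ℝ τC τH))
  let pR : IntertwiningMap ρ τR := (IntertwiningMap.fst ℝ τR (τC.prod τH)).comp E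
  let pC : IntertwiningMap ρ τC := (IntertwiningMap.fst ℝ τC τH).comp
    ((IntertwiningMap.snd ℝ τR (τC.prod τH)).comp E)
  let pH : IntertwiningMap ρ τH := (IntertwiningMap.snd ℝ τC τH).comp
    ((IntertwiningMap.snd ℝ τR (τC.prod τH)).comp E)
  have hR : pR.comp iR = (1 : EquivEnd τR) :=
    IntertwiningMap.ext (LinearMap.ext fun x => congrArg Prod.fst (hEF (x, 0)))
  have hC : pC.comp iC = (1 : EquivEnd τC) :=
    IntertwiningMap.ext (LinearMap.ext fun x => congrArg (fun y => y.2.1) (hEF (0, x, 0)))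
  have hH : pH.comp iH = (1 : EquivEnd τH) :=
    IntertwiningMap.ext (LinearMap.ext fun x => congrArg (fun y => y.2.2) (hEF (0, 0, x)))
  refine ⟨fun i => (sumCopies σR r i).map iR pR hR, fun i => (sumCopies σC c i).map iC pC hC,
    fun i => (sumCopies σH h i).map iH pH hH, ?_⟩
  simp only [Copies.proj_map, ← comp_sum, ← sum_comp, sum_proj_sumCopies]
  refine IntertwiningMap.ext (LinearMap.ext fun x => ?_)
  change F ((E x).1, 0) + (F (0, (E x).2.1, 0) + F (0, 0, (E x).2.2)) = x
  change F.toLinearMap ((E x).1, 0) + (F.toLinearMap (0, (E x).2.1, 0) +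
    F.toLinearMap (0, 0, (E x).2.2)) = x
  rw [← map_add, ← map_add]
  simpa using hFE x

variable {ρ σR σC σH r c h}

/-- Composites through a different indecomposable vanish under θ, so reading off the diagonal blocks
is multiplicative and the blocks can be prescribed independently. -/
theorem exists_blockAlg_hom (hR : ∀ i, IsRealType (σR i))
    (hR' : ∀ i j, i ≠ j → IsEmpty ((σR i).Equiv (σR j)))
    (hC : ∀ i, IsComplexType (σC i))
    (hC' : ∀ i j, i ≠ j → IsEmpty ((σC i).Equiv (σC j)))
    (hH : ∀ i, IsQuaternionicType (σH i))
    (hH' : ∀ i j, i ≠ j → IsEmpty ((σH i).Equiv (σH j)))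
    (e : ρ.Equiv ((sumWithMult σR r).prod ((sumWithMult σC c).prod (sumWithMult σH h)))) :
    ∃ π : EquivEnd ρ →ₐ[ℝ] BlockAlg r c h, Function.Surjective π ∧
      ∀ A, π A = 0 → IsNilpotent A := by
  obtain ⟨PR, PC, PH, hsum⟩ := exists_copies ρ σR σC σH r c h e
  choose θR sR kR using fun i => (hR i).2
  choose θC sC kC using fun i => (hC i).2
  choose θH sH kH using fun i => (hH i).2
  have d1 : finrank ℝ ℝ = 1 := finrank_self ℝ
  have d2 : finrank ℝ ℂ = 2 := Complex.finrank_real_complex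
  have d4 : finrank ℝ ℍ[ℝ] = 4 := Quaternion.finrank_eq_four
  -- Representations of different types are not isomorphic, since the dimensions 1, 2 and 4 differ.
  have eRC : ∀ i j, IsEmpty ((σR i).Equiv (σC j)) := fun i j => ⟨fun e => by
    have := (hR i).2.finrank_eq (hC j).2 e; omega⟩
  have eRH : ∀ i j, IsEmpty ((σR i).Equiv (σH j)) := fun i j => ⟨fun e => by
    have := (hR i).2.finrank_eq (hH j).2 e; omega⟩
  have eCH : ∀ i j, IsEmpty ((σC i).Equiv (σH j)) := fun i j => ⟨fun e => by
    have := (hC i).2.finrank_eq (hH j).2 e; omega⟩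
  have zRR : ∀ i j, i ≠ j → ∀ (f : IntertwiningMap (σR j) (σR i))
      (g : IntertwiningMap (σR i) (σR j)), θR i (f.comp g) = 0 := fun i j hij =>
    map_comp_eq_zero (hR i).1.1 (hR j).1 (hR' j i hij.symm) (θR i) (sR i) fun A => (kR i A).1
  have zRC : ∀ i j (f : IntertwiningMap (σC j) (σR i))
      (g : IntertwiningMap (σR i) (σC j)), θR i (f.comp g) = 0 := fun i j =>
    map_comp_eq_zero (hR i).1.1 (hC j).1 ⟨fun e => (eRC i j).elim e.symm⟩ (θR i) (sR i)
      fun A => (kR i A).1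
  have zRH : ∀ i j (f : IntertwiningMap (σH j) (σR i))
      (g : IntertwiningMap (σR i) (σH j)), θR i (f.comp g) = 0 := fun i j =>
    map_comp_eq_zero (hR i).1.1 (hH j).1 ⟨fun e => (eRH i j).elim e.symm⟩ (θR i) (sR i)
      fun A => (kR i A).1
  have zCR : ∀ i j (f : IntertwiningMap (σR j) (σC i))
      (g : IntertwiningMap (σC i) (σR j)), θC i (f.comp g) = 0 := fun i j =>
    map_comp_eq_zero (hC i).1.1 (hR j).1 (eRC j i) (θC i) (sC i)
      fun A => (kC i A).1
  have zCC : ∀ i j, i ≠ j → ∀ (f : IntertwiningMap (σC j) (σC i))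
      (g : IntertwiningMap (σC i) (σC j)), θC i (f.comp g) = 0 := fun i j hij =>
    map_comp_eq_zero (hC i).1.1 (hC j).1 (hC' j i hij.symm) (θC i) (sC i) fun A => (kC i A).1
  have zCH : ∀ i j (f : IntertwiningMap (σH j) (σC i))
      (g : IntertwiningMap (σC i) (σH j)), θC i (f.comp g) = 0 := fun i j =>
    map_comp_eq_zero (hC i).1.1 (hH j).1 ⟨fun e => (eCH i j).elim e.symm⟩ (θC i) (sC i)
      fun A => (kC i A).1
  have zHR : ∀ i j (f : IntertwiningMap (σR j) (σH i))
      (g : IntertwiningMap (σH i) (σR j)), θH i (f.comp g) = 0 := fun i j =>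
    map_comp_eq_zero (hH i).1.1 (hR j).1 (eRH j i) (θH i) (sH i)
      fun A => (kH i A).1
  have zHC : ∀ i j (f : IntertwiningMap (σC j) (σH i))
      (g : IntertwiningMap (σH i) (σC j)), θH i (f.comp g) = 0 := fun i j =>
    map_comp_eq_zero (hH i).1.1 (hC j).1 (eCH j i) (θH i) (sH i)
      fun A => (kH i A).1
  have zHH : ∀ i j, i ≠ j → ∀ (f : IntertwiningMap (σH j) (σH i))
      (g : IntertwiningMap (σH i) (σH j)), θH i (f.comp g) = 0 := fun i j hij =>
    map_comp_eq_zero (hH i).1.1 (hH j).1 (hH' j i hij.symm) (θH i) (sH i) fun A => (kH i A).1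
  have qR : ∀ i, Negligible (θR i) (1 - (PR i).proj) := fun i =>
    negligible_one_sub_proj PR (fun j hj => (PR j).negligible_proj (zRR i j hj))
      ((Negligible.sum _ fun j _ => (PC j).negligible_proj (zRC i j)).add
        (Negligible.sum _ fun j _ => (PH j).negligible_proj (zRH i j)))
      hsum
  have qC : ∀ i, Negligible (θC i) (1 - (PC i).proj) := fun i =>
    negligible_one_sub_proj PC (fun j hj => (PC j).negligible_proj (zCC i j hj))
      ((Negligible.sum _ fun j _ => (PR j).negligible_proj (zCR i j)).add
        (Negligible.sum _ fun j _ => (PH j).negligible_proj (zCH i j)))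
      (by rw [← hsum]; abel)
  have qH : ∀ i, Negligible (θH i) (1 - (PH i).proj) := fun i =>
    negligible_one_sub_proj PH (fun j hj => (PH j).negligible_proj (zHH i j hj))
      ((Negligible.sum _ fun j _ => (PR j).negligible_proj (zHR i j)).add
        (Negligible.sum _ fun j _ => (PC j).negligible_proj (zHC i j)))
      (by rw [← hsum]; abel)
  refine ⟨(blocksHom PR θR qR).prod ((blocksHom PC θC qC).prod (blocksHom PH θH qH)), ?_, ?_⟩
  · rintro ⟨x, y, z⟩
    obtain ⟨M, hM⟩ := exists_blocksHom_eq PR θR sR qR zRR x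
    obtain ⟨N, hN⟩ := exists_blocksHom_eq PC θC sC qC zCC y
    obtain ⟨O, hO⟩ := exists_blocksHom_eq PH θH sH qH zHH z
    refine ⟨∑ j, (PR j).ofMatrix (M j) + (∑ j, (PC j).ofMatrix (N j) +
      ∑ j, (PH j).ofMatrix (O j)), Prod.ext ?_ (Prod.ext ?_ ?_)⟩
    · exact hM _ fun i =>
        (Negligible.sum _ fun j _ => (PC j).negligible_ofMatrix (zRC i j) _).add
          (Negligible.sum _ fun j _ => (PH j).negligible_ofMatrix (zRH i j) _)
    · rw [add_left_comm]
      exact hN _ fun i =>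
        (Negligible.sum _ fun j _ => (PR j).negligible_ofMatrix (zCR i j) _).add
          (Negligible.sum _ fun j _ => (PH j).negligible_ofMatrix (zCH i j) _)
    · rw [← add_assoc, add_comm]
      exact hO _ fun i =>
        (Negligible.sum _ fun j _ => (PR j).negligible_ofMatrix (zHR i j) _).add
          (Negligible.sum _ fun j _ => (PC j).negligible_ofMatrix (zHC i j) _)
  · intro A hA
    -- The projections to all summands add up to 1, so the trace of `B` is the sum of the traces on
    -- the isotypic summands, each of which is zero.
    refine isNilpotent_of_trace_eq_zero _ (fun B hB => ?_) hA
    have h1 := trace_mul_sum_proj PR θR (fun i A => (kR i A).1) qR (congrArg Prod.fst hB)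
    have h2 := trace_mul_sum_proj PC θC (fun i A => (kC i A).1) qC
      (congrArg (fun y => y.2.1) hB)
    have h3 := trace_mul_sum_proj PH θH (fun i A => (kH i A).1) qH
      (congrArg (fun y => y.2.2) hB)
    have h4 : B = B * ∑ i, (PR i).proj + (B * ∑ i, (PC i).proj + B * ∑ i, (PH i).proj) := by
      rw [← mul_add, ← mul_add, hsum, mul_one]
    change LinearMap.trace ℝ W (toEnd ρ B) = 0
    rw [h4, map_add, map_add, map_add, map_add, h1, h2, h3, add_zero, add_zero]

end Decomposition

end MonoidRep

theorem theorem3p2 {S : Type*} [Monoid S]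
    {W : Type*} [AddCommGroup W] [Module ℝ W] [FiniteDimensional ℝ W]
    (ρ : Representation ℝ S W)
    {u v w : ℕ}
    -- the indecomposable representations of real type
    {VR : Fin u → Type*} [∀ i, AddCommGroup (VR i)] [∀ i, Module ℝ (VR i)]
    [∀ i, FiniteDimensional ℝ (VR i)]
    (σR : ∀ i, Representation ℝ S (VR i))
    (hR : ∀ i, MonoidRep.IsRealType (σR i))
    (hR' : ∀ i j, i ≠ j → IsEmpty ((σR i).Equiv (σR j)))
    -- the indecomposable representations of complex type
    {VC : Fin v → Type*} [∀ i, AddCommGroup (VC i)] [∀ i, Module ℝ (VC i)]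
    [∀ i, FiniteDimensional ℝ (VC i)]
    (σC : ∀ i, Representation ℝ S (VC i))
    (hC : ∀ i, MonoidRep.IsComplexType (σC i))
    (hC' : ∀ i j, i ≠ j → IsEmpty ((σC i).Equiv (σC j)))
    -- the indecomposable representations of quaternionic type
    {VH : Fin w → Type*} [∀ i, AddCommGroup (VH i)] [∀ i, Module ℝ (VH i)]
    [∀ i, FiniteDimensional ℝ (VH i)]
    (σH : ∀ i, Representation ℝ S (VH i))
    (hH : ∀ i, MonoidRep.IsQuaternionicType (σH i))
    (hH' : ∀ i j, i ≠ j → IsEmpty ((σH i).Equiv (σH j)))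
    -- the multiplicities, and the decomposition of `W`
    (r : Fin u → ℕ) (c : Fin v → ℕ) (h : Fin w → ℕ)
    (hW : Nonempty (ρ.Equiv ((MonoidRep.sumWithMult σR r).prod
      ((MonoidRep.sumWithMult σC c).prod (MonoidRep.sumWithMult σH h))))) :
    MonoidRep.IsUnionOfInvariantSubmanifolds ρ (MonoidRep.nilSet ρ ρ)
      (∑ i, r i + ∑ i, 2 * c i + ∑ i, 4 * h i) ∧
    MonoidRep.IsUnionOfInvariantSubmanifolds ρ (MonoidRep.cenSet ρ ρ)
      (∑ i, ⌈(r i : ℚ) / 2⌉₊ + ∑ i, c i + ∑ i, h i) := by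
  obtain ⟨e⟩ := hW
  obtain ⟨π, hπ, hk⟩ := MonoidRep.exists_blockAlg_hom hR hR' hC hC' hH hH' e
  exact ⟨(MonoidRep.hasStrat_nilpotent_blockAlg r c h).isUnionOfInvariantSubmanifolds π hπ
      fun A => (MonoidRep.mem_nilSet_self ρ A).trans (MonoidRep.isNilpotent_iff_of_ker π hk A),
    (MonoidRep.hasStrat_cen_blockAlg r c h).isUnionOfInvariantSubmanifolds π hπ
      fun A => (MonoidRep.mem_cenSet_self_iff_isCen A).trans (MonoidRep.isCen_iff_of_ker π hk A)⟩
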